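/- Let $0\le k<d$ be integers and $\lambda>0$. Let $\Psi=\sum_{i\ge1}\delta_{(P_i,V_i)}$ be a Poisson point process on $\mathbb R\times S^{d-1}_+$, where $S^{d-1}_+=\{v\in\mathbb R^d:\|v\|=1,\ v_d\ge 0\}$, with intensity measure $\lambda\,dp\otimes\Theta(dv)$, $\Theta$ being the uniform distribution on $S^{d-1}_+$. With $H(p,v)=\{x\in\mathbb R^d:\langle x,v\rangle=p\}$, the hyperplanes $H(P_i,V_i)$, $i\ge 1$, form a stationary and isotropic Poisson hyperplane process $\Phi$ with intensity $\lambda$. Let $\Phi_k$ be the process of all $k$-flats arising as intersections of $d-k$ distinct hyperplanes of $\Phi$. Write $B_r^n$ for the closed ball of radius $r$ centred at the origin of $\mathbb R^n$, $\nu_n$ for Lebesgue measure on $\mathbb R^n$ ($\nu_0$ is counting measure), and $\kappa_n=\nu_n(B_1^n)=\pi^{n/2}/\Gamma(n/2+1)$. Let $\Psi_k(B_r^d)$ be the number of $k$-flats of $\Phi_k$ (with multiplicity) hitting $B_r^d$. The intensity of $\Phi_k$ is $\lambda_k=\mathbb E\Psi_k(B_1^d)/\kappa_{d-k}$, and its estimator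 is $\widehat\lambda_{k,r}=\Psi_k(B_r^d)/\nu_{d-k}(B_r^{d-k})$. Put $$a_{d,k}=\binom dk\frac{\kappa_d}{\kappa_k}\Big(\frac{\kappa_{d-1}}{d\kappa_d}\Big)^{d-k},\qquad b_j=\frac{2^{j-1}(j-1)!\,\kappa_{j-1}}{\sqrt{2\,(2j-1)!}\;\kappa_j}\quad(j\ge1),$$ and let $z_q$ denote the $q$-quantile of the standard normal distribution. Then: 1. $\mathbb E\Psi_k(B_r^d)=\lambda_k\kappa_{d-k}r^{d-k}$ for all $r>0$, that is, $\mathbb E\widehat\lambda_{k,r}=\lambda_k$. 2. As $r\to\infty$, $$\frac{\sqrt r}{b_{d-k}}\,a_{d,k}^{-1/(2(d-k))}\Big(\widehat\lambda_{k,r}^{\,1/(2(d-k))}-\lambda_k^{1/(2(d-k))}\Big)\xrightarrow{d}\mathcal N(0,1).$$ 3. For every $\alpha\in(0,1)$, $\mathbb P(\lambda_k\in I_{k,r}^{(d)}(\alpha))\to1-\alpha$ as $r\to\infty$, where $$I_{k,r}^{(d)}(\alpha)=\bigg[\Big(\widehat\lambda_{k,r}^{\,1/(2(d-k))}-\tfrac{a_{d,k}^{1/(2(d-k))}b_{d-k}}{\sqrt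 r}z_{1-\alpha/2}\Big)^{2(d-k)},\ \Big(\widehat\lambda_{k,r}^{\,1/(2(d-k))}+\tfrac{a_{d,k}^{1/(2(d-k))}b_{d-k}}{\sqrt r}z_{1-\alpha/2}\Big)^{2(d-k)}\bigg].$$ 4. $\lambda=(\lambda_k/a_{d,k})^{1/(d-k)}$, and for every $\alpha\in(0,1)$, $\mathbb P(\lambda\in J_{k,r}^{(d)}(\alpha))\to1-\alpha$ as $r\to\infty$, where $$J_{k,r}^{(d)}(\alpha)=\bigg[\Big(\big(\widehat\lambda_{k,r}/a_{d,k}\big)^{1/(2(d-k))}-\tfrac{b_{d-k}}{\sqrt r}z_{1-\alpha/2}\Big)^{2},\ \Big(\big(\widehat\lambda_{k,r}/a_{d,k}\big)^{1/(2(d-k))}+\tfrac{b_{d-k}}{\sqrt r}z_{1-\alpha/2}\Big)^{2}\bigg].$$ -/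

import Mathlib

open MeasureTheory ProbabilityTheory Filter Topology
open scoped ENNReal NNReal Nat

noncomputable section

/-! ### Constants -/

/-- `κ_n = π^{n/2} / Γ(n/2 + 1)`, the volume of the unit ball of `ℝⁿ` (so `κ_0 = 1`). -/
def kappa (n : ℕ) : ℝ := Real.pi ^ ((n : ℝ) / 2) / Real.Gamma ((n : ℝ) / 2 + 1)

/-- `a_{d,k} = (d choose k) (κ_d / κ_k) (κ_{d-1} / (d κ_d))^{d-k}`, used for `k < d`. -/
def aConst (d k : ℕ) : ℝ :=
  (d.choose k : ℝ) * (kappa d / kappa k) * (kappa (d - 1) / ((d : ℝ) * kappa d)) ^ (d - k)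

/-- `b_j = 2^{j-1} (j-1)! κ_{j-1} / (√(2 (2j-1)!) κ_j)`, used for `j ≥ 1`. -/
def bConst (j : ℕ) : ℝ :=
  2 ^ (j - 1) * ((j - 1)! : ℝ) * kappa (j - 1) / (Real.sqrt (2 * ((2 * j - 1)! : ℝ)) * kappa j)

/-- The `q`-quantile of the standard normal distribution. -/
def stdNormalQuantile (q : ℝ) : ℝ := sInf {x : ℝ | q ≤ cdf (gaussianReal 0 1) x}

/-! ### Hyperplanes and flats -/

/-- The unit sphere `S^{d-1}` of `ℝ^d`. -/
abbrev UnitSphere (d : ℕ) : Type := Metric.sphere (0 : EuclideanSpace ℝ (Fin d)) 1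

/-- The upper unit hemisphere `S_+^{d-1}`: the last coordinate is nonnegative. -/
def upperHemisphere (d : ℕ) : Set (UnitSphere d) :=
  {v | ∀ i : Fin d, (i : ℕ) + 1 = d → 0 ≤ (v : EuclideanSpace ℝ (Fin d)) i}

/-- The uniform distribution on the upper unit hemisphere: the normalized surface measure of the
sphere, conditioned on the hemisphere. -/
def uniformHemisphere (d : ℕ) : Measure (UnitSphere d) :=
  cond (volume : Measure (EuclideanSpace ℝ (Fin d))).toSphere (upperHemisphere d)

/-- The hyperplane `H(p, v) = {x : ⟨x, v⟩ = p}`. -/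
def hyperplane {d : ℕ} (q : ℝ × UnitSphere d) : Set (EuclideanSpace ℝ (Fin d)) :=
  {x | inner ℝ x (q.2 : EuclideanSpace ℝ (Fin d)) = q.1}

/-- `S` is a `k`-flat, i.e. a (nonempty) affine subspace of dimension `k`. -/
def IsFlat {d : ℕ} (k : ℕ) (S : Set (EuclideanSpace ℝ (Fin d))) : Prop :=
  ∃ A : AffineSubspace ℝ (EuclideanSpace ℝ (Fin d)),
    (A : Set (EuclideanSpace ℝ (Fin d))) = S ∧ S.Nonempty ∧ Module.finrank ℝ A.direction = k

/-! ### Poisson processes -/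

section Flats

variable {Ω : Type*} [MeasurableSpace Ω]

/-- The number of points of the configuration `∑ᵢ δ_{X i ω}` in `B`, with multiplicity. -/
def pointCount {𝒳 : Type*} (X : ℕ → Ω → 𝒳) (B : Set 𝒳) (ω : Ω) : ℕ∞ :=
  {i : ℕ | X i ω ∈ B}.encard

/-- `∑ᵢ δ_{X i}` is a Poisson point process with intensity measure `Λ`: the number of points in a
measurable set of finite intensity is Poisson distributed, and the numbers of points in pairwise
disjoint measurable sets are independent. -/
structure IsPoissonProcess {𝒳 : Type*} [MeasurableSpace 𝒳] (X : ℕ → Ω → 𝒳) (Λ : Measure 𝒳)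
    (P : Measure Ω) : Prop where
  measurable : ∀ i, Measurable (X i)
  poisson : ∀ B : Set 𝒳, MeasurableSet B → Λ B ≠ ∞ →
    P.map (pointCount X B) = (poissonMeasure (Λ B).toNNReal).map (fun n : ℕ => (n : ℕ∞))
  indep : ∀ (n : ℕ) (B : Fin n → Set 𝒳), (∀ j, MeasurableSet (B j)) →
    Pairwise (fun i j => Disjoint (B i) (B j)) → iIndepFun (fun j => pointCount X (B j)) P

/-- The points `X i = (P_i, V_i)` represent a stationary Poisson hyperplane process
`Φ = ∑ᵢ δ_{H(P_i, V_i)}` of intensity `lam` and orientation distribution `Θ`: they form a Poisson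
process on `ℝ × S^{d-1}` with intensity measure `lam dp ⊗ Θ(dv)`. -/
def IsPoissonHyperplaneProcess {d : ℕ} (X : ℕ → Ω → ℝ × UnitSphere d) (lam : ℝ)
    (Θ : Measure (UnitSphere d)) (P : Measure Ω) : Prop :=
  IsPoissonProcess X ((ENNReal.ofReal lam • (volume : Measure ℝ)).prod Θ) P

variable {d : ℕ}

/-- `Ψ_k(B_r^d)`: the number of `k`-flats of the intersection process `Φ_k` hitting the ball
`B_r^d`, i.e. the number of unordered choices of `d - k` distinct hyperplanes of `Φ` (whose points
`X i ω` are almost surely pairwise distinct) whose intersection is a `k`-flat that meets `B_r^d`. -/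
def flatCount (X : ℕ → Ω → ℝ × UnitSphere d) (k : ℕ) (r : ℝ) (ω : Ω) : ℕ∞ :=
  {s : Finset ℕ | s.card = d - k ∧ IsFlat k (⋂ i ∈ s, hyperplane (X i ω)) ∧
    ((⋂ i ∈ s, hyperplane (X i ω)) ∩ Metric.closedBall 0 r).Nonempty}.encard

/-- The intensity `λ_k` of `Φ_k`: the number such that `λ_k κ_{d-k}` is the expected number of
`k`-flats of `Φ_k` hitting the unit ball. -/
def flatIntensity (X : ℕ → Ω → ℝ × UnitSphere d) (P : Measure Ω) (k : ℕ) : ℝ :=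
  (∫⁻ ω, (flatCount X k 1 ω : ℝ≥0∞) ∂P).toReal / kappa (d - k)

/-- The estimator `λ̂_{k,r} = Ψ_k(B_r^d) / ν_{d-k}(B_r^{d-k})` of `λ_k`. -/
def lambdaHat (X : ℕ → Ω → ℝ × UnitSphere d) (k : ℕ) (r : ℝ) (ω : Ω) : ℝ :=
  ((flatCount X k r ω).toNat : ℝ) /
    volume.real (Metric.closedBall (0 : EuclideanSpace ℝ (Fin (d - k))) r)

/-- The confidence interval `I_{k,r}^{(d)}(α)` for `λ_k`. -/
def intervalI (X : ℕ → Ω → ℝ × UnitSphere d) (k : ℕ) (r α : ℝ) (ω : Ω) : Set ℝ :=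
  let e : ℝ := 1 / (2 * ((d - k : ℕ) : ℝ))
  let w : ℝ := aConst d k ^ e * bConst (d - k) / Real.sqrt r * stdNormalQuantile (1 - α / 2)
  Set.Icc ((lambdaHat X k r ω ^ e - w) ^ (2 * (d - k)))
    ((lambdaHat X k r ω ^ e + w) ^ (2 * (d - k)))

/-- The confidence interval `J_{k,r}^{(d)}(α)` for the intensity `λ` of the hyperplane process. -/
def intervalJ (X : ℕ → Ω → ℝ × UnitSphere d) (k : ℕ) (r α : ℝ) (ω : Ω) : Set ℝ :=
  let e : ℝ := 1 / (2 * ((d - k : ℕ) : ℝ))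
  let w : ℝ := bConst (d - k) / Real.sqrt r * stdNormalQuantile (1 - α / 2)
  Set.Icc (((lambdaHat X k r ω / aConst d k) ^ e - w) ^ 2)
    (((lambdaHat X k r ω / aConst d k) ^ e + w) ^ 2)

end Flats

end

noncomputable section

/-! ### Poisson distribution -/

/-! Write `m = d - k`. Almost surely, `m` distinct hyperplanes of the process with a common point
have independent normals. Hence `m!` times the number of flats hitting the ball of radius `r` is
almost surely the number of ordered `m`-tuples of distinct hyperplanes with a common point in that
ball, which is a Poisson U-statistic of order `m`.

Mean. By the multivariate Mecke formula (`lintegral_tupleSum`) the mean is the product measure of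
the set of such tuples, computed in `measure_hitSet` by peeling off one hyperplane at a time. A
hyperplane cuts a ball of an `n`-dimensional flat in a ball of dimension `n - 1` whose radius is
given by Pythagoras. Integrating over the offset gives a one-dimensional integral times the length
of the projection of the normal. By isotropy the mean projection length is a quotient of Gamma
functions depending on `n` only. These quotients telescope, and the duplication formula turns the
product into `m! a_{d,k} λ^m κ_m r^m`.

Fluctuations. The U-statistic is compared with its Hájek projection, a sum over single hyperplanes
of the measure `f₁` of their completions to a hitting tuple. When second moments are expanded, pairs
of tuples sharing no or one hyperplane cancel, and pairs sharing at least two contribute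
`O(r^{2m-2})`, against a variance of order `r^{2m-1}` (`integral_sub_projection_sq_le`). Since
`f₁(p, v)` is proportional to `(1 - (p/r)²)^{(m-1)/2}`, the projection is a linear statistic with a
fixed profile. Campbell's formula (`integral_exp_tsum`) gives its characteristic function, and a
Taylor expansion yields the normal limit. The result is that `√(λ r) (λ̂/λ_k - 1)` tends to a
centred normal law with standard deviation `2 m b_m`.

Variance stabilization. As `λ_k = a_{d,k} λ^m`, the power `1/(2m)` sends `λ_k` to a known constant
times `√λ`. This cancels the unknown `√λ` in the scaling, and the derivative `1/(2m)` at `1` leaves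
`b_m`. The intervals come from inverting `|Z_r| ≤ z`. The even powers of their endpoints are
harmless once the half-width is below the target, which holds for large `r`. -/

lemma lintegral_poissonMeasure_eq_tsum (r : ℝ≥0) (f : ℕ → ℝ≥0∞) :
    ∫⁻ n, f n ∂(poissonMeasure r) =
      ∑' n : ℕ, ENNReal.ofReal (Real.exp (-r) * r ^ n / n !) * f n := by
  simp [poissonMeasure, lintegral_sum_measure, lintegral_smul_measure]

lemma lintegral_cast_poissonMeasure (r : ℝ≥0) :
    ∫⁻ n : ℕ, (n : ℝ≥0∞) ∂(poissonMeasure r) = r := by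
  rw [lintegral_poissonMeasure_eq_tsum, tsum_eq_zero_add' ENNReal.summable]
  have h : ∀ n : ℕ, ENNReal.ofReal (Real.exp (-r) * r ^ (n + 1) / (n + 1)!) * ((n + 1 : ℕ) : ℝ≥0∞)
      = r * ENNReal.ofReal (Real.exp (-r) * r ^ n / n !) := by
    intro n
    rw [← ENNReal.ofReal_natCast, ← ENNReal.ofReal_mul (by positivity),
      ← ENNReal.ofReal_coe_nnreal, ← ENNReal.ofReal_mul (by positivity)]
    congr 1
    rw [Nat.factorial_succ, pow_succ]
    push_cast
    field_simp
  simp_rw [h, ENNReal.tsum_mul_left]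
  rw [← ENNReal.ofReal_tsum_of_nonneg (fun n => by positivity)
    (hasSum_one_poissonMeasure r).summable, (hasSum_one_poissonMeasure r).tsum_eq]
  simp

/-- The masses at `0` and `1` add up to `e^{-r}(1 + r) ≥ (1 - r)(1 + r)`. The quadratic order is
what excludes two points with the same offset. -/
lemma poissonMeasure_two_le (r : ℝ≥0) : poissonMeasure r {n | 2 ≤ n} ≤ (r : ℝ≥0∞) ^ 2 := by
  have hc : {n : ℕ | 2 ≤ n} = ({0, 1} : Set ℕ)ᶜ := by
    ext n
    simp only [Set.mem_ofPred_eq, Set.mem_compl_iff, Set.mem_insert_iff, Set.mem_singleton_iff]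
    omega
  have h01 : (poissonMeasure r).real {0, 1} = Real.exp (-r) * (1 + r) := by
    rw [show ({0, 1} : Set ℕ) = {0} ∪ {1} from rfl, measureReal_union (by simp) (by simp),
      poissonMeasure_real_singleton, poissonMeasure_real_singleton]
    simp
    ring
  have h : (poissonMeasure r).real {n | 2 ≤ n} ≤ (r : ℝ) ^ 2 := by
    rw [hc, probReal_compl_eq_one_sub (by measurability), h01]
    nlinarith [Real.add_one_le_exp (-(r : ℝ)), r.2]
  rw [← ENNReal.ofReal_coe_nnreal, ← ENNReal.ofReal_pow (by positivity), ← ofReal_measureReal]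
  exact ENNReal.ofReal_le_ofReal h

/-- From `x^q / q! ≤ e^x` at `x = n / r`, the bound reduces to the exponential moment `exp (r
(e^{1/r} - 1))`, which is at most `e²` because `e^x - 1 ≤ 2x` on `[0, 1]`. -/
lemma lintegral_pow_poissonMeasure_le (r : ℝ≥0) (hr : 1 ≤ r) (q : ℕ) :
    ∫⁻ n : ℕ, (n : ℝ≥0∞) ^ q ∂(poissonMeasure r) ≤
      ENNReal.ofReal (q ! * Real.exp 2 * r ^ q) := by
  have hr' : (1 : ℝ) ≤ r := hr
  have hr0 : (0 : ℝ) < r := by linarith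
  have hs : HasSum (fun n : ℕ => (r * Real.exp (1 / r)) ^ n / n !)
      (Real.exp (r * Real.exp (1 / r))) := by
    rw [Real.exp_eq_exp_ℝ]
    exact NormedSpace.expSeries_div_hasSum_exp _
  have hle : ∀ n : ℕ, ENNReal.ofReal (Real.exp (-r) * r ^ n / n !) * (n : ℝ≥0∞) ^ q ≤
      ENNReal.ofReal (q ! * r ^ q * Real.exp (-r) * ((r * Real.exp (1 / r)) ^ n / n !)) := by
    intro n
    rw [← ENNReal.ofReal_natCast, ← ENNReal.ofReal_pow (by positivity),
      ← ENNReal.ofReal_mul (by positivity)]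
    apply ENNReal.ofReal_le_ofReal
    have h1 : ((n : ℝ) / r) ^ q / q ! ≤ Real.exp (n / r) :=
      Real.pow_div_factorial_le_exp _ (by positivity) _
    have h2 : (n : ℝ) ^ q ≤ q ! * r ^ q * Real.exp (1 / r) ^ n := by
      rw [← Real.exp_nat_mul, mul_one_div]
      rw [div_pow, div_div, div_le_iff₀ (by positivity)] at h1
      linarith
    calc Real.exp (-r) * r ^ n / n ! * (n : ℝ) ^ q
        ≤ Real.exp (-r) * r ^ n / n ! * (q ! * r ^ q * Real.exp (1 / r) ^ n) := by gcongr
      _ = _ := by rw [mul_pow]; ring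
  rw [lintegral_poissonMeasure_eq_tsum]
  refine (ENNReal.tsum_le_tsum hle).trans ?_
  rw [← ENNReal.ofReal_tsum_of_nonneg (fun n => by positivity) (hs.mul_left _).summable,
    (hs.mul_left _).tsum_eq]
  apply ENNReal.ofReal_le_ofReal
  have hb : r * Real.exp (1 / r) ≤ r + 2 := by
    have h1 : |1 / (r : ℝ)| ≤ 1 := by
      rw [abs_of_pos (by positivity), div_le_one hr0]; exact hr'
    have h2 := Real.abs_exp_sub_one_le h1
    rw [abs_of_pos (a := 1 / (r : ℝ)) (by positivity)] at h2
    have h3 := (abs_le.1 h2).2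
    have h4 : (r : ℝ) * (2 * (1 / r)) = 2 := by field_simp
    nlinarith
  calc (q ! : ℝ) * r ^ q * Real.exp (-r) * Real.exp (r * Real.exp (1 / r))
      = q ! * r ^ q * Real.exp (-r + r * Real.exp (1 / r)) := by rw [Real.exp_add]; ring
    _ ≤ q ! * r ^ q * Real.exp 2 := by gcongr; linarith
    _ = _ := by ring

/-! ### Sums over tuples of distinct points -/

lemma tsum_pi_prod_eq_prod_tsum {ι : Type*} [Fintype ι] (f : ι → ℕ → ℝ≥0∞) :
    ∑' I : ι → ℕ, ∏ a, f a (I a) = ∏ a, ∑' i, f a i := by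
  classical
  have key : ∀ (n : ℕ) (f : Fin n → ℕ → ℝ≥0∞),
      ∑' I : Fin n → ℕ, ∏ a, f a (I a) = ∏ a, ∑' i, f a i := by
    intro n
    induction n with
    | zero => intro f; simp
    | succ n ih =>
      intro f
      rw [← (Fin.consEquiv (fun _ : Fin (n + 1) => ℕ)).tsum_eq, ENNReal.tsum_prod',
        Fin.prod_univ_succ]
      simp only [Fin.consEquiv, Equiv.coe_fn_mk, Fin.prod_univ_succ, Fin.cons_zero, Fin.cons_succ]
      simp_rw [ENNReal.tsum_mul_left, ih, ENNReal.tsum_mul_right]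
  let e := Fintype.equivFin ι
  rw [← (Equiv.arrowCongr e.symm (Equiv.refl ℕ)).tsum_eq]
  rw [← e.symm.prod_comp (fun a => ∑' i, f a i), ← key]
  refine tsum_congr fun I => ?_
  rw [← e.symm.prod_comp]
  simp

lemma indicator_univ_pi_one {ι 𝒳 : Type*} [Fintype ι] (B : ι → Set 𝒳) (x : ι → 𝒳) :
    (Set.univ.pi B).indicator (1 : (ι → 𝒳) → ℝ≥0∞) x = ∏ a, (B a).indicator 1 (x a) := by
  by_cases hI : ∀ a, x a ∈ B a
  · rw [Set.indicator_of_mem (by simpa using hI), Finset.prod_eq_one]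
    · rfl
    · intro a _; rw [Set.indicator_of_mem (hI a)]; rfl
  · rw [Set.indicator_of_notMem (by simpa using hI)]
    push Not at hI
    obtain ⟨a, ha⟩ := hI
    rw [Finset.prod_eq_zero (Finset.mem_univ a)]
    rw [Set.indicator_of_notMem ha]

section Tuple

variable {Ω 𝒳 : Type*}

/-- The sum of `F` over the tuples of points with distinct indices. -/
def tupleSum (X : ℕ → Ω → 𝒳) (ι : Type*) (F : (ι → 𝒳) → ℝ≥0∞) (ω : Ω) : ℝ≥0∞ :=
  ∑' I : ι → ℕ, {I : ι → ℕ | Function.Injective I}.indicator (fun I => F fun a => X (I a) ω) I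

lemma coe_pointCount_eq_tsum (X : ℕ → Ω → 𝒳) (B : Set 𝒳) (ω : Ω) :
    (pointCount X B ω : ℝ≥0∞) = ∑' i, B.indicator 1 (X i ω) := by
  rw [pointCount, ← ENNReal.tsum_set_one, tsum_subtype {i | X i ω ∈ B} fun _ => (1 : ℝ≥0∞)]
  exact tsum_congr fun i => by simp [Set.indicator]

variable [MeasurableSpace Ω] [MeasurableSpace 𝒳] {P : Measure Ω} {X : ℕ → Ω → 𝒳} {Λ : Measure 𝒳}

lemma measurable_tupleSum (hX : ∀ i, Measurable (X i)) {ι : Type*} [Finite ι]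
    {F : (ι → 𝒳) → ℝ≥0∞} (hF : Measurable F) : Measurable (tupleSum X ι F) := by
  refine Measurable.tsum fun I => ?_
  by_cases hI : Function.Injective I
  · simp only [Set.indicator, Set.mem_ofPred_eq, hI, if_true]
    exact hF.comp (measurable_pi_lambda _ fun a => hX _)
  · simp only [Set.indicator, Set.mem_ofPred_eq, hI, if_false]
    exact measurable_const

/-- As `ℕ∞` is countable, fibres suffice, and each is a fibre of the measurable `ℝ≥0∞`-valued sum of
indicators. -/
lemma measurable_pointCount (hX : ∀ i, Measurable (X i)) {B : Set 𝒳} (hB : MeasurableSet B) :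
    Measurable (pointCount X B) := by
  have h : Measurable fun ω => (pointCount X B ω : ℝ≥0∞) := by
    simp_rw [coe_pointCount_eq_tsum]
    exact Measurable.tsum fun i => (measurable_one.indicator hB).comp (hX i)
  refine measurable_to_countable' fun n => ?_
  convert! h (measurableSet_singleton (n : ℝ≥0∞)) using 1
  ext ω
  simp

namespace IsPoissonProcess

lemma lintegral_comp_pointCount (h : IsPoissonProcess X Λ P) {B : Set 𝒳} (hB : MeasurableSet B)
    (hfin : Λ B ≠ ∞) (g : ℕ∞ → ℝ≥0∞) :
    ∫⁻ ω, g (pointCount X B ω) ∂P = ∫⁻ n : ℕ, g n ∂(poissonMeasure (Λ B).toNNReal) := by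
  rw [← lintegral_map (f := g) .of_discrete (measurable_pointCount h.measurable hB),
    h.poisson B hB hfin, lintegral_map .of_discrete .of_discrete]

lemma lintegral_pointCount (h : IsPoissonProcess X Λ P) {B : Set 𝒳} (hB : MeasurableSet B)
    (hfin : Λ B ≠ ∞) : ∫⁻ ω, (pointCount X B ω : ℝ≥0∞) ∂P = Λ B := by
  rw [h.lintegral_comp_pointCount hB hfin (fun n => (n : ℝ≥0∞))]
  simp only [ENat.toENNReal_coe, lintegral_cast_poissonMeasure]
  exact ENNReal.coe_toNNReal hfin

lemma measure_two_le_pointCount (h : IsPoissonProcess X Λ P) {B : Set 𝒳} (hB : MeasurableSet B)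
    (hfin : Λ B ≠ ∞) : P {ω | 2 ≤ pointCount X B ω} ≤ Λ B ^ 2 := by
  have hm := measurable_pointCount h.measurable hB
  have : {ω | 2 ≤ pointCount X B ω} = pointCount X B ⁻¹' {n | 2 ≤ n} := rfl
  rw [this, ← Measure.map_apply hm .of_discrete, h.poisson B hB hfin,
    Measure.map_apply .of_discrete .of_discrete]
  refine le_trans (le_of_eq ?_) ((poissonMeasure_two_le (Λ B).toNNReal).trans
    (by rw [ENNReal.coe_toNNReal hfin]))
  congr 1
  ext n
  simp only [Set.preimage_ofPred_eq, Set.mem_ofPred_eq]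
  exact_mod_cast Iff.rfl

lemma ae_pointCount_lt_top (h : IsPoissonProcess X Λ P) {B : Set 𝒳} (hB : MeasurableSet B)
    (hfin : Λ B ≠ ∞) : ∀ᵐ ω ∂P, (pointCount X B ω : ℝ≥0∞) < ∞ := by
  refine ae_lt_top ?_ (by rw [h.lintegral_pointCount hB hfin]; exact hfin)
  exact Measurable.comp (g := ENat.toENNReal) .of_discrete (measurable_pointCount h.measurable hB)

/-- With disjoint sides a tuple with a repeated index never lies in the box, so the sum over
distinct indices is the full product of the counts, and independence applies. -/
lemma lintegral_tupleSum_indicator_pi (h : IsPoissonProcess X Λ P) {ι : Type*} [Fintype ι]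
    {B : ι → Set 𝒳} (hB : ∀ a, MeasurableSet (B a)) (hfin : ∀ a, Λ (B a) ≠ ∞)
    (hdisj : Pairwise fun a b => Disjoint (B a) (B b)) :
    ∫⁻ ω, tupleSum X ι ((Set.univ.pi B).indicator 1) ω ∂P = ∏ a, Λ (B a) := by
  have hsum : ∀ ω, tupleSum X ι ((Set.univ.pi B).indicator 1) ω =
      ∏ a, (pointCount X (B a) ω : ℝ≥0∞) := by
    intro ω
    simp_rw [coe_pointCount_eq_tsum]
    rw [← tsum_pi_prod_eq_prod_tsum]
    refine tsum_congr fun I => ?_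
    by_cases hI : Function.Injective I
    · rw [Set.indicator_of_mem (by exact hI), indicator_univ_pi_one]
    · rw [Set.indicator_of_notMem (by exact hI)]
      have : ∃ a b, I a = I b ∧ a ≠ b := by
        simpa [Function.Injective] using hI
      obtain ⟨a, b, hab, hne⟩ := this
      symm
      by_cases ha : X (I a) ω ∈ B a
      · refine Finset.prod_eq_zero (Finset.mem_univ b) (Set.indicator_of_notMem ?_ _)
        rw [← hab]
        exact fun hb => Set.disjoint_left.1 (hdisj hne) ha hb
      · exact Finset.prod_eq_zero (Finset.mem_univ a) (Set.indicator_of_notMem ha _)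
  simp_rw [hsum]
  let e := Fintype.equivFin ι
  have hind := h.indep (Fintype.card ι) (fun j => B (e.symm j)) (fun j => hB _)
    (fun i j hij => hdisj (by simpa using hij))
  have hind' : iIndepFun (fun (j : Fin (Fintype.card ι)) ω =>
      (pointCount X (B (e.symm j)) ω : ℝ≥0∞)) P :=
    hind.comp (fun _ => ENat.toENNReal) (fun _ => .of_discrete)
  have := lintegral_prod_eq_prod_lintegral_of_indepFun Finset.univ _ hind'
    (fun j => Measurable.comp (g := ENat.toENNReal) .of_discrete
      (measurable_pointCount h.measurable (hB _)))
  simp_rw [h.lintegral_pointCount (hB _) (hfin _)] at this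
  rw [e.symm.prod_comp (fun a => Λ (B a))] at this
  rw [← this]
  exact lintegral_congr fun ω => (e.symm.prod_comp (fun a => (pointCount X (B a) ω : ℝ≥0∞))).symm

end IsPoissonProcess

end Tuple

/-! ### Slabs in the offset variable and the diagonals of the product measure. -/

section Slab

instance (lam : ℝ) : SigmaFinite (ENNReal.ofReal lam • (volume : Measure ℝ)) :=
  inferInstanceAs (SigmaFinite (lam.toNNReal • (volume : Measure ℝ)))

/-- The slab of width `1 / N` with index `j`. -/
def slab (S : Type*) (N : ℕ) (j : ℤ) : Set (ℝ × S) := {x | ⌊(N : ℝ) * x.1⌋ = j}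

lemma disjoint_slab {S : Type*} (N : ℕ) {i j : ℤ} (h : i ≠ j) : Disjoint (slab S N i) (slab S N j) :=
  Set.disjoint_left.2 fun _ hi hj => h (hi.symm.trans hj)

variable {S : Type*} [MeasurableSpace S]

/-- The intensity measure `lam dp ⊗ Θ`. -/
abbrev markedLebesgue (lam : ℝ) (Θ : Measure S) : Measure (ℝ × S) :=
  (ENNReal.ofReal lam • (volume : Measure ℝ)).prod Θ

lemma measurableSet_slab (N : ℕ) (j : ℤ) : MeasurableSet (slab S N j) := by
  have : Measurable fun x : ℝ × S => ⌊(N : ℝ) * x.1⌋ := by fun_prop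
  exact this (measurableSet_singleton j)

lemma measure_slab (Θ : Measure S) [IsProbabilityMeasure Θ] (lam : ℝ) {N : ℕ} (hN : 0 < N)
    (j : ℤ) : markedLebesgue lam Θ (slab S N j) =
      ENNReal.ofReal lam * ENNReal.ofReal (1 / N) := by
  have hN' : (0 : ℝ) < N := by exact_mod_cast hN
  have : slab S N j = Set.Ico ((j : ℝ) / N) ((j + 1) / N) ×ˢ Set.univ := by
    ext x
    simp only [slab, Set.mem_ofPred_eq, Int.floor_eq_iff, Set.mem_prod, Set.mem_Ico, Set.mem_univ,
      and_true, div_le_iff₀ hN', lt_div_iff₀ hN', mul_comm]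
  rw [this, Measure.prod_prod, Measure.smul_apply, Real.volume_Ico, measure_univ, mul_one,
    smul_eq_mul]
  congr 2
  ring

/-- Integrating the coordinate `a` first, with the others frozen, leaves the measure of a set of
fixed offset. -/
lemma pi_diagonal_eq_zero {Λ : Measure (ℝ × S)} [SigmaFinite Λ] (hΛ : ∀ c, Λ {x | x.1 = c} = 0)
    {ι : Type*} [Fintype ι] {a b : ι} (hab : a ≠ b) :
    Measure.pi (fun _ : ι => Λ) {x | (x a).1 = (x b).1} = 0 := by
  classical
  have hm : MeasurableSet {x : ι → ℝ × S | (x a).1 = (x b).1} :=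
    measurableSet_eq_fun (by fun_prop) (by fun_prop)
  rw [← lintegral_indicator_one hm]
  -- The marginal integrals below need a base point.
  rcases isEmpty_or_nonempty (ι → ℝ × S) with he | ⟨⟨x₀⟩⟩
  · simp
  rw [lintegral_eq_lmarginal_univ x₀, lmarginal_erase' _ _ (Finset.mem_univ a)]
  · have : (fun x => ∫⁻ xₐ, {x : ι → ℝ × S | (x a).1 = (x b).1}.indicator (1 : (ι → ℝ × S) → ℝ≥0∞)
        (Function.update x a xₐ) ∂Λ) = 0 := by
      ext x
      have h1 : ∀ y, {x : ι → ℝ × S | (x a).1 = (x b).1}.indicator (1 : (ι → ℝ × S) → ℝ≥0∞)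
          (Function.update x a y) = {y : ℝ × S | y.1 = (x b).1}.indicator 1 y := by
        intro y
        simp [Set.indicator, Function.update_of_ne hab.symm]
      simp_rw [h1]
      rw [lintegral_indicator_one (measurableSet_eq_fun (by fun_prop) (by fun_prop)), hΛ]
      rfl
    rw [this]
    simp [lmarginal]
  · exact measurable_one.indicator hm

end Slab

/-! ### Factorial moment measures and the Mecke formula. -/

section Moment

variable {Ω S : Type*} [MeasurableSpace Ω] [MeasurableSpace S] {P : Measure Ω}
  {X : ℕ → Ω → ℝ × S} {Θ : Measure S} [IsProbabilityMeasure Θ] {lam : ℝ}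

/-- The moment measure of the point configuration off the diagonals. -/
def momentMeasure (X : ℕ → Ω → ℝ × S) (P : Measure Ω) (ι : Type*) : Measure (ι → ℝ × S) :=
  Measure.sum fun I : {I : ι → ℕ // Function.Injective I} => P.map fun ω a => X (I.1 a) ω

lemma lintegral_momentMeasure (hX : ∀ i, Measurable (X i)) {ι : Type*} [Finite ι]
    {F : (ι → ℝ × S) → ℝ≥0∞} (hF : Measurable F) :
    ∫⁻ x, F x ∂(momentMeasure X P ι) = ∫⁻ ω, tupleSum X ι F ω ∂P := by
  have hm : ∀ I : ι → ℕ, Measurable fun ω a => X (I a) ω :=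
    fun I => measurable_pi_lambda _ fun a => hX _
  rw [momentMeasure, lintegral_sum_measure]
  simp_rw [lintegral_map hF (hm _), tupleSum,
    ← tsum_subtype {I : ι → ℕ | Function.Injective I}]
  exact (lintegral_tsum fun I : {I : ι → ℕ // Function.Injective I} =>
    (hF.comp (hm I.1)).aemeasurable).symm

namespace IsPoissonProcess

/-- Two points with equal offset in `[-R, R)` lie in the same slab of width `1/N`. Each of the `2RN`
slabs holds two points with probability at most `(λ/N)²`, so the total is `O(1/N)`. -/
lemma ae_injective_fst (h : IsPoissonProcess X (markedLebesgue lam Θ) P) :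
    ∀ᵐ ω ∂P, ∀ i j, i ≠ j → (X i ω).1 ≠ (X j ω).1 := by
  have key : ∀ R : ℕ, P {ω | ∃ i j, i ≠ j ∧ (X i ω).1 = (X j ω).1 ∧ -(R : ℝ) ≤ (X i ω).1 ∧
      (X i ω).1 < R} = 0 := by
    intro R
    have hle : ∀ N : ℕ, 0 < N → P {ω | ∃ i j, i ≠ j ∧ (X i ω).1 = (X j ω).1 ∧
        -(R : ℝ) ≤ (X i ω).1 ∧ (X i ω).1 < R} ≤
          ENNReal.ofReal (2 * R * lam.toNNReal ^ 2 * (1 / N)) := by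
      intro N hN
      have hN' : (0 : ℝ) < N := by exact_mod_cast hN
      calc _ ≤ P (⋃ j ∈ Finset.Ico (-(R * N) : ℤ) (R * N),
            {ω | 2 ≤ pointCount X (slab S N j) ω}) := by
            apply measure_mono
            rintro ω ⟨i, j, hij, he, h1, h2⟩
            simp only [Set.mem_iUnion, Finset.mem_Ico]
            refine ⟨⌊(N : ℝ) * (X i ω).1⌋, ⟨?_, ?_⟩, ?_⟩
            · rw [Int.le_floor]; push_cast; nlinarith
            · rw [Int.floor_lt]; push_cast; nlinarith
            · have hsub : ({i, j} : Set ℕ) ⊆ {l | X l ω ∈ slab S N ⌊(N : ℝ) * (X i ω).1⌋} := by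
                rintro l (rfl | rfl)
                · rfl
                · simp [slab, he]
              have := Set.encard_le_encard hsub
              rwa [Set.encard_pair hij] at this
        _ ≤ ∑ j ∈ Finset.Ico (-(R * N) : ℤ) (R * N),
            P {ω | 2 ≤ pointCount X (slab S N j) ω} := measure_biUnion_finset_le _ _
        _ ≤ ∑ j ∈ Finset.Ico (-(R * N) : ℤ) (R * N),
            (ENNReal.ofReal lam * ENNReal.ofReal (1 / N)) ^ 2 := by
            gcongr with j _
            have := h.measure_two_le_pointCount (measurableSet_slab N j)
              (by rw [measure_slab Θ lam hN]; exact ENNReal.mul_ne_top (by simp) (by simp))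
            rwa [measure_slab Θ lam hN] at this
        _ = _ := by
            rw [Finset.sum_const, Int.card_Ico, nsmul_eq_mul, ← ENNReal.ofReal_natCast]
            have : (((R * N : ℤ) - -(R * N : ℤ)).toNat : ℝ) = 2 * R * N := by
              have : ((R * N : ℤ) - -(R * N : ℤ)) = ((2 * R * N : ℕ) : ℤ) := by push_cast; ring
              rw [this, Int.toNat_natCast]; push_cast; ring
            rw [this, show ENNReal.ofReal lam = ENNReal.ofReal lam.toNNReal by
              simp, ← ENNReal.ofReal_mul (by positivity),
              ← ENNReal.ofReal_pow (by positivity), ← ENNReal.ofReal_mul (by positivity)]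
            congr 1
            field_simp
    have hlim : Tendsto (fun N : ℕ => ENNReal.ofReal (2 * R * lam.toNNReal ^ 2 * (1 / N))) atTop
        (𝓝 0) := by
      rw [← ENNReal.ofReal_zero]
      refine ENNReal.tendsto_ofReal ?_
      simpa using (tendsto_one_div_atTop_nhds_zero_nat (𝕜 := ℝ)).const_mul
        (2 * R * (lam.toNNReal : ℝ) ^ 2)
    exact le_antisymm (ge_of_tendsto hlim (eventually_atTop.2 ⟨1, fun N hN => hle N hN⟩)) bot_le
  have key' : ∀ᵐ ω ∂P, ∀ R : ℕ, ¬ ∃ i j, i ≠ j ∧ (X i ω).1 = (X j ω).1 ∧ -(R : ℝ) ≤ (X i ω).1 ∧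
      (X i ω).1 < R := by
    rw [ae_all_iff]
    intro R
    rw [ae_iff]
    simpa only [not_not] using key R
  filter_upwards [key'] with ω hω i j hij he
  obtain ⟨R, hR⟩ := exists_nat_gt |(X i ω).1|
  exact hω R ⟨i, j, hij, he, (abs_lt.1 hR).1.le, (abs_lt.1 hR).2⟩

/-- Both measures agree on boxes whose sides lie in distinct slabs of equal width. Countably many
products of distinct slabs cover everything off the diagonals of the offsets, and the diagonals are
null for both measures. -/
lemma momentMeasure_eq (h : IsPoissonProcess X (markedLebesgue lam Θ) P) (ι : Type*) [Fintype ι] :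
    momentMeasure X P ι = Measure.pi fun _ : ι => markedLebesgue lam Θ := by
  have hfin : ∀ N : ℕ, 0 < N → ∀ j : ℤ, markedLebesgue lam Θ (slab S N j) ≠ ∞ := fun N hN j => by
    rw [measure_slab Θ lam hN]; exact ENNReal.mul_ne_top (by simp) (by simp)
  let s : {p : ℕ × (ι → ℤ) // 0 < p.1 ∧ Function.Injective p.2} → Set (ι → ℝ × S) :=
    fun p => Set.univ.pi fun a => slab S p.1.1 (p.1.2 a)
  have hcover : ∀ x : ι → ℝ × S, (∀ a b, a ≠ b → (x a).1 ≠ (x b).1) → x ∈ ⋃ p, s p := by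
    intro x hx
    -- Once `N` exceeds the inverse of every gap between offsets, distinct coordinates fall into
    -- distinct slabs.
    have hev : ∀ᶠ N : ℕ in atTop, ∀ a b, a ≠ b → ⌊(N : ℝ) * (x a).1⌋ ≠ ⌊(N : ℝ) * (x b).1⌋ := by
      refine eventually_all.2 fun a => eventually_all.2 fun b => ?_
      by_cases hab : a = b
      · simp [hab]
      obtain ⟨M, hM⟩ := exists_nat_gt (1 / |(x a).1 - (x b).1|)
      filter_upwards [eventually_ge_atTop M] with N hN _ he
      have hpos : 0 < |(x a).1 - (x b).1| := abs_pos.2 (sub_ne_zero.2 (hx a b hab))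
      have h1 := Int.abs_sub_lt_one_of_floor_eq_floor he
      rw [← mul_sub, abs_mul, Nat.abs_cast] at h1
      rw [div_lt_iff₀ hpos] at hM
      have : (M : ℝ) ≤ N := by exact_mod_cast hN
      nlinarith
    obtain ⟨N, hN, hN0⟩ := (hev.and (eventually_gt_atTop 0)).exists
    refine Set.mem_iUnion.2 ⟨⟨(N, fun a => ⌊(N : ℝ) * (x a).1⌋), hN0, fun a b hab => ?_⟩, ?_⟩
    · by_contra hne
      exact hN a b hne hab
    · intro a _
      rfl
  have hbox : ∀ p, (momentMeasure X P ι).restrict (s p) =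
      (Measure.pi fun _ : ι => markedLebesgue lam Θ).restrict (s p) := by
    intro p
    have : ∀ a, IsFiniteMeasure ((markedLebesgue lam Θ).restrict (slab S p.1.1 (p.1.2 a))) := fun a =>
      ⟨by rw [Measure.restrict_apply_univ]; exact (hfin _ p.2.1 _).lt_top⟩
    rw [Measure.restrict_pi_pi]
    refine (Measure.pi_eq fun B hB => ?_).symm
    have hms : ∀ a, MeasurableSet (B a ∩ slab S p.1.1 (p.1.2 a)) :=
      fun a => (hB a).inter (measurableSet_slab _ _)
    rw [Measure.restrict_apply (MeasurableSet.univ_pi hB), ← Set.pi_inter_distrib,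
      ← lintegral_indicator_one (MeasurableSet.univ_pi hms), lintegral_momentMeasure h.measurable
        (measurable_one.indicator (MeasurableSet.univ_pi hms)),
      h.lintegral_tupleSum_indicator_pi hms]
    · exact Finset.prod_congr rfl fun a _ => (Measure.restrict_apply (hB a)).symm
    · exact fun a => ne_top_of_le_ne_top (hfin _ p.2.1 _) (measure_mono Set.inter_subset_right)
    · exact fun a b hab => (disjoint_slab _ (p.2.2.ne hab)).mono Set.inter_subset_right
        Set.inter_subset_right
  have hcompl : ∀ μ : Measure (ι → ℝ × S),
      (∀ᵐ x ∂μ, ∀ a b, a ≠ b → (x a).1 ≠ (x b).1) → μ.restrict (⋃ p, s p) = μ := by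
    intro μ hμ
    rw [Measure.restrict_eq_self_of_ae_mem]
    exact hμ.mono fun x hx => hcover x hx
  rw [← hcompl (momentMeasure X P ι), ← hcompl (Measure.pi fun _ : ι => markedLebesgue lam Θ)]
  · exact Measure.restrict_iUnion_congr.2 hbox
  · simp only [ae_all_iff]
    intro a b hab
    rw [ae_iff]
    simp only [ne_eq, not_not]
    refine pi_diagonal_eq_zero (fun c => ?_) hab
    rw [show {x : ℝ × S | x.1 = c} = {c} ×ˢ Set.univ by ext; simp, Measure.prod_prod]
    simp
  · rw [momentMeasure, Measure.ae_sum_iff' ?_]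
    · intro I
      rw [ae_map_iff (measurable_pi_lambda _ fun a => h.measurable _).aemeasurable]
      · filter_upwards [h.ae_injective_fst] with ω hω a b hab
        exact hω _ _ (I.2.ne hab)
      · simp only [Set.ofPred_forall]
        refine MeasurableSet.iInter fun a => MeasurableSet.iInter fun b => MeasurableSet.iInter
          fun _ => (measurableSet_eq_fun (by fun_prop) (by fun_prop)).compl
    · simp only [Set.ofPred_forall]
      refine MeasurableSet.iInter fun a => MeasurableSet.iInter fun b => MeasurableSet.iInter
          fun _ => (measurableSet_eq_fun (by fun_prop) (by fun_prop)).compl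

/-- The multivariate Mecke formula for kernels that do not depend on the process. -/
theorem lintegral_tupleSum (h : IsPoissonProcess X (markedLebesgue lam Θ) P) {ι : Type*} [Fintype ι]
    {F : (ι → ℝ × S) → ℝ≥0∞} (hF : Measurable F) :
    ∫⁻ ω, tupleSum X ι F ω ∂P = ∫⁻ x, F x ∂(Measure.pi fun _ : ι => markedLebesgue lam Θ) := by
  rw [← lintegral_momentMeasure h.measurable hF, h.momentMeasure_eq]

end IsPoissonProcess

end Moment

/-! ### Fubini for finite powers of a measure. -/

section PiIntegrals

variable {𝒳 : Type*} [MeasurableSpace 𝒳]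

lemma lintegral_pi_unique {Λ : Measure 𝒳} {κ : Type*} [Fintype κ] [Unique κ] {g : 𝒳 → ℝ≥0∞} (hg : Measurable g) :
    ∫⁻ x, g (x default) ∂(Measure.pi fun _ : κ => Λ) = ∫⁻ y, g y ∂Λ := by
  have h := measurePreserving_piUnique (fun _ : κ => Λ)
  rw [← h.lintegral_comp hg]
  rfl

variable {Λ : Measure 𝒳} [SigmaFinite Λ]

lemma lintegral_pi_sum {ι κ : Type*} [Fintype ι] [Fintype κ] {F : (ι → 𝒳) → (κ → 𝒳) → ℝ≥0∞}
    (hF : Measurable (Function.uncurry F)) :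
    ∫⁻ x, F (fun a => x (Sum.inl a)) (fun b => x (Sum.inr b)) ∂(Measure.pi fun _ : ι ⊕ κ => Λ) =
      ∫⁻ y, ∫⁻ z, F y z ∂(Measure.pi fun _ : κ => Λ) ∂(Measure.pi fun _ : ι => Λ) := by
  have h := measurePreserving_sumPiEquivProdPi (fun _ : ι ⊕ κ => Λ)
  have h' := h.lintegral_comp hF
  rw [lintegral_prod _ hF.aemeasurable] at h'
  exact h'

lemma lintegral_pi_insertNth {n : ℕ} (a : Fin (n + 1)) {F : 𝒳 → (Fin n → 𝒳) → ℝ≥0∞}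
    (hF : Measurable (Function.uncurry F)) :
    ∫⁻ x, F (x a) (a.removeNth x) ∂(Measure.pi fun _ : Fin (n + 1) => Λ) =
      ∫⁻ y, ∫⁻ z, F y z ∂(Measure.pi fun _ : Fin n => Λ) ∂Λ := by
  have h := measurePreserving_piFinSuccAbove (fun _ : Fin (n + 1) => Λ) a
  have h' := h.lintegral_comp hF
  rw [lintegral_prod _ hF.aemeasurable] at h'
  exact h'

lemma measurable_insertNth {n : ℕ} (a : Fin (n + 1)) :
    Measurable fun p : 𝒳 × (Fin n → 𝒳) => (a.insertNth p.1 p.2 : Fin (n + 1) → 𝒳) :=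
  (MeasurableEquiv.piFinSuccAbove (fun _ : Fin (n + 1) => 𝒳) a).symm.measurable

lemma lintegral_mul_eval {n : ℕ} {f : (Fin (n + 1) → 𝒳) → ℝ≥0∞} (hf : Measurable f)
    {f₁ : 𝒳 → ℝ≥0∞} {a : Fin (n + 1)}
    (h₁ : ∀ y, ∫⁻ z, f (a.insertNth y z) ∂(Measure.pi fun _ : Fin n => Λ) = f₁ y)
    {g : 𝒳 → ℝ≥0∞} (hg : Measurable g) :
    ∫⁻ x, f x * g (x a) ∂(Measure.pi fun _ : Fin (n + 1) => Λ) = ∫⁻ y, f₁ y * g y ∂Λ := by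
  have hi := measurable_insertNth (𝒳 := 𝒳) a
  have hm : Measurable (Function.uncurry fun (y : 𝒳) (z : Fin n → 𝒳) =>
      f (a.insertNth y z) * g y) := (hf.comp hi).mul (hg.comp measurable_fst)
  have := lintegral_pi_insertNth (Λ := Λ) a hm
  simp only [Fin.insertNth_self_removeNth] at this
  rw [this]
  refine lintegral_congr fun y => ?_
  have hz : Measurable fun z : Fin n → 𝒳 => f (a.insertNth y z) :=
    hf.comp (hi.comp measurable_prodMk_left)
  rw [lintegral_mul_const _ hz, ← h₁ y]

end PiIntegrals

/-! ### Products of tuple sums, sorted by coinciding indices. -/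

section TupleProducts

variable {Ω 𝒳 : Type*} {X : ℕ → Ω → 𝒳}

/-- The index of the extra factor either differs from all entries of the tuple, giving a tuple with
one more entry, or equals exactly one of them. -/
lemma tupleSum_mul_tsum {ι : Type*} [Fintype ι] (F : (ι → 𝒳) → ℝ≥0∞) (g : 𝒳 → ℝ≥0∞) (ω : Ω) :
    tupleSum X ι F ω * ∑' i, g (X i ω) =
      tupleSum X (ι ⊕ Unit) (fun x => F (fun a => x (Sum.inl a)) * g (x (Sum.inr ()))) ω +
        ∑ a, tupleSum X ι (fun x => F x * g (x a)) ω := by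
  classical
  unfold tupleSum
  rw [← (Equiv.sumArrowEquivProdArrow ι Unit ℕ).symm.tsum_eq, ENNReal.tsum_prod',
    ← Summable.tsum_finsetSum fun _ _ => ENNReal.summable, ← ENNReal.tsum_mul_right, ← ENNReal.tsum_add]
  refine tsum_congr fun I => ?_
  rw [← (Equiv.funUnique Unit ℕ).symm.tsum_eq]
  by_cases hI : Function.Injective I
  · simp only [Set.indicator_of_mem (show I ∈ {I : ι → ℕ | Function.Injective I} from hI)]
    have hinj : ∀ i : ℕ, (Equiv.sumArrowEquivProdArrow ι Unit ℕ).symm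
        (I, (Equiv.funUnique Unit ℕ).symm i) ∈ {I : ι ⊕ Unit → ℕ | Function.Injective I} ↔
          i ∈ (Set.range I)ᶜ := by
      intro i
      change Function.Injective (Sum.elim I fun _ : Unit => i) ↔ _
      rw [Sum.elim_injective]
      simp [hI, Function.injective_of_subsingleton]
    have h1 : ∀ i : ℕ, {I : ι ⊕ Unit → ℕ | Function.Injective I}.indicator
        (fun K => F (fun a => X (K (Sum.inl a)) ω) * g (X (K (Sum.inr ())) ω))
          ((Equiv.sumArrowEquivProdArrow ι Unit ℕ).symm (I, (Equiv.funUnique Unit ℕ).symm i)) =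
        F (fun a => X (I a) ω) * (Set.range I)ᶜ.indicator (fun i => g (X i ω)) i := by
      intro i
      by_cases hi : i ∈ (Set.range I)ᶜ
      · rw [Set.indicator_of_mem ((hinj i).2 hi), Set.indicator_of_mem hi]
        rfl
      · rw [Set.indicator_of_notMem (fun h => hi ((hinj i).1 h)), Set.indicator_of_notMem hi,
          mul_zero]
    simp_rw [h1]
    rw [ENNReal.tsum_mul_left, ← Finset.mul_sum, ← mul_add,
      ← tsum_fintype (L := SummationFilter.unconditional _) (fun a => g (X (I a) ω)), ← tsum_range (fun i => g (X i ω)) hI,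
      ← tsum_subtype, add_comm, (ENNReal.summable (f := (fun i => g (X i ω)) ∘ _)).tsum_add_tsum_compl ENNReal.summable]
  · have hinj : ∀ i : ℕ, ¬ (Equiv.sumArrowEquivProdArrow ι Unit ℕ).symm
        (I, (Equiv.funUnique Unit ℕ).symm i) ∈ {I : ι ⊕ Unit → ℕ | Function.Injective I} := by
      intro i hK
      exact hI ((Sum.elim_injective.1 hK).1)
    have hI' : I ∉ {I : ι → ℕ | Function.Injective I} := hI
    simp_rw [Set.indicator_of_notMem hI', Set.indicator_of_notMem (hinj _)]
    simp

/-- Given `I`, two entries of `J` are forced, so `n + 1` entries of `I` and `n - 1` of `J` are free,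
each contributing at most a factor `∑ w`. -/
lemma tsum_tsum_coincidence_le {n : ℕ} (w : ℕ → ℝ≥0∞) (hw : ∀ i, w i ≤ 1)
    {a a' b b' : Fin (n + 1)} (hb : b ≠ b') :
    ∑' I : Fin (n + 1) → ℕ, ∑' J : Fin (n + 1) → ℕ,
      (if I a = J b ∧ I a' = J b' then (∏ c, w (I c)) * ∏ c, w (J c) else 0) ≤
        (∑' i, w i) ^ (2 * n) := by
  classical
  set N := ∑' i, w i
  have hn : 1 ≤ n := by
    rcases Nat.eq_zero_or_pos n with rfl | h
    · exact absurd (Fin.ext (by omega)) hb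
    · exact h
  have hJ : ∀ I : Fin (n + 1) → ℕ, ∑' J : Fin (n + 1) → ℕ,
      (if I a = J b ∧ I a' = J b' then (∏ c, w (I c)) * ∏ c, w (J c) else 0) ≤
        (∏ c, w (I c)) * N ^ (n - 1) := by
    intro I
    -- At `b` and `b'` the weight is replaced by the constraint that forces the entry; nothing is
    -- lost in the upper bound since `w ≤ 1`.
    let u : Fin (n + 1) → ℕ → ℝ≥0∞ := fun c j =>
      if c = b then (if j = I a then 1 else 0) else
        if c = b' then (if j = I a' then 1 else 0) else w j
    have hle : ∀ J : Fin (n + 1) → ℕ,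
        (if I a = J b ∧ I a' = J b' then (∏ c, w (I c)) * ∏ c, w (J c) else 0) ≤
          (∏ c, w (I c)) * ∏ c, u c (J c) := by
      intro J
      split_ifs with h
      · gcongr with c _
        by_cases h1 : c = b
        · subst h1; simp [u, h.1, hw]
        · by_cases h2 : c = b'
          · subst h2; simp [u, h.2, h1, hw]
          · simp [u, h1, h2]
      · exact zero_le
    refine (ENNReal.tsum_le_tsum hle).trans ?_
    rw [ENNReal.tsum_mul_left, tsum_pi_prod_eq_prod_tsum]
    gcongr
    have hu : ∀ c, ∑' j, u c j = if c ∈ ({b, b'} : Finset (Fin (n + 1)))ᶜ then N else 1 := by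
      intro c
      by_cases h1 : c = b
      · simp [u, h1]
      · by_cases h2 : c = b'
        · subst h2; simp [u, h1]
        · simp [u, h1, h2, N]
    simp_rw [hu]
    rw [Finset.prod_ite_mem, Finset.univ_inter, Finset.prod_const, Finset.card_compl,
      Finset.card_pair hb, Fintype.card_fin]
    exact le_of_eq (by congr 1)
  refine (ENNReal.tsum_le_tsum hJ).trans ?_
  rw [ENNReal.tsum_mul_right, tsum_pi_prod_eq_prod_tsum (fun _ : Fin (n + 1) => w),
    Finset.prod_const, Finset.card_univ, Fintype.card_fin, ← pow_add]
  exact le_of_eq (by congr 1; omega)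

/-- Pairs of tuples are split by the number of common indices. No or one common index gives a tuple
sum whose mean is computable by Mecke. With two or more, the kernels are bounded by products of `w`,
and the positions of two coincidences are chosen in at most `(n + 1)^4` ways. -/
lemma tupleSum_sq_le {n : ℕ} {f : (Fin (n + 1) → 𝒳) → ℝ≥0∞} {w : 𝒳 → ℝ≥0∞} (hw : ∀ x, w x ≤ 1)
    (hf : ∀ x, f x ≤ ∏ c, w (x c)) (ω : Ω) :
    tupleSum X (Fin (n + 1)) f ω ^ 2 ≤
      tupleSum X (Fin (n + 1) ⊕ Fin (n + 1))
        (fun x => f (fun a => x (Sum.inl a)) * f (fun a => x (Sum.inr a))) ω +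
      ∑ a, ∑ b, tupleSum X (Fin (n + 1) ⊕ Fin n)
        (fun x => f (fun c => x (Sum.inl c)) *
          f (Fin.insertNth b (x (Sum.inl a)) fun c => x (Sum.inr c))) ω +
      (n + 1) ^ 4 * (∑' i, w (X i ω)) ^ (2 * n) := by
  classical
  let Y : (Fin (n + 1) → ℕ) → Fin (n + 1) → 𝒳 := fun I c => X (I c) ω
  let c : (Fin (n + 1) → ℕ) → (Fin (n + 1) → ℕ) → ℝ≥0∞ := fun I J => f (Y I) * f (Y J)
  -- `t₁` collects the pairs without a common index, `t₂ a b` those whose only coincidence is `I a =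
  -- J b`, and `t₃` dominates pairs with coincidences at two different positions of `J`.
  let t₁ : (Fin (n + 1) → ℕ) → (Fin (n + 1) → ℕ) → ℝ≥0∞ := fun I J =>
    if Function.Injective (Sum.elim I J) then c I J else 0
  let t₂ : Fin (n + 1) → Fin (n + 1) → (Fin (n + 1) → ℕ) → (Fin (n + 1) → ℕ) → ℝ≥0∞ :=
    fun a b I J => if I a = J b ∧ Function.Injective (Sum.elim I (b.removeNth J)) then c I J else 0
  let t₃ : Fin (n + 1) → Fin (n + 1) → Fin (n + 1) → Fin (n + 1) →
      (Fin (n + 1) → ℕ) → (Fin (n + 1) → ℕ) → ℝ≥0∞ := fun a a' b b' I J =>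
    if b ≠ b' then
      (if I a = J b ∧ I a' = J b' then (∏ c, w (Y I c)) * ∏ c, w (Y J c) else 0) else 0
  have hpt : ∀ I J : Fin (n + 1) → ℕ,
      {I : Fin (n + 1) → ℕ | Function.Injective I}.indicator (fun I => f (Y I)) I *
        {I : Fin (n + 1) → ℕ | Function.Injective I}.indicator (fun I => f (Y I)) J ≤
      t₁ I J + ∑ a, ∑ b, t₂ a b I J + ∑ a, ∑ a', ∑ b, ∑ b', t₃ a a' b b' I J := by
    intro I J
    by_cases hI : Function.Injective I
    swap
    · rw [Set.indicator_of_notMem (by exact hI), zero_mul]; exact zero_le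
    by_cases hJ : Function.Injective J
    swap
    · rw [Set.indicator_of_notMem (a := J) (by exact hJ), mul_zero]; exact zero_le
    rw [Set.indicator_of_mem (by exact hI), Set.indicator_of_mem (by exact hJ)]
    by_cases h1 : Function.Injective (Sum.elim I J)
    · refine le_trans (le_of_eq ?_) (le_self_add.trans le_self_add)
      simp only [t₁, h1, if_true, c]
    obtain ⟨a, b, hab⟩ : ∃ a b, I a = J b := by
      rw [Sum.elim_injective] at h1
      push Not at h1
      exact h1 hI hJ
    by_cases h2 : Function.Injective (Sum.elim I (b.removeNth J))
    · refine le_trans ?_ (le_self_add (a := t₁ I J + _))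
      refine le_trans ?_ (le_add_self (a := ∑ a, ∑ b, t₂ a b I J))
      refine le_trans ?_ (Finset.single_le_sum (f := fun a => ∑ b, t₂ a b I J)
        (fun _ _ => zero_le) (Finset.mem_univ a))
      refine le_trans ?_ (Finset.single_le_sum (f := fun b => t₂ a b I J)
        (fun _ _ => zero_le) (Finset.mem_univ b))
      simp only [t₂, hab, h2, and_self, if_true, c, le_refl]
    obtain ⟨a', b₀, hab'⟩ : ∃ a' b₀, I a' = J (b.succAbove b₀) := by
      rw [Sum.elim_injective] at h2
      push Not at h2
      exact h2 hI (hJ.comp Fin.succAbove_right_injective)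
    refine le_trans ?_ le_add_self
    refine le_trans ?_ (Finset.single_le_sum (f := fun a => ∑ a', ∑ b, ∑ b', t₃ a a' b b' I J)
        (fun _ _ => zero_le) (Finset.mem_univ a))
    refine le_trans ?_ (Finset.single_le_sum (f := fun a' => ∑ b, ∑ b', t₃ a a' b b' I J)
        (fun _ _ => zero_le) (Finset.mem_univ a'))
    refine le_trans ?_ (Finset.single_le_sum (f := fun b => ∑ b', t₃ a a' b b' I J)
        (fun _ _ => zero_le) (Finset.mem_univ b))
    refine le_trans ?_ (Finset.single_le_sum (f := fun b' => t₃ a a' b b' I J)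
        (fun _ _ => zero_le) (Finset.mem_univ (b.succAbove b₀)))
    simp only [t₃, hab, hab', (Fin.succAbove_ne b b₀).symm, and_self, if_true, ne_eq,
      not_false_eq_true]
    gcongr
    · exact hf _
    · exact hf _
  have hT1 : ∑' I, ∑' J, t₁ I J = tupleSum X (Fin (n + 1) ⊕ Fin (n + 1))
        (fun x => f (fun a => x (Sum.inl a)) * f (fun a => x (Sum.inr a))) ω := by
    unfold tupleSum
    rw [← (Equiv.sumArrowEquivProdArrow _ _ ℕ).symm.tsum_eq, ENNReal.tsum_prod']
    refine tsum_congr fun I => tsum_congr fun J => ?_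
    simp only [t₁, Set.indicator, Set.mem_ofPred_eq]
    rfl
  have hT2 : ∀ a b, ∑' I, ∑' J, t₂ a b I J = tupleSum X (Fin (n + 1) ⊕ Fin n)
        (fun x => f (fun c => x (Sum.inl c)) *
          f (Fin.insertNth b (x (Sum.inl a)) fun c => x (Sum.inr c))) ω := by
    intro a b
    unfold tupleSum
    rw [← (Equiv.sumArrowEquivProdArrow _ _ ℕ).symm.tsum_eq, ENNReal.tsum_prod']
    refine tsum_congr fun I => ?_
    rw [← (Fin.insertNthEquiv (fun _ : Fin (n + 1) => ℕ) b).tsum_eq, ENNReal.tsum_prod',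
      ENNReal.tsum_comm]
    refine tsum_congr fun J => ?_
    -- The entry of `J` at position `b` is forced to be `I a`, so only the remaining `n` entries are
    -- summed.
    rw [tsum_eq_single (I a)]
    · have hY : Y (Fin.insertNth b (I a) J) = Fin.insertNth b (X (I a) ω) fun c => X (J c) ω := by
        rw [Fin.eq_insertNth_iff]
        constructor
        · simp [Y]
        · ext d; simp [Y, Fin.removeNth]
      simp only [t₂, Set.indicator, Set.mem_ofPred_eq, Fin.insertNthEquiv, Equiv.coe_fn_mk, c, hY,
        Fin.insertNth_apply_same, Fin.removeNth_insertNth, true_and]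
      rfl
    · intro j hj
      simp only [t₂, Fin.insertNthEquiv, Equiv.coe_fn_mk, Fin.insertNth_apply_same]
      rw [if_neg fun h => hj h.1.symm]
  have hT3 : ∀ a a' b b', ∑' I, ∑' J, t₃ a a' b b' I J ≤ (∑' i, w (X i ω)) ^ (2 * n) := by
    intro a a' b b'
    by_cases hb : b = b'
    · simp [t₃, hb]
    · simp only [t₃, ne_eq, hb, not_false_eq_true, if_true]
      exact tsum_tsum_coincidence_le (fun i => w (X i ω)) (fun i => hw _) hb
  have hswap : ∀ {κ : Type} [Fintype κ] (g : κ → (Fin (n + 1) → ℕ) → (Fin (n + 1) → ℕ) → ℝ≥0∞),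
      ∑' I, ∑' J, ∑ a, g a I J = ∑ a, ∑' I, ∑' J, g a I J := by
    intro κ _ g
    simp_rw [Summable.tsum_finsetSum fun _ _ => ENNReal.summable]
  calc tupleSum X (Fin (n + 1)) f ω ^ 2
      = ∑' I, ∑' J, {I : Fin (n + 1) → ℕ | Function.Injective I}.indicator (fun I => f (Y I)) I *
        {I : Fin (n + 1) → ℕ | Function.Injective I}.indicator (fun I => f (Y I)) J := by
        simp_rw [ENNReal.tsum_mul_left, ENNReal.tsum_mul_right]
        rw [sq]
        rfl
    _ ≤ ∑' I, ∑' J, (t₁ I J + ∑ a, ∑ b, t₂ a b I J + ∑ a, ∑ a', ∑ b, ∑ b', t₃ a a' b b' I J) :=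
        ENNReal.tsum_le_tsum fun I => ENNReal.tsum_le_tsum fun J => hpt I J
    _ = ∑' I, ∑' J, t₁ I J + ∑ a, ∑ b, ∑' I, ∑' J, t₂ a b I J +
        ∑ a, ∑ a', ∑ b, ∑ b', ∑' I, ∑' J, t₃ a a' b b' I J := by
        simp_rw [ENNReal.tsum_add, hswap]
    _ ≤ _ := by
        rw [hT1]
        simp_rw [hT2]
        gcongr
        refine (Finset.sum_le_sum fun a _ => Finset.sum_le_sum fun a' _ =>
          Finset.sum_le_sum fun b _ => Finset.sum_le_sum fun b' _ => hT3 a a' b b').trans ?_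
        simp only [Finset.sum_const, Finset.card_univ, Fintype.card_fin, nsmul_eq_mul]
        push_cast
        exact le_of_eq (by ring)

end TupleProducts

/-! ### Second moments and the Hájek projection. -/

namespace IsPoissonProcess

variable {Ω S : Type*} [MeasurableSpace Ω] [MeasurableSpace S] {P : Measure Ω}
  {X : ℕ → Ω → ℝ × S} {Θ : Measure S} {lam : ℝ}

lemma lintegral_pow_pointCount_le (h : IsPoissonProcess X (markedLebesgue lam Θ) P)
    {W : Set (ℝ × S)} (hW : MeasurableSet W) {t : ℝ} (ht : 1 ≤ t)
    (hWt : markedLebesgue lam Θ W = ENNReal.ofReal t) (q : ℕ) :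
    ∫⁻ ω, (∑' i, W.indicator (1 : ℝ × S → ℝ≥0∞) (X i ω)) ^ q ∂P ≤
      ENNReal.ofReal (q ! * Real.exp 2 * t ^ q) := by
  simp_rw [← coe_pointCount_eq_tsum X W]
  rw [h.lintegral_comp_pointCount hW (by rw [hWt]; simp) fun n => (n : ℝ≥0∞) ^ q, hWt]
  simp only [ENat.toENNReal_coe]
  have := lintegral_pow_poissonMeasure_le t.toNNReal (by rw [Real.one_le_toNNReal]; exact ht) q
  rwa [Real.coe_toNNReal _ (by linarith)] at this

variable [IsProbabilityMeasure Θ]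

lemma lintegral_tupleSum_mul_tsum (h : IsPoissonProcess X (markedLebesgue lam Θ) P)
    {ι : Type*} [Fintype ι] {F : (ι → ℝ × S) → ℝ≥0∞} (hF : Measurable F)
    {g : ℝ × S → ℝ≥0∞} (hg : Measurable g) :
    ∫⁻ ω, tupleSum X ι F ω * ∑' i, g (X i ω) ∂P =
      (∫⁻ x, F x ∂(Measure.pi fun _ : ι => markedLebesgue lam Θ)) *
        (∫⁻ y, g y ∂(markedLebesgue lam Θ)) +
      ∑ a, ∫⁻ x, F x * g (x a) ∂(Measure.pi fun _ : ι => markedLebesgue lam Θ) := by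
  have hm1 : Measurable fun x : ι ⊕ Unit → ℝ × S =>
      F (fun a => x (Sum.inl a)) * g (x (Sum.inr ())) := by fun_prop
  have hm2 : ∀ a, Measurable fun x : ι → ℝ × S => F x * g (x a) := fun a => by fun_prop
  simp_rw [tupleSum_mul_tsum]
  rw [lintegral_add_left (measurable_tupleSum h.measurable hm1),
    lintegral_finsetSum _ fun a _ => measurable_tupleSum h.measurable (hm2 a),
    h.lintegral_tupleSum hm1]
  simp_rw [h.lintegral_tupleSum (hm2 _)]
  congr 1
  have hu : Measurable (Function.uncurry fun (y : ι → ℝ × S) (z : Unit → ℝ × S) =>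
      F y * g (z default)) := by
    unfold Function.uncurry
    fun_prop
  rw [← lintegral_pi_unique (κ := Unit) hg, ← lintegral_mul_const _ hF]
  refine (lintegral_pi_sum hu).trans (lintegral_congr fun y => ?_)
  rw [lintegral_const_mul _ (by fun_prop)]

/-- The bound on the variance of the difference between a Poisson U-statistic and its Hájek
projection. -/
theorem integral_sub_projection_sq_le [IsProbabilityMeasure P]
    (h : IsPoissonProcess X (markedLebesgue lam Θ) P)
    {W : Set (ℝ × S)} (hW : MeasurableSet W) {t : ℝ} (ht : 1 ≤ t)
    (hWt : markedLebesgue lam Θ W = ENNReal.ofReal t) {n : ℕ}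
    {f : (Fin (n + 1) → ℝ × S) → ℝ≥0∞} (hf : Measurable f)
    (hfW : ∀ x, f x ≤ ∏ c, W.indicator 1 (x c))
    {f₁ : ℝ × S → ℝ≥0∞} (hf₁m : Measurable f₁)
    (hf₁ : ∀ a y, ∫⁻ z, f (Fin.insertNth a y z)
      ∂(Measure.pi fun _ : Fin n => markedLebesgue lam Θ) = f₁ y) :
    Integrable (fun ω => ((tupleSum X (Fin (n + 1)) f ω).toReal -
      (n + 1) * (∑' i, f₁ (X i ω)).toReal + n * (∫⁻ y, f₁ y ∂(markedLebesgue lam Θ)).toReal) ^ 2)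
      P ∧
    ∫ ω, ((tupleSum X (Fin (n + 1)) f ω).toReal - (n + 1) * (∑' i, f₁ (X i ω)).toReal +
      n * (∫⁻ y, f₁ y ∂(markedLebesgue lam Θ)).toReal) ^ 2 ∂P ≤
        (n + 1) ^ 4 * ((2 * n)! * Real.exp 2 * t ^ (2 * n)) := by
  set A : Ω → ℝ≥0∞ := tupleSum X (Fin (n + 1)) f
  set L : Ω → ℝ≥0∞ := fun ω => ∑' i, f₁ (X i ω)
  set a : ℝ≥0∞ := ∫⁻ y, f₁ y ∂(markedLebesgue lam Θ)
  set s : ℝ≥0∞ := ∫⁻ y, f₁ y * f₁ y ∂(markedLebesgue lam Θ)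
  set R : ℝ := (n + 1) ^ 4 * ((2 * n)! * Real.exp 2 * t ^ (2 * n))
  have hAm : Measurable A := measurable_tupleSum h.measurable hf
  have hLm : Measurable L := Measurable.tsum fun i => hf₁m.comp (h.measurable i)
  have hfa : ∫⁻ x, f x ∂(Measure.pi fun _ : Fin (n + 1) => markedLebesgue lam Θ) = a := by
    have := lintegral_mul_eval (Λ := markedLebesgue lam Θ) hf (hf₁ 0) (g := 1) measurable_one
    simpa using this
  -- Viewing the linear statistic as a tuple sum of order one lets the same product formula give
  -- both `E[L²]` and `E[AL]`.
  have hL_eq : ∀ ω, L ω = tupleSum X (Fin 1) (fun x => f₁ (x 0)) ω := by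
    intro ω
    unfold tupleSum
    rw [← (Equiv.funUnique (Fin 1) ℕ).symm.tsum_eq]
    refine tsum_congr fun i => ?_
    rw [Set.indicator_of_mem (by exact Function.injective_of_subsingleton _)]
    simp
  have hf₁' : Measurable fun x : Fin 1 → ℝ × S => f₁ (x 0) := by fun_prop
  have hEA : ∫⁻ ω, A ω ∂P = a := by rw [h.lintegral_tupleSum hf, hfa]
  have hEL : ∫⁻ ω, L ω ∂P = a := by
    simp_rw [hL_eq]
    rw [h.lintegral_tupleSum hf₁']
    exact lintegral_pi_unique (κ := Fin 1) hf₁m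
  have hEL2 : ∫⁻ ω, L ω * L ω ∂P = a * a + s := by
    have := h.lintegral_tupleSum_mul_tsum hf₁' hf₁m
    simp_rw [← hL_eq] at this
    rw [this, Finset.univ_unique, Finset.sum_singleton]
    congr 1
    · congr 1
      exact lintegral_pi_unique (κ := Fin 1) hf₁m
    · exact lintegral_pi_unique (κ := Fin 1) (g := fun y => f₁ y * f₁ y) (hf₁m.mul hf₁m)
  have hEAL : ∫⁻ ω, A ω * L ω ∂P = a * a + (n + 1) * s := by
    rw [h.lintegral_tupleSum_mul_tsum hf hf₁m, hfa]
    have e : ∀ b : Fin (n + 1), ∫⁻ x, f x * f₁ (x b) ∂(Measure.pi fun _ => markedLebesgue lam Θ) = s :=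
      fun b => lintegral_mul_eval hf (hf₁ b) hf₁m
    simp_rw [e]
    simp [s, a]
  -- The disjoint pairs give `a²`, each of the `(n + 1)²` ways to share one point gives `s`, and the
  -- rest is a moment of order `2n` of the number of points in `W`.
  have hEA2 : ∫⁻ ω, A ω ^ 2 ∂P ≤ a * a + (n + 1) ^ 2 * s + ENNReal.ofReal R := by
    have hpt := fun ω => tupleSum_sq_le (X := X) (w := W.indicator 1)
      (fun x => Set.indicator_le_self' (fun _ _ => zero_le) x) hfW ω
    refine (lintegral_mono hpt).trans ?_
    have hm1 : Measurable fun x : Fin (n + 1) ⊕ Fin (n + 1) → ℝ × S =>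
        f (fun a => x (Sum.inl a)) * f (fun a => x (Sum.inr a)) := by fun_prop
    have hm2 : ∀ a b, Measurable fun x : Fin (n + 1) ⊕ Fin n → ℝ × S =>
        f (fun c => x (Sum.inl c)) *
          f (Fin.insertNth b (x (Sum.inl a)) fun c => x (Sum.inr c)) := by
      intro a b
      have hp : Measurable fun x : Fin (n + 1) ⊕ Fin n → ℝ × S =>
        (x (Sum.inl a), fun c => x (Sum.inr c)) := by fun_prop
      exact Measurable.mul (by fun_prop) (hf.comp ((measurable_insertNth b).comp hp))
    have hm3 : Measurable fun ω => ∑' i, W.indicator (1 : ℝ × S → ℝ≥0∞) (X i ω) :=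
      Measurable.tsum fun i => (measurable_one.indicator hW).comp (h.measurable i)
    rw [lintegral_add_right _ ((hm3.pow_const _).const_mul _),
      lintegral_add_left (measurable_tupleSum h.measurable hm1),
      lintegral_finsetSum _ fun a _ => Finset.measurable_fun_sum _ fun b _ =>
        measurable_tupleSum h.measurable (hm2 a b),
      h.lintegral_tupleSum hm1, lintegral_const_mul _ (hm3.pow_const _)]
    simp_rw [lintegral_finsetSum _ fun b _ => measurable_tupleSum h.measurable (hm2 _ b),
      h.lintegral_tupleSum (hm2 _ _)]
    have h1 : ∫⁻ x : Fin (n + 1) ⊕ Fin (n + 1) → ℝ × S, f (fun a => x (Sum.inl a)) *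
        f (fun a => x (Sum.inr a)) ∂(Measure.pi fun _ => markedLebesgue lam Θ) = a * a := by
      have hu : Measurable (Function.uncurry fun (y : Fin (n + 1) → ℝ × S)
          (z : Fin (n + 1) → ℝ × S) => f y * f z) := by
        unfold Function.uncurry
        fun_prop
      refine (lintegral_pi_sum hu).trans ?_
      have e : ∀ y : Fin (n + 1) → ℝ × S,
          ∫⁻ z, f y * f z ∂(Measure.pi fun _ : Fin (n + 1) => markedLebesgue lam Θ) = f y * a :=
        fun y => by rw [lintegral_const_mul _ hf, hfa]
      simp_rw [e]
      rw [lintegral_mul_const _ hf, hfa]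
    have h2 : ∀ a b, ∫⁻ x : Fin (n + 1) ⊕ Fin n → ℝ × S, f (fun c => x (Sum.inl c)) *
          f (Fin.insertNth b (x (Sum.inl a)) fun c => x (Sum.inr c)) ∂(Measure.pi fun _ => markedLebesgue lam Θ)
          = s := by
      intro a b
      have hz : Measurable fun p : (Fin (n + 1) → ℝ × S) × (Fin n → ℝ × S) =>
          f (b.insertNth (p.1 a) p.2) := by
        have hp : Measurable fun p : (Fin (n + 1) → ℝ × S) × (Fin n → ℝ × S) =>
          (p.1 a, p.2) := by fun_prop
        exact hf.comp ((measurable_insertNth b).comp hp)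
      have hu : Measurable (Function.uncurry fun (y : Fin (n + 1) → ℝ × S)
          (z : Fin n → ℝ × S) => f y * f (b.insertNth (y a) z)) :=
        (hf.comp measurable_fst).mul hz
      refine (lintegral_pi_sum hu).trans ((lintegral_congr fun y => ?_).trans
        (lintegral_mul_eval hf (hf₁ a) hf₁m))
      have hz' : Measurable fun z : Fin n → ℝ × S => f (b.insertNth (y a) z) :=
        hz.comp measurable_prodMk_left
      rw [lintegral_const_mul _ hz', hf₁ b]
    rw [h1]
    simp_rw [h2]
    gcongr
    · simp only [Finset.sum_const, Finset.card_univ, Fintype.card_fin, nsmul_eq_mul]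
      push_cast
      exact le_of_eq (by ring)
    · have := h.lintegral_pow_pointCount_le hW ht hWt (2 * n)
      calc _ ≤ ((n : ℝ≥0∞) + 1) ^ 4 * ENNReal.ofReal ((2 * n)! * Real.exp 2 * t ^ (2 * n)) := by
            gcongr
        _ = _ := by
            rw [ENNReal.ofReal_mul (p := ((n : ℝ) + 1) ^ 4) (by positivity),
              ENNReal.ofReal_pow (p := (n : ℝ) + 1) (by positivity),
              ENNReal.ofReal_add (by positivity) (by positivity)]
            simp
  have hWtop : ∏ _c : Fin n, markedLebesgue lam Θ W ≠ ∞ := ENNReal.prod_ne_top fun _ _ => by rw [hWt]; simp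
  -- As the kernel is supported on `W^{n+1}`, this domination makes `a` and `s` finite, so that
  -- passing to real integrals is legitimate.
  have hf₁W : ∀ y, f₁ y ≤ W.indicator 1 y * ∏ _c : Fin n, markedLebesgue lam Θ W := by
    intro y
    have hmW : Measurable (W.indicator (1 : ℝ × S → ℝ≥0∞)) := measurable_one.indicator hW
    calc f₁ y = ∫⁻ z, f (Fin.insertNth 0 y z) ∂(Measure.pi fun _ : Fin n => markedLebesgue lam Θ) := (hf₁ 0 y).symm
      _ ≤ ∫⁻ z : Fin n → ℝ × S, W.indicator 1 y * ∏ c, W.indicator 1 (z c)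
          ∂(Measure.pi fun _ : Fin n => markedLebesgue lam Θ) := by
          refine lintegral_mono fun z => (hfW _).trans ?_
          rw [Fin.prod_univ_succ]
          simp
      _ = W.indicator 1 y * ∏ _c : Fin n, markedLebesgue lam Θ W := by
          have hp : Measurable fun z : Fin n → ℝ × S => ∏ c, W.indicator (1 : ℝ × S → ℝ≥0∞) (z c) :=
            Finset.measurable_fun_prod _ fun c _ => hmW.comp (measurable_pi_apply c)
          rw [lintegral_const_mul _ hp]
          simp_rw [← indicator_univ_pi_one (fun _ : Fin n => W)]
          rw [lintegral_indicator_one (MeasurableSet.univ_pi fun _ => hW), Measure.pi_pi]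
  have ha : a ≠ ∞ := by
    refine ne_top_of_le_ne_top ?_ (lintegral_mono hf₁W)
    rw [lintegral_mul_const _ (measurable_one.indicator hW), lintegral_indicator_one hW]
    exact ENNReal.mul_ne_top (by rw [hWt]; simp) hWtop
  have hs : s ≠ ∞ := by
    refine ne_top_of_le_ne_top ?_ (lintegral_mono fun y => mul_le_mul' (hf₁W y)
      ((hf₁W y).trans (mul_le_of_le_one_left' (Set.indicator_le_self' (fun _ _ => zero_le) y))))
    rw [lintegral_mul_const _ ((measurable_one.indicator hW).mul_const _),
      lintegral_mul_const _ (measurable_one.indicator hW), lintegral_indicator_one hW]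
    exact ENNReal.mul_ne_top (ENNReal.mul_ne_top (by rw [hWt]; simp) hWtop) hWtop
  have hA2 : ∫⁻ ω, A ω ^ 2 ∂P ≠ ∞ := by
    refine ne_top_of_le_ne_top ?_ hEA2
    have : ((n : ℝ≥0∞) + 1) ^ 2 * s ≠ ∞ :=
      ENNReal.mul_ne_top (ENNReal.pow_ne_top (by simp)) hs
    simp [ha, this, ENNReal.mul_eq_top]
  have toReal_sq : ∀ (F G : Ω → ℝ≥0∞), Measurable F → Measurable G →
      ∫⁻ ω, F ω * G ω ∂P ≠ ∞ → Integrable (fun ω => (F ω).toReal * (G ω).toReal) P ∧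
        ∫ ω, (F ω).toReal * (G ω).toReal ∂P = (∫⁻ ω, F ω * G ω ∂P).toReal := by
    intro F G hF hG hFG
    simp_rw [← ENNReal.toReal_mul]
    exact ⟨integrable_toReal_of_lintegral_ne_top (hF.mul hG).aemeasurable hFG,
      integral_toReal (hF.mul hG).aemeasurable (ae_lt_top (hF.mul hG) hFG)⟩
  have hAi : Integrable (fun ω => (A ω).toReal) P ∧ ∫ ω, (A ω).toReal ∂P = a.toReal := by
    have := toReal_sq A 1 hAm measurable_one (by simpa [hEA] using ha)
    simpa [hEA] using this
  have hLi : Integrable (fun ω => (L ω).toReal) P ∧ ∫ ω, (L ω).toReal ∂P = a.toReal := by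
    have := toReal_sq L 1 hLm measurable_one (by simpa [hEL] using ha)
    simpa [hEL] using this
  have hAAi := toReal_sq A A hAm hAm (by simpa [sq] using hA2)
  have hLLi := toReal_sq L L hLm hLm (by rw [hEL2]; simp [ha, hs, ENNReal.mul_eq_top])
  have hALi := toReal_sq A L hAm hLm (by
    have : ((n : ℝ≥0∞) + 1) * s ≠ ∞ := ENNReal.mul_ne_top (by simp) hs
    rw [hEAL]; simp [ha, this, ENNReal.mul_eq_top])
  have hAAle : ∫ ω, (A ω).toReal * (A ω).toReal ∂P ≤
      a.toReal * a.toReal + (n + 1) ^ 2 * s.toReal + R := by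
    rw [hAAi.2]
    have hR : 0 ≤ R := by positivity
    have h1 : a * a ≠ ∞ := ENNReal.mul_ne_top ha ha
    have h2 : ((n : ℝ≥0∞) + 1) ^ 2 * s ≠ ∞ := ENNReal.mul_ne_top (ENNReal.pow_ne_top (by simp)) hs
    simp_rw [← sq]
    refine (ENNReal.toReal_mono ?_ hEA2).trans (le_of_eq ?_)
    · simp [h1, h2]
    · rw [ENNReal.toReal_add (by simp [h1, h2]) (by simp), ENNReal.toReal_add h1 h2,
        ENNReal.toReal_ofReal hR, ENNReal.toReal_mul, ENNReal.toReal_mul, ENNReal.toReal_pow,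
        ENNReal.toReal_add (by simp) (by simp)]
      simp [sq]
  have hLLe : ∫ ω, (L ω).toReal * (L ω).toReal ∂P = a.toReal * a.toReal + s.toReal := by
    rw [hLLi.2, hEL2, ENNReal.toReal_add (ENNReal.mul_ne_top ha ha) hs, ENNReal.toReal_mul]
  have hALe : ∫ ω, (A ω).toReal * (L ω).toReal ∂P =
      a.toReal * a.toReal + (n + 1) * s.toReal := by
    rw [hALi.2, hEAL, ENNReal.toReal_add (ENNReal.mul_ne_top ha ha)
      (ENNReal.mul_ne_top (by simp) hs), ENNReal.toReal_mul, ENNReal.toReal_mul,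
      ENNReal.toReal_add (by simp) (by simp)]
    simp
  have hexp : (fun ω => ((A ω).toReal - (n + 1) * (L ω).toReal + n * a.toReal) ^ 2) = fun ω =>
      (A ω).toReal * (A ω).toReal + (n + 1) ^ 2 * ((L ω).toReal * (L ω).toReal)
        - 2 * (n + 1) * ((A ω).toReal * (L ω).toReal)
        + 2 * n * a.toReal * (A ω).toReal - 2 * n * a.toReal * (n + 1) * (L ω).toReal
        + (n * a.toReal) ^ 2 := by
    ext ω; ring
  have i1 := hAAi.1
  have i2 := hLLi.1.const_mul ((n + 1 : ℝ) ^ 2)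
  have i3 := hALi.1.const_mul (2 * (n + 1 : ℝ))
  have i4 := hAi.1.const_mul (2 * n * a.toReal)
  have i5 := hLi.1.const_mul (2 * n * a.toReal * (n + 1))
  have i6 : Integrable (fun _ : Ω => (n * a.toReal) ^ 2) P := integrable_const _
  rw [hexp]
  have j1 := i1.add i2
  have j2 := j1.sub i3
  have j3 := j2.add i4
  have j4 := j3.sub i5
  refine ⟨j4.add i6, ?_⟩
  have e := integral_add' j4 i6
  rw [integral_sub' j3 i5, integral_add' j2 i4, integral_sub' j1 i3, integral_add' i1 i2] at e
  simp only [Pi.add_apply, Pi.sub_apply, integral_const_mul, integral_const, probReal_univ,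
    one_smul] at e
  rw [e, hLLe, hALe, hAi.2, hLi.2]
  -- The coefficient of `s` is `(n+1)² (1 + 1 - 2) = 0` and that of `a²` is `(1 - (n+1) + n)² = 0`,
  -- so only `R` survives.
  nlinarith [hAAle]

end IsPoissonProcess

/-! ### Campbell's formula for linear statistics. -/

namespace IsPoissonProcess

variable {Ω 𝒳 : Type*} [MeasurableSpace Ω] [MeasurableSpace 𝒳] {P : Measure Ω}
  {X : ℕ → Ω → 𝒳} {Λ : Measure 𝒳}

lemma ae_finite_mem (h : IsPoissonProcess X Λ P) {W : Set 𝒳} (hW : MeasurableSet W)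
    (hfin : Λ W ≠ ∞) : ∀ᵐ ω ∂P, {i | X i ω ∈ W}.Finite := by
  filter_upwards [h.ae_pointCount_lt_top hW hfin] with ω hω
  rw [← Set.encard_lt_top_iff]
  have : (pointCount X W ω : ℝ≥0∞) ≠ ∞ := hω.ne
  rw [ne_eq, ENat.toENNReal_eq_top] at this
  exact lt_top_iff_ne_top.2 this

lemma integral_exp_pointCount (h : IsPoissonProcess X Λ P) {B : Set 𝒳} (hB : MeasurableSet B)
    (hfin : Λ B ≠ ∞) (t : ℝ) :
    ∫ ω, Complex.exp (t * (pointCount X B ω).toNat * Complex.I) ∂P =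
      Complex.exp (Λ.real B * (Complex.exp (t * Complex.I) - 1)) := by
  let F : ℕ∞ → ℂ := fun n => Complex.exp (t * n.toNat * Complex.I)
  have hm := measurable_pointCount h.measurable hB
  have h1 : ∫ ω, F (pointCount X B ω) ∂P = ∫ n, F n ∂(P.map (pointCount X B)) :=
    (integral_map hm.aemeasurable (Measurable.aestronglyMeasurable .of_discrete)).symm
  change ∫ ω, F (pointCount X B ω) ∂P = _
  rw [h1, h.poisson B hB hfin,
    integral_map (Measurable.aemeasurable .of_discrete)
      (Measurable.aestronglyMeasurable .of_discrete)]
  have h2 := charFun_map_cast_poissonMeasure (Λ B).toNNReal t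
  rw [charFun_apply_real, integral_map (Measurable.aemeasurable .of_discrete)
    (by fun_prop)] at h2
  simp only [F, ENat.toNat_natCast]
  simp only [Complex.ofReal_natCast] at h2
  rw [h2]
  rfl

/-- On the disjoint level sets of `g` in `W` the statistic is a linear combination of independent
Poisson counts, so its characteristic function is a product of Poisson ones. -/
lemma integral_exp_tsum_simpleFunc [IsProbabilityMeasure P]
    (h : IsPoissonProcess X Λ P) {W : Set 𝒳} (hW : MeasurableSet W)
    (hfin : Λ W ≠ ∞) (g : SimpleFunc 𝒳 ℝ) (t : ℝ) :
    ∫ ω, Complex.exp (t * (∑' i, W.indicator g (X i ω) : ℝ) * Complex.I) ∂P =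
      Complex.exp (∫ x in W, (Complex.exp (t * g x * Complex.I) - 1) ∂Λ) := by
  classical
  let n := Fintype.card g.range
  let e : g.range ≃ Fin n := Fintype.equivFin g.range
  let c : Fin n → ℝ := fun j => (e.symm j).1
  let B : Fin n → Set 𝒳 := fun j => W ∩ g ⁻¹' {c j}
  have hB : ∀ j, MeasurableSet (B j) := fun j => hW.inter (g.measurableSet_preimage _)
  have hBfin : ∀ j, Λ (B j) ≠ ∞ := fun j =>
    ne_top_of_le_ne_top hfin (measure_mono Set.inter_subset_left)
  have hdisj : Pairwise fun i j => Disjoint (B i) (B j) := by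
    intro i j hij
    refine Set.disjoint_left.2 fun x hi hj => hij ?_
    have : c i = c j := hi.2.symm.trans hj.2
    exact e.symm.injective (Subtype.ext this)
  have hsum : ∀ᵐ ω ∂P, (∑' i, W.indicator g (X i ω) : ℝ) =
      ∑ j, c j * (pointCount X (B j) ω).toNat := by
    filter_upwards [h.ae_finite_mem hW hfin] with ω hω
    have hcount : ∀ j, ((pointCount X (B j) ω).toNat : ℝ) =
        ∑ i ∈ hω.toFinset, if g (X i ω) = c j then 1 else 0 := by
      intro j
      have hs : {i | X i ω ∈ B j} = ((hω.toFinset.filter fun i => g (X i ω) = c j : Finset ℕ) :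
          Set ℕ) := by
        ext i; simp [B]
      rw [pointCount, hs, Set.encard_coe_eq_coe_finsetCard, ENat.toNat_natCast, Finset.sum_boole]
    rw [tsum_eq_sum (s := hω.toFinset)]
    · simp_rw [hcount, Finset.mul_sum]
      rw [Finset.sum_comm]
      refine Finset.sum_congr rfl fun i hi => ?_
      have hi' : X i ω ∈ W := by simpa using hi
      rw [Set.indicator_of_mem hi']
      rw [Finset.sum_eq_single (e ⟨g (X i ω), g.mem_range_self _⟩)]
      · simp [c]
      · intro j _ hj
        rw [if_neg, mul_zero]
        intro hc
        apply hj
        rw [← e.symm_apply_eq]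
        exact Subtype.ext hc.symm
      · simp
    · intro i hi
      rw [Set.indicator_of_notMem]
      simpa using hi
  have hprod : ∀ᵐ ω ∂P, Complex.exp (t * (∑' i, W.indicator g (X i ω) : ℝ) * Complex.I) =
      ∏ j, Complex.exp ((t * c j : ℝ) * (pointCount X (B j) ω).toNat * Complex.I) := by
    filter_upwards [hsum] with ω hω
    rw [hω, ← Complex.exp_sum]
    congr 1
    push_cast
    rw [Finset.mul_sum, Finset.sum_mul]
    exact Finset.sum_congr rfl fun j _ => by ring
  have hind : iIndepFun (fun j ω =>
      Complex.exp ((t * c j : ℝ) * (pointCount X (B j) ω).toNat * Complex.I)) P :=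
    (h.indep n B hB hdisj).comp
      (fun j (N : ℕ∞) => Complex.exp ((t * c j : ℝ) * N.toNat * Complex.I)) fun _ => .of_discrete
  rw [integral_congr_ae hprod, hind.integral_fun_prod_eq_prod_integral]
  · simp_rw [h.integral_exp_pointCount (hB _) (hBfin _)]
    rw [← Complex.exp_sum]
    congr 1
    have : IsFiniteMeasure (Λ.restrict W) := ⟨by simpa using hfin.lt_top⟩
    have hF0 : Complex.exp (t * (0 : ℝ) * Complex.I) - 1 = 0 := by simp
    have hgi : Integrable g (Λ.restrict W) := g.integrable_of_isFiniteMeasure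
    have h1 := SimpleFunc.map_integral g (fun y : ℝ => Complex.exp (t * y * Complex.I) - 1) hgi hF0
    rw [SimpleFunc.integral_eq_integral _ (SimpleFunc.integrable_of_isFiniteMeasure _)] at h1
    simp only [SimpleFunc.map_apply] at h1
    rw [h1]
    refine Eq.trans ?_ (Finset.sum_coe_sort g.range _)
    refine Eq.trans ?_ (e.symm.sum_comp _)
    refine Finset.sum_congr rfl fun j _ => ?_
    rw [measureReal_restrict_apply (g.measurableSet_preimage _), Set.inter_comm]
    simp [B, c]
  · intro j
    exact (Measurable.comp (g := fun N : ℕ∞ =>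
      Complex.exp ((t * c j : ℝ) * N.toNat * Complex.I)) .of_discrete
        (measurable_pointCount h.measurable (hB j))).aestronglyMeasurable

lemma measurable_tsum_indicator (h : IsPoissonProcess X Λ P) {W : Set 𝒳} (hW : MeasurableSet W)
    {g : 𝒳 → ℝ} (hg : Measurable g) : Measurable fun ω => ∑' i, W.indicator g (X i ω) :=
  Measurable.tsum fun i => (hg.indicator hW).comp (h.measurable i)

/-- The characteristic function of a linear statistic of a Poisson process (Campbell's theorem). -/
theorem integral_exp_tsum [IsProbabilityMeasure P] (h : IsPoissonProcess X Λ P) {W : Set 𝒳}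
    (hW : MeasurableSet W) (hfin : Λ W ≠ ∞) {g : 𝒳 → ℝ} (hg : Measurable g) (t : ℝ) :
    ∫ ω, Complex.exp (t * (∑' i, W.indicator g (X i ω) : ℝ) * Complex.I) ∂P =
      Complex.exp (∫ x in W, (Complex.exp (t * g x * Complex.I) - 1) ∂Λ) := by
  have : IsFiniteMeasure (Λ.restrict W) := ⟨by simpa using hfin.lt_top⟩
  let gs : ℕ → SimpleFunc 𝒳 ℝ := hg.stronglyMeasurable.approx
  have hgs : ∀ x, Tendsto (fun n => gs n x) atTop (𝓝 (g x)) :=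
    hg.stronglyMeasurable.tendsto_approx
  have hnorm : ∀ y : ℝ, ‖Complex.exp (t * y * Complex.I)‖ = 1 := fun y => by
    rw [← Complex.ofReal_mul, Complex.norm_exp_ofReal_mul_I]
  have hcont : Continuous fun y : ℝ => Complex.exp (t * y * Complex.I) := by fun_prop
  have h1 : Tendsto (fun n => ∫ ω, Complex.exp (t * (∑' i, W.indicator (gs n) (X i ω) : ℝ) *
      Complex.I) ∂P) atTop
      (𝓝 (∫ ω, Complex.exp (t * (∑' i, W.indicator g (X i ω) : ℝ) * Complex.I) ∂P)) := by
    refine tendsto_integral_of_dominated_convergence (fun _ => 1) (fun n => ?_)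
      (integrable_const _) (fun n => ae_of_all _ fun ω => (hnorm _).le) ?_
    · exact (hcont.measurable.comp
        (h.measurable_tsum_indicator hW (gs n).measurable)).aestronglyMeasurable
    · filter_upwards [h.ae_finite_mem hW hfin] with ω hω
      refine (hcont.tendsto _).comp ?_
      have hs : ∀ f : 𝒳 → ℝ, ∑' i, W.indicator f (X i ω) =
          ∑ i ∈ hω.toFinset, W.indicator f (X i ω) := fun f =>
        tsum_eq_sum fun i hi => Set.indicator_of_notMem (by simpa using hi) _
      simp_rw [hs]
      refine tendsto_finsetSum _ fun i hi => ?_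
      have hi' : X i ω ∈ W := by simpa using hi
      simp_rw [Set.indicator_of_mem hi']
      exact hgs _
  have h2 : Tendsto (fun n => ∫ x in W, (Complex.exp (t * gs n x * Complex.I) - 1) ∂Λ) atTop
      (𝓝 (∫ x in W, (Complex.exp (t * g x * Complex.I) - 1) ∂Λ)) := by
    refine tendsto_integral_of_dominated_convergence (fun _ => 2) (fun n => ?_)
      (integrable_const _) (fun n => ae_of_all _ fun x => ?_) (ae_of_all _ fun x => ?_)
    · exact ((hcont.measurable.comp (gs n).measurable).sub_const 1).aestronglyMeasurable
    · refine (norm_sub_le _ _).trans ?_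
      rw [hnorm]
      norm_num
    · exact ((hcont.tendsto _).comp (hgs x)).sub_const 1
  simp_rw [h.integral_exp_tsum_simpleFunc hW hfin] at h1
  exact tendsto_nhds_unique h1 ((Complex.continuous_exp.tendsto _).comp h2)

end IsPoissonProcess

/-! ### Central limit theorem for linear statistics. -/

section CLT

variable {Ω S : Type*} [MeasurableSpace Ω] [MeasurableSpace S] {P : Measure Ω}
  {X : ℕ → Ω → ℝ × S} {Θ : Measure S} [IsProbabilityMeasure Θ] {lam : ℝ}

lemma setIntegral_markedLebesgue (hlam : 0 ≤ lam) {r : ℝ} (hr : 0 < r) {F : ℝ → ℂ}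
    (hF : IntegrableOn (fun x : ℝ × S => F x.1) (Set.Icc (-r) r ×ˢ Set.univ)
      (markedLebesgue lam Θ)) :
    ∫ x in Set.Icc (-r) r ×ˢ Set.univ, F x.1 ∂(markedLebesgue lam Θ) =
      lam * r * ∫ s in (-1 : ℝ)..1, F (r * s) := by
  rw [markedLebesgue, setIntegral_prod _ hF]
  simp only [Measure.restrict_univ, integral_const, probReal_univ, one_smul]
  rw [intervalIntegral.integral_comp_mul_left _ hr.ne', Measure.restrict_smul,
    integral_smul_measure, ENNReal.toReal_ofReal hlam, integral_Icc_eq_integral_Ioc,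
    ← intervalIntegral.integral_of_le (by linarith)]
  simp only [mul_neg, mul_one, Complex.real_smul, Complex.ofReal_inv]
  have : (r : ℂ) ≠ 0 := by exact_mod_cast hr.ne'
  field_simp

/-- The central limit theorem for linear statistics of a marked Poisson process that depend on the
positions through a fixed profile function. -/
theorem IsPoissonProcess.tendstoInDistribution_tsum [IsProbabilityMeasure P]
    (h : IsPoissonProcess X (markedLebesgue lam Θ) P) (hlam : 0 < lam) {ψ : ℝ → ℝ}
    (hψ : Measurable ψ) (hψ1 : ∀ s, |ψ s| ≤ 1) (hσ : 0 < ∫ s in (-1 : ℝ)..1, ψ s ^ 2) :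
    TendstoInDistribution (fun (r : ℝ) ω =>
      (∑' i, (Set.Icc (-r) r ×ˢ Set.univ).indicator (fun x : ℝ × S => ψ (x.1 / r)) (X i ω) -
        lam * r * ∫ s in (-1 : ℝ)..1, ψ s) / √(lam * r * ∫ s in (-1 : ℝ)..1, ψ s ^ 2))
      atTop (fun x : ℝ => x) (fun _ => P) (gaussianReal 0 1) := by
  set σ := ∫ s in (-1 : ℝ)..1, ψ s ^ 2
  set m := ∫ s in (-1 : ℝ)..1, ψ s
  have hWm : ∀ r : ℝ, MeasurableSet (Set.Icc (-r) r ×ˢ (Set.univ : Set S)) :=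
    fun r => measurableSet_Icc.prod .univ
  have hWfin : ∀ r : ℝ, markedLebesgue lam Θ (Set.Icc (-r) r ×ˢ (Set.univ : Set S)) ≠ ∞ := by
    intro r
    rw [Measure.prod_prod, Measure.smul_apply, Real.volume_Icc]
    exact ENNReal.mul_ne_top (ENNReal.mul_ne_top (by simp) (by simp)) (by simp)
  have hLm : ∀ r : ℝ, Measurable fun ω => ∑' i, (Set.Icc (-r) r ×ˢ Set.univ).indicator
      (fun x : ℝ × S => ψ (x.1 / r)) (X i ω) := fun r =>
    h.measurable_tsum_indicator (hWm r) (by fun_prop)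
  have hTm : ∀ r : ℝ, AEMeasurable (fun ω =>
      (∑' i, (Set.Icc (-r) r ×ˢ Set.univ).indicator (fun x : ℝ × S => ψ (x.1 / r)) (X i ω) -
        lam * r * m) / √(lam * r * σ)) P := fun r =>
    (((hLm r).sub_const _).div_const _).aemeasurable
  have hint : ∀ (c : ℂ) (k : ℕ), IntervalIntegrable (fun s => c * (ψ s : ℂ) ^ k) volume (-1) 1 := by
    intro c k
    refine (intervalIntegrable_const (c := (1 : ℝ))).mono_fun
      (by fun_prop) (ae_of_all _ fun s => ?_) |>.const_mul c
    simp only [norm_pow, Complex.norm_real, Real.norm_eq_abs]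
    simpa using pow_le_one₀ (abs_nonneg _) (hψ1 s)
  have hm_eq : ∫ s in (-1 : ℝ)..1, (ψ s : ℂ) = m := intervalIntegral.integral_ofReal
  have hσ_eq : ∫ s in (-1 : ℝ)..1, (ψ s : ℂ) ^ 2 = σ := by
    rw [← intervalIntegral.integral_ofReal]
    simp
  refine ⟨hTm, by fun_prop, ?_⟩
  -- Lévy's continuity theorem is applied along sequences of radii.
  refine tendsto_of_seq_tendsto fun x hx => ?_
  refine ProbabilityMeasure.tendsto_iff_tendsto_charFun.2 fun u => ?_
  simp only [ProbabilityMeasure.coe_mk, Measure.map_id']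
  rw [charFun_gaussianReal]
  -- The exponent of the characteristic function after the substitution `p = r s`; centring removes
  -- the first-order term.
  let E : ℝ → ℂ := fun r => lam * r * ∫ s in (-1 : ℝ)..1,
    (Complex.exp ((u / √(lam * r * σ) : ℝ) * ψ s * Complex.I) - 1 -
      (u / √(lam * r * σ) : ℝ) * ψ s * Complex.I)
  have hE : ∀ r : ℝ, 0 < r → charFun (P.map fun ω =>
      (∑' i, (Set.Icc (-r) r ×ˢ Set.univ).indicator (fun x : ℝ × S => ψ (x.1 / r)) (X i ω) -
        lam * r * m) / √(lam * r * σ)) u = Complex.exp (E r) := by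
    intro r hr
    set c : ℝ := u / √(lam * r * σ) with hc
    rw [charFun_apply_real, integral_map (hTm r) (by fun_prop)]
    have h1 := h.integral_exp_tsum (hWm r) (hWfin r)
      (g := fun x : ℝ × S => ψ (x.1 / r)) (by fun_prop) c
    have hexpI : IntegrableOn (fun x : ℝ × S => Complex.exp (c * ψ (x.1 / r) * Complex.I) - 1)
        (Set.Icc (-r) r ×ˢ Set.univ) (markedLebesgue lam Θ) := by
      have : IsFiniteMeasure ((markedLebesgue lam Θ).restrict (Set.Icc (-r) r ×ˢ Set.univ)) :=
        ⟨by simpa using (hWfin r).lt_top⟩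
      have hm1 : Measurable fun x : ℝ × S => (c * ψ (x.1 / r) * Complex.I : ℂ) := by fun_prop
      refine Integrable.of_bound
        ((Complex.measurable_exp.comp hm1).sub_const 1).aestronglyMeasurable 2
        (ae_of_all _ fun x => ?_)
      refine (norm_sub_le _ _).trans ?_
      rw [← Complex.ofReal_mul, Complex.norm_exp_ofReal_mul_I]
      norm_num
    rw [setIntegral_markedLebesgue hlam.le hr
      (F := fun p => Complex.exp (c * ψ (p / r) * Complex.I) - 1) hexpI] at h1
    simp_rw [mul_div_cancel_left₀ _ hr.ne'] at h1
    have h2 : ∀ ω, Complex.exp (u * ((∑' i, (Set.Icc (-r) r ×ˢ Set.univ).indicator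
        (fun x : ℝ × S => ψ (x.1 / r)) (X i ω) - lam * r * m) / √(lam * r * σ) : ℝ) * Complex.I) =
        Complex.exp (c * (∑' i, (Set.Icc (-r) r ×ˢ Set.univ).indicator
        (fun x : ℝ × S => ψ (x.1 / r)) (X i ω) : ℝ) * Complex.I) *
          Complex.exp (-(lam * r * (c * m * Complex.I))) := by
      intro ω
      rw [← Complex.exp_add, hc]
      congr 1
      push_cast
      ring
    simp_rw [h2]
    rw [integral_mul_const, h1, ← Complex.exp_add]
    congr 1
    simp only [E]
    have hi1 : IntervalIntegrable (fun s => Complex.exp (c * ψ s * Complex.I) - 1)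
        volume (-1) 1 := by
      refine (intervalIntegrable_const (c := (2 : ℝ))).mono_fun (by fun_prop)
        (ae_of_all _ fun s => ?_)
      refine (norm_sub_le _ _).trans ?_
      rw [← Complex.ofReal_mul, Complex.norm_exp_ofReal_mul_I]
      norm_num
    have hi2 : IntervalIntegrable (fun s => (c * ψ s * Complex.I : ℂ)) volume (-1) 1 := by
      simpa [mul_right_comm] using hint (c * Complex.I) 1
    have hi3 : ∫ s in (-1 : ℝ)..1, (c : ℂ) * ψ s * Complex.I = c * m * Complex.I := by
      rw [intervalIntegral.integral_mul_const, intervalIntegral.integral_const_mul, hm_eq]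
    rw [← hc, intervalIntegral.integral_sub hi1 hi2, hi3]
    ring
  -- With `c = u / √(λ r σ)`, the quadratic term integrates exactly to `-u²/2`, and the cubic
  -- remainder is of order `r |c|³`, that is `r^{-1/2}`.
  have hbound : ∀ᶠ r : ℝ in atTop, ‖E r - (-(u ^ 2 / 2) : ℝ)‖ ≤
      lam * 2 * (|u| ^ 3 * Real.exp 1 / √(lam * σ) ^ 3) * (√r)⁻¹ := by
    have hev : ∀ᶠ r : ℝ in atTop, |u| / √(lam * r * σ) ≤ 1 := by
      have : Tendsto (fun r : ℝ => √(lam * r * σ)) atTop atTop := by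
        refine Real.tendsto_sqrt_atTop.comp ?_
        exact (tendsto_id.const_mul_atTop hlam).atTop_mul_const hσ
      have := this.const_div_atTop |u|
      exact this.eventually_le_const zero_lt_one
    filter_upwards [hev, eventually_gt_atTop 0] with r hr1 hr0
    have hs0 : 0 < √(lam * r * σ) := Real.sqrt_pos.2 (by positivity)
    set c : ℝ := u / √(lam * r * σ) with hc
    have hcabs : |c| ≤ 1 := by rwa [hc, abs_div, abs_of_pos hs0]
    have hc2 : lam * r * σ * c ^ 2 = u ^ 2 := by
      rw [hc, div_pow, Real.sq_sqrt (by positivity)]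
      field_simp
    have hmain : E r - (-(u ^ 2 / 2) : ℝ) = lam * r * ∫ s in (-1 : ℝ)..1,
        (Complex.exp (c * ψ s * Complex.I) - 1 - c * ψ s * Complex.I -
          -(c ^ 2 / 2) * ψ s ^ 2) := by
      rw [intervalIntegral.integral_sub _ (hint _ 2), intervalIntegral.integral_const_mul, hσ_eq,
        mul_sub]
      · simp only [E]
        congr 1
        rw [← hc2]
        push_cast
        ring
      · refine (intervalIntegrable_const (c := (3 : ℝ))).mono_fun (by fun_prop)
          (ae_of_all _ fun s => ?_)
        refine (norm_sub_le _ _).trans ((add_le_add_left (norm_sub_le _ _) _).trans ?_)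
        rw [← Complex.ofReal_mul, Complex.norm_exp_ofReal_mul_I, norm_mul, Complex.norm_real,
          Complex.norm_I, Real.norm_eq_abs, abs_mul]
        have := mul_le_one₀ hcabs (abs_nonneg (ψ s)) (hψ1 s)
        norm_num
        linarith
    rw [hmain, norm_mul, norm_mul, Complex.norm_real, Complex.norm_real, Real.norm_eq_abs,
      Real.norm_eq_abs, abs_of_pos hlam, abs_of_pos hr0]
    have hI : ‖∫ s in (-1 : ℝ)..1, (Complex.exp (c * ψ s * Complex.I) - 1 - c * ψ s * Complex.I -
          -(c ^ 2 / 2) * ψ s ^ 2)‖ ≤ (|c| ^ 3 * Real.exp 1) * |1 - (-1)| := by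
      refine intervalIntegral.norm_integral_le_of_norm_le_const fun s _ => ?_
      -- The Taylor remainder is at most `|cψ|³ e^{|cψ|}`, and `|cψ| ≤ 1` bounds the exponential by
      -- `e`.
      have h3 := Complex.norm_exp_sub_sum_le_norm_mul_exp (c * ψ s * Complex.I) 3
      have hn : ‖(c * ψ s * Complex.I : ℂ)‖ = |c| * |ψ s| := by simp
      have e : Complex.exp (c * ψ s * Complex.I) - ∑ k ∈ Finset.range 3,
          (c * ψ s * Complex.I : ℂ) ^ k / k ! = Complex.exp (c * ψ s * Complex.I) - 1 -
            c * ψ s * Complex.I - -(c ^ 2 / 2) * ψ s ^ 2 := by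
        simp [Finset.sum_range_succ, mul_pow, Nat.factorial]
        ring
      rw [e, hn] at h3
      refine h3.trans ?_
      have h4 : |c| * |ψ s| ≤ |c| := mul_le_of_le_one_right (abs_nonneg _) (hψ1 s)
      have h5 : |c| * |ψ s| ≤ 1 := h4.trans hcabs
      gcongr
    refine (mul_le_mul_of_nonneg_left hI (by positivity)).trans (le_of_eq ?_)
    have hsq : √(lam * r * σ) = √(lam * σ) * √r := by
      rw [← Real.sqrt_mul (by positivity)]; congr 1; ring
    have hsr : 0 < √r := Real.sqrt_pos.2 hr0
    have hsl : 0 < √(lam * σ) := Real.sqrt_pos.2 (by positivity)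
    rw [hc, abs_div, abs_of_pos hs0, hsq]
    norm_num
    have hrr : √r ^ 2 = r := Real.sq_sqrt hr0.le
    field_simp
    rw [hrr]
    ring
  have hElim : Tendsto E atTop (𝓝 ((-(u ^ 2 / 2) : ℝ) : ℂ)) := by
    rw [tendsto_iff_norm_sub_tendsto_zero]
    refine squeeze_zero' (Eventually.of_forall fun _ => norm_nonneg _) hbound ?_
    have : Tendsto (fun r : ℝ => (√r)⁻¹) atTop (𝓝 0) :=
      tendsto_inv_atTop_zero.comp Real.tendsto_sqrt_atTop
    simpa using this.const_mul (lam * 2 * (|u| ^ 3 * Real.exp 1 / √(lam * σ) ^ 3))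
  have hfinal := ((Complex.continuous_exp.tendsto _).comp hElim).comp hx
  have e : Complex.exp ((-(u ^ 2 / 2) : ℝ) : ℂ) = Complex.exp (u * (0 : ℝ) * Complex.I -
      ((1 : ℝ≥0) : ℝ) * (u : ℂ) ^ 2 / 2) := by
    congr 1
    push_cast
    simp
  rw [e] at hfinal
  refine hfinal.congr' ?_
  filter_upwards [hx.eventually (eventually_gt_atTop 0)] with j hj
  exact (hE _ hj).symm

end CLT

/-! ### Intersections of random hyperplanes with balls in subspaces -/

/-- The integral of `(1 - s²)^{m/2}` over `[-1, 1]`. -/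
def capIntegral (m : ℕ) : ℝ := ∫ s in (-1 : ℝ)..1, √(1 - s ^ 2) ^ m

lemma capIntegral_nonneg (m : ℕ) : 0 ≤ capIntegral m :=
  intervalIntegral.integral_nonneg (by norm_num) fun _ _ => by positivity

/-- The volume constant attached to mean projection lengths `γ`: the mean measure of the set of
`m` hyperplanes whose intersection meets the unit ball of an `n`-dimensional subspace. -/
def hitConst (γ : ℕ → ℝ) : ℕ → ℕ → ℝ
  | _, 0 => 1
  | n, m + 1 => γ n * capIntegral m * hitConst γ (n - 1) m

lemma hitConst_nonneg {γ : ℕ → ℝ} (hγ : ∀ n, 0 ≤ γ n) (n m : ℕ) : 0 ≤ hitConst γ n m := by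
  induction m generalizing n with
  | zero => simp [hitConst]
  | succ m ih =>
    rw [hitConst]
    exact mul_nonneg (mul_nonneg (hγ n) (capIntegral_nonneg m)) (ih _)

/-- After translating by `a`, substitute `p = ρ b s`. In the application `b` is the length of the
projected normal, and `ρ` the radius of the ball being cut. -/
lemma lintegral_profile (m : ℕ) {ρ b C : ℝ} (hρ : 0 ≤ ρ) (hb : 0 < b) (hC : 0 ≤ C) (a : ℝ) :
    ∫⁻ p : ℝ, (if |p - a| ≤ ρ * b then
      ENNReal.ofReal (C * √(ρ ^ 2 - ((p - a) / b) ^ 2) ^ m) else 0) =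
        ENNReal.ofReal (C * (b * ρ ^ (m + 1) * capIntegral m)) := by
  rw [lintegral_sub_right_eq_self (fun q : ℝ => if |q| ≤ ρ * b then
      ENNReal.ofReal (C * √(ρ ^ 2 - (q / b) ^ 2) ^ m) else 0) a]
  have h1 : (fun q : ℝ => if |q| ≤ ρ * b then
      ENNReal.ofReal (C * √(ρ ^ 2 - (q / b) ^ 2) ^ m) else 0) =
      (Set.Icc (-(ρ * b)) (ρ * b)).indicator
        fun q => ENNReal.ofReal (C * √(ρ ^ 2 - (q / b) ^ 2) ^ m) := by
    ext q
    simp only [Set.indicator, Set.mem_Icc, abs_le]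
  have hcont : Continuous fun q : ℝ => C * √(ρ ^ 2 - (q / b) ^ 2) ^ m := by fun_prop
  rw [h1, lintegral_indicator measurableSet_Icc,
    ← ofReal_integral_eq_lintegral_ofReal hcont.continuousOn.integrableOn_Icc
      (ae_of_all _ fun q => by positivity), integral_Icc_eq_integral_Ioc,
    ← intervalIntegral.integral_of_le (by nlinarith [mul_nonneg hρ hb.le])]
  congr 1
  rcases hρ.eq_or_lt with rfl | hρ0
  · simp
  have h2 := intervalIntegral.integral_comp_mul_left (a := -1) (b := 1)
    (fun q : ℝ => C * √(ρ ^ 2 - (q / b) ^ 2) ^ m) (mul_pos hρ0 hb).ne'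
  have h3 : ∀ s : ℝ, C * √(ρ ^ 2 - (ρ * b * s / b) ^ 2) ^ m = C * ρ ^ m * √(1 - s ^ 2) ^ m := by
    intro s
    have : ρ ^ 2 - (ρ * b * s / b) ^ 2 = ρ ^ 2 * (1 - s ^ 2) := by field_simp
    rw [this, Real.sqrt_mul (by positivity), Real.sqrt_sq hρ, mul_pow, mul_assoc]
  simp_rw [h3] at h2
  rw [intervalIntegral.integral_const_mul, mul_neg, mul_one, smul_eq_mul] at h2
  rw [capIntegral]
  have hne : ρ * b ≠ 0 := (mul_pos hρ0 hb).ne'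
  rw [eq_inv_mul_iff_mul_eq₀ hne] at h2
  rw [← h2]
  ring

section Geometry

variable {E : Type*} [NormedAddCommGroup E] [InnerProductSpace ℝ E]

/-- The configurations of `m` hyperplanes whose intersection meets the ball of radius `ρ` of the
affine subspace `x₀ + W`. -/
def hitSet (W : Submodule ℝ E) (x₀ : E) (ρ : ℝ) (m : ℕ) :
    Set (Fin m → ℝ × Metric.sphere (0 : E) 1) :=
  {x | ∃ y ∈ W, ‖y‖ ≤ ρ ∧ ∀ i, inner ℝ (x₀ + y) ((x i).2 : E) = (x i).1}

variable [FiniteDimensional ℝ E]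

/-- The set is the image of a closed incidence relation under the projection along a compact ball,
which is a closed map. Measurability follows from this. -/
lemma isClosed_hitSet (W : Submodule ℝ E) (x₀ : E) (ρ : ℝ) (m : ℕ) :
    IsClosed (hitSet W x₀ ρ m) := by
  let C : Set E := (W : Set E) ∩ Metric.closedBall 0 ρ
  have hC : IsCompact C := (isCompact_closedBall 0 ρ).inter_left W.closed_of_finiteDimensional
  have : CompactSpace C := isCompact_iff_compactSpace.1 hC
  let T : Set (C × (Fin m → ℝ × Metric.sphere (0 : E) 1)) :=
    {z | ∀ i, inner ℝ (x₀ + (z.1 : E)) ((z.2 i).2 : E) = (z.2 i).1}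
  have hT : IsClosed T := by
    simp only [T, Set.ofPred_forall]
    exact isClosed_iInter fun i => isClosed_eq (by fun_prop) (by fun_prop)
  convert! isClosedMap_snd_of_compactSpace T hT using 1
  ext x
  constructor
  · rintro ⟨y, hy, hyρ, h⟩
    exact ⟨(⟨y, hy, by simpa using hyρ⟩, x), h, rfl⟩
  · rintro ⟨⟨⟨y, hy, hyρ⟩, x'⟩, h, rfl⟩
    exact ⟨y, hy, by simpa using hyρ, h⟩

lemma inner_starProjection_of_mem {W : Submodule ℝ E} {y : E} (hy : y ∈ W) (v : E) :
    inner ℝ y (W.starProjection v) = inner ℝ y v := by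
  rw [← W.inner_starProjection_left_eq_right, Submodule.starProjection_eq_self_iff.2 hy]

/-- On `W`, pairing with `v` is pairing with its projection `w`. Hence the solutions in `W` are
`(q/‖w‖²) w` plus vectors of `W` orthogonal to `v`, and Pythagoras gives the radius of the section.
The predicate `Q` stands for the remaining hyperplanes. -/
lemma exists_mem_inner_eq_iff {W : Submodule ℝ E} {v : E} (hw : W.starProjection v ≠ 0) (x₀ : E)
    {ρ : ℝ} (hρ : 0 ≤ ρ) (p : ℝ) (Q : E → Prop) :
    (∃ y ∈ W, ‖y‖ ≤ ρ ∧ inner ℝ (x₀ + y) v = p ∧ Q (x₀ + y)) ↔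
      |p - inner ℝ x₀ v| ≤ ρ * ‖W.starProjection v‖ ∧
      ∃ y ∈ W ⊓ (ℝ ∙ v)ᗮ, ‖y‖ ≤ √(ρ ^ 2 - ((p - inner ℝ x₀ v) / ‖W.starProjection v‖) ^ 2) ∧
        Q (x₀ + ((p - inner ℝ x₀ v) / ‖W.starProjection v‖ ^ 2) • W.starProjection v + y) := by
  set w := W.starProjection v
  set q := p - inner ℝ x₀ v with hq
  have hwW : w ∈ W := W.starProjection_apply_mem v
  have hb : 0 < ‖w‖ := norm_pos_iff.2 hw
  have hwv : inner ℝ w v = ‖w‖ ^ 2 := by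
    rw [← inner_starProjection_of_mem hwW v]
    exact real_inner_self_eq_norm_sq w
  constructor
  · rintro ⟨y, hy, hyρ, hp, hQ⟩
    have hyw : inner ℝ y w = q := by
      rw [inner_starProjection_of_mem hy, hq, ← hp, inner_add_left]
      ring
    have habs : |q| ≤ ρ * ‖w‖ := by
      rw [← hyw]
      exact (abs_real_inner_le_norm y w).trans (by gcongr)
    refine ⟨habs, y - (q / ‖w‖ ^ 2) • w, ⟨?_, ?_⟩, ?_, ?_⟩
    · exact W.sub_mem hy (W.smul_mem _ hwW)
    · rw [SetLike.mem_coe, Submodule.mem_orthogonal_singleton_iff_inner_left, inner_sub_left,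
        inner_smul_left, hwv,
        ← inner_starProjection_of_mem hy]
      change inner ℝ y w - _ = 0
      rw [hyw]
      simp only [conj_trivial]
      field_simp
      ring
    · apply Real.le_sqrt_of_sq_le
      rw [norm_sub_sq_real, inner_smul_right, hyw, norm_smul, Real.norm_eq_abs, mul_pow, sq_abs]
      have : ‖y‖ ^ 2 ≤ ρ ^ 2 := by gcongr
      have e : ‖y‖ ^ 2 - 2 * (q / ‖w‖ ^ 2 * q) + (q / ‖w‖ ^ 2) ^ 2 * ‖w‖ ^ 2 =
          ‖y‖ ^ 2 - (q / ‖w‖) ^ 2 := by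
        field_simp
        ring
      rw [e]
      linarith
    · convert hQ using 1
      abel
  · rintro ⟨habs, y, ⟨hy, hyv⟩, hyρ, hQ⟩
    rw [SetLike.mem_coe, Submodule.mem_orthogonal_singleton_iff_inner_left] at hyv
    have hyw : inner ℝ w y = 0 := by
      rw [real_inner_comm, inner_starProjection_of_mem hy, hyv]
    have hnn : 0 ≤ ρ ^ 2 - (q / ‖w‖) ^ 2 := by
      rw [sub_nonneg, sq_le_sq, abs_div, abs_norm, abs_of_nonneg hρ, div_le_iff₀ hb]
      exact habs
    refine ⟨(q / ‖w‖ ^ 2) • w + y, W.add_mem (W.smul_mem _ hwW) hy, ?_, ?_, ?_⟩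
    · rw [← abs_of_nonneg hρ, ← abs_norm, ← sq_le_sq, norm_add_sq_real, inner_smul_left, hyw,
        norm_smul, Real.norm_eq_abs, mul_pow, sq_abs]
      have h1 : ‖y‖ ^ 2 ≤ ρ ^ 2 - (q / ‖w‖) ^ 2 := by
        rw [← Real.sq_sqrt hnn]
        gcongr
      have h2 : (q / ‖w‖ ^ 2) ^ 2 * ‖w‖ ^ 2 = (q / ‖w‖) ^ 2 := by field_simp
      rw [h2]
      linarith
    · rw [inner_add_left, inner_add_left, inner_smul_left, hwv, hyv]
      simp only [conj_trivial]
      rw [div_mul_cancel₀ _ (by positivity)]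
      simp [hq]
    · rwa [← add_assoc]

/-- Pairing with `v` is a nonzero functional on `W`, and the intersection is its kernel. -/
lemma finrank_inf_orthogonal_singleton {W : Submodule ℝ E} {v : E}
    (hw : W.starProjection v ≠ 0) :
    Module.finrank ℝ (W ⊓ (ℝ ∙ v)ᗮ : Submodule ℝ E) = Module.finrank ℝ W - 1 := by
  let f : W →ₗ[ℝ] ℝ := (innerₛₗ ℝ v).comp W.subtype
  have hf : ∀ y : W, f y = inner ℝ v (y : E) := fun y => rfl
  have hsurj : LinearMap.range f = ⊤ := by
    rw [LinearMap.range_eq_top]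
    refine LinearMap.surjective fun h0 => hw ?_
    have h1 := LinearMap.congr_fun h0 ⟨W.starProjection v, W.starProjection_apply_mem v⟩
    rw [hf, real_inner_comm] at h1
    simp only [LinearMap.zero_apply] at h1
    rw [← inner_starProjection_of_mem (W.starProjection_apply_mem v)] at h1
    exact inner_self_eq_zero.1 h1
  have hker : W ⊓ (ℝ ∙ v)ᗮ = (LinearMap.ker f).map W.subtype := by
    ext y
    simp only [Submodule.mem_inf, Submodule.mem_orthogonal_singleton_iff_inner_right,
      Submodule.mem_map, LinearMap.mem_ker, Submodule.subtype_apply]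
    constructor
    · rintro ⟨hy, hyv⟩
      exact ⟨⟨y, hy⟩, by rw [hf]; exact hyv, rfl⟩
    · rintro ⟨y, hy, rfl⟩
      exact ⟨y.2, by rw [← hf]; exact hy⟩
  have := f.finrank_range_add_finrank_ker
  rw [hsurj, finrank_top, Module.finrank_self] at this
  rw [hker, Submodule.finrank_map_subtype_eq]
  omega

lemma insertNth_mem_hitSet_iff {W : Submodule ℝ E} {m : ℕ} (a : Fin (m + 1))
    (y : ℝ × Metric.sphere (0 : E) 1) (z : Fin m → ℝ × Metric.sphere (0 : E) 1)
    (hw : W.starProjection (y.2 : E) ≠ 0) (x₀ : E) {ρ : ℝ} (hρ : 0 ≤ ρ) :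
    (Fin.insertNth a y z : Fin (m + 1) → ℝ × Metric.sphere (0 : E) 1) ∈ hitSet W x₀ ρ (m + 1) ↔
      |y.1 - inner ℝ x₀ (y.2 : E)| ≤ ρ * ‖W.starProjection (y.2 : E)‖ ∧
      z ∈ hitSet (W ⊓ (ℝ ∙ (y.2 : E))ᗮ)
        (x₀ + ((y.1 - inner ℝ x₀ (y.2 : E)) / ‖W.starProjection (y.2 : E)‖ ^ 2) •
          W.starProjection (y.2 : E))
        √(ρ ^ 2 - ((y.1 - inner ℝ x₀ (y.2 : E)) / ‖W.starProjection (y.2 : E)‖) ^ 2) m := by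
  rw [hitSet, hitSet, Set.mem_ofPred_eq, Set.mem_ofPred_eq,
    ← exists_mem_inner_eq_iff hw x₀ hρ y.1 (fun u => ∀ i, inner ℝ u ((z i).2 : E) = (z i).1)]
  simp_rw [Fin.forall_iff_succAbove a, Fin.insertNth_apply_same, Fin.insertNth_apply_succAbove]

lemma _root_.Set.indicator_one_congr {α β : Type*} {s : Set α} {t : Set β} {a : α} {b : β}
    (h : a ∈ s ↔ b ∈ t) :
    s.indicator (1 : α → ℝ≥0∞) a = t.indicator (1 : β → ℝ≥0∞) b := by
  classical
  simp only [Set.indicator_apply, h, Pi.one_apply]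

variable [MeasurableSpace E] [BorelSpace E] {Θ : Measure (Metric.sphere (0 : E) 1)}
  [IsProbabilityMeasure Θ] {lam : ℝ}

lemma measurableSet_hitSet (W : Submodule ℝ E) (x₀ : E) (ρ : ℝ) (m : ℕ) :
    MeasurableSet (hitSet W x₀ ρ m) :=
  (isClosed_hitSet W x₀ ρ m).measurableSet

/-- The mean measure of the configurations of hyperplanes whose intersection meets a ball of an
affine subspace. -/
theorem measure_hitSet {γ : ℕ → ℝ} (hγ : ∀ n, 0 ≤ γ n) (hlam : 0 ≤ lam)
    (hΘ : ∀ W : Submodule ℝ E, ∫⁻ v, ENNReal.ofReal ‖W.starProjection (v : E)‖ ∂Θ =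
      ENNReal.ofReal (γ (Module.finrank ℝ W)))
    (m : ℕ) (W : Submodule ℝ E) (x₀ : E) {ρ : ℝ} (hρ : 0 ≤ ρ) :
    Measure.pi (fun _ : Fin m => markedLebesgue lam Θ) (hitSet W x₀ ρ m) =
      ENNReal.ofReal (lam ^ m * hitConst γ (Module.finrank ℝ W) m * ρ ^ m) := by
  induction m generalizing W x₀ ρ with
  | zero =>
    have : hitSet W x₀ ρ 0 = Set.univ :=
      Set.eq_univ_of_forall fun x => ⟨0, W.zero_mem, by simpa using hρ, fun i => i.elim0⟩
    rw [this, Measure.pi_of_empty]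
    simp [hitConst]
  | succ m ih =>
    have hmeas := measurableSet_hitSet W x₀ ρ (m + 1)
    have hins : Measurable fun p : (ℝ × Metric.sphere (0 : E) 1) ×
        (Fin m → ℝ × Metric.sphere (0 : E) 1) =>
        (hitSet W x₀ ρ (m + 1)).indicator
          (1 : (Fin (m + 1) → ℝ × Metric.sphere (0 : E) 1) → ℝ≥0∞) (Fin.insertNth 0 p.1 p.2) :=
      (measurable_one.indicator hmeas).comp (measurable_insertNth 0)
    rw [← lintegral_indicator_one hmeas]
    have h1 := lintegral_pi_insertNth (Λ := markedLebesgue lam Θ) (0 : Fin (m + 1))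
      (F := fun y z => (hitSet W x₀ ρ (m + 1)).indicator
          (1 : (Fin (m + 1) → ℝ × Metric.sphere (0 : E) 1) → ℝ≥0∞) (Fin.insertNth 0 y z)) hins
    simp only [Fin.insertNth_self_removeNth] at h1
    have : SigmaFinite (markedLebesgue lam Θ) := inferInstance
    have hG : Measurable fun y : ℝ × Metric.sphere (0 : E) 1 =>
        ∫⁻ z, (hitSet W x₀ ρ (m + 1)).indicator
          (1 : (Fin (m + 1) → ℝ × Metric.sphere (0 : E) 1) → ℝ≥0∞)
          (Fin.insertNth 0 y z) ∂(Measure.pi fun _ : Fin m => markedLebesgue lam Θ) :=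
      hins.lintegral_prod_right'
    rw [h1, lintegral_prod_symm _ hG.aemeasurable]
    have h2 : ∀ v : Metric.sphere (0 : E) 1,
        ∫⁻ p, ∫⁻ z, (hitSet W x₀ ρ (m + 1)).indicator (1 : (Fin (m + 1) → ℝ × Metric.sphere (0 : E) 1) → ℝ≥0∞)
          (Fin.insertNth 0 (p, v) z) ∂(Measure.pi fun _ : Fin m => markedLebesgue lam Θ)
          ∂(ENNReal.ofReal lam • (volume : Measure ℝ)) =
        ENNReal.ofReal ‖W.starProjection (v : E)‖ *
          ENNReal.ofReal (lam ^ (m + 1) * (capIntegral m * hitConst γ (Module.finrank ℝ W - 1) m) *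
            ρ ^ (m + 1)) := by
      intro v
      rw [lintegral_smul_measure]
      -- If `v` is orthogonal to `W`, then pairing with `v` is constant on `x₀ + W`, so a single
      -- offset can be hit. Its measure is zero, in agreement with the projection length.
      by_cases hw : W.starProjection (v : E) = 0
      · rw [hw]
        simp only [norm_zero, ENNReal.ofReal_zero, zero_mul, smul_eq_mul, mul_eq_zero]
        right
        have hz : ∀ p : ℝ, p ≠ inner ℝ x₀ (v : E) → ∀ z : Fin m → ℝ × Metric.sphere (0 : E) 1,
            (hitSet W x₀ ρ (m + 1)).indicator
          (1 : (Fin (m + 1) → ℝ × Metric.sphere (0 : E) 1) → ℝ≥0∞) (Fin.insertNth 0 (p, v) z) = 0 := by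
          intro p hp z
          refine Set.indicator_of_notMem ?_ _
          rintro ⟨y, hy, -, h⟩
          have h0 := h 0
          simp only [Fin.insertNth_apply_same] at h0
          rw [inner_add_left, ← inner_starProjection_of_mem hy, hw, inner_zero_right,
            add_zero] at h0
          exact hp h0.symm
        refine lintegral_eq_zero_of_ae_eq_zero ?_
        have : ∀ᵐ p : ℝ, p ≠ inner ℝ x₀ (v : E) := by simp [ae_iff]
        filter_upwards [this] with p hp
        simp only [hz p hp, lintegral_zero, Pi.zero_apply]
      · set b := ‖W.starProjection (v : E)‖ with hbdef
        have hb : 0 < b := norm_pos_iff.2 hw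
        set C := lam ^ m * hitConst γ (Module.finrank ℝ W - 1) m with hC
        have hC0 : 0 ≤ C := mul_nonneg (by positivity) (hitConst_nonneg hγ _ _)
        have h3 : ∀ p : ℝ, ∫⁻ z, (hitSet W x₀ ρ (m + 1)).indicator (1 : (Fin (m + 1) → ℝ × Metric.sphere (0 : E) 1) → ℝ≥0∞)
            (Fin.insertNth 0 (p, v) z) ∂(Measure.pi fun _ : Fin m => markedLebesgue lam Θ) =
            if |p - inner ℝ x₀ (v : E)| ≤ ρ * b then
              ENNReal.ofReal (C * √(ρ ^ 2 - ((p - inner ℝ x₀ (v : E)) / b) ^ 2) ^ m) else 0 := by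
          intro p
          have hiff := fun z => insertNth_mem_hitSet_iff (0 : Fin (m + 1)) (p, v) z hw x₀ hρ
          simp only [← hbdef] at hiff
          split_ifs with hp
          -- The section is a ball in a translate of `W ∩ v^⊥`, so the induction hypothesis applies
          -- with the new centre and radius.
          · have := ih (W ⊓ (ℝ ∙ (v : E))ᗮ)
              (x₀ + ((p - inner ℝ x₀ (v : E)) / b ^ 2) • W.starProjection (v : E))
              (Real.sqrt_nonneg (ρ ^ 2 - ((p - inner ℝ x₀ (v : E)) / b) ^ 2))
            rw [finrank_inf_orthogonal_singleton hw] at this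
            rw [hC, ← this, ← lintegral_indicator_one (measurableSet_hitSet _ _ _ _)]
            refine lintegral_congr fun z => ?_
            exact Set.indicator_one_congr (by rw [hiff]; exact and_iff_right hp)
          · rw [lintegral_eq_zero_of_ae_eq_zero]
            refine ae_of_all _ fun z => Set.indicator_of_notMem (fun h => hp ?_) _
            exact ((hiff z).1 h).1
        simp_rw [h3]
        rw [lintegral_profile m hρ hb hC0, smul_eq_mul, ← ENNReal.ofReal_mul hlam,
          ← ENNReal.ofReal_mul hb.le, hC]
        congr 1
        ring
    simp_rw [h2]
    rw [lintegral_mul_const', hΘ, ← ENNReal.ofReal_mul (hγ _)]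
    · congr 1
      rw [hitConst]
      ring
    · simp

/-- The mean measure of the hyperplanes that together with a given one meet a ball. -/
theorem lintegral_insertNth_hitSet {γ : ℕ → ℝ} (hγ : ∀ n, 0 ≤ γ n) (hlam : 0 ≤ lam)
    (hΘ : ∀ W : Submodule ℝ E, ∫⁻ v, ENNReal.ofReal ‖W.starProjection (v : E)‖ ∂Θ =
      ENNReal.ofReal (γ (Module.finrank ℝ W)))
    {n : ℕ} (a : Fin (n + 1)) (y : ℝ × Metric.sphere (0 : E) 1) {r : ℝ} (hr : 0 < r) :
    ∫⁻ z, (hitSet (⊤ : Submodule ℝ E) 0 r (n + 1)).indicator (1 : (Fin (n + 1) → ℝ × Metric.sphere (0 : E) 1) → ℝ≥0∞) (Fin.insertNth a y z)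
      ∂(Measure.pi fun _ : Fin n => markedLebesgue lam Θ) =
      ENNReal.ofReal (lam ^ n * hitConst γ (Module.finrank ℝ E - 1) n * r ^ n) *
        (Set.Icc (-r) r ×ˢ Set.univ).indicator
          (fun x : ℝ × Metric.sphere (0 : E) 1 => ENNReal.ofReal (√(1 - (x.1 / r) ^ 2) ^ n)) y := by
  -- In the whole space a unit normal is its own projection, so the measure of the completions
  -- depends on the offset only.
  have hw1 : ‖(⊤ : Submodule ℝ E).starProjection (y.2 : E)‖ = 1 := by
    rw [Submodule.starProjection_top]
    simp
  have hw : (⊤ : Submodule ℝ E).starProjection (y.2 : E) ≠ 0 := by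
    rw [← norm_pos_iff, hw1]; norm_num
  have hiff := fun z => insertNth_mem_hitSet_iff a y z hw 0 hr.le
  simp only [hw1, inner_zero_left, sub_zero, mul_one, div_one, zero_add, one_pow] at hiff
  by_cases hp : |y.1| ≤ r
  · have := measure_hitSet hγ hlam hΘ n (⊤ ⊓ (ℝ ∙ (y.2 : E))ᗮ)
      (y.1 • (⊤ : Submodule ℝ E).starProjection (y.2 : E)) (Real.sqrt_nonneg (r ^ 2 - y.1 ^ 2))
    rw [finrank_inf_orthogonal_singleton hw, finrank_top] at this
    have hmem : y ∈ Set.Icc (-r) r ×ˢ (Set.univ : Set (Metric.sphere (0 : E) 1)) :=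
      ⟨abs_le.1 hp, trivial⟩
    have hs : √(r ^ 2 - y.1 ^ 2) = r * √(1 - (y.1 / r) ^ 2) := by
      have : r ^ 2 - y.1 ^ 2 = r ^ 2 * (1 - (y.1 / r) ^ 2) := by field_simp
      rw [this, Real.sqrt_mul (by positivity), Real.sqrt_sq hr.le]
    rw [Set.indicator_of_mem hmem, ← ENNReal.ofReal_mul
      (mul_nonneg (mul_nonneg (by positivity) (hitConst_nonneg hγ _ _)) (by positivity)),
      mul_assoc _ (r ^ n), ← mul_pow, ← hs, ← this,
      ← lintegral_indicator_one (measurableSet_hitSet _ _ _ _)]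
    refine lintegral_congr fun z => ?_
    exact Set.indicator_one_congr (by rw [hiff]; exact and_iff_right hp)
  · have hmem : y ∉ Set.Icc (-r) r ×ˢ (Set.univ : Set (Metric.sphere (0 : E) 1)) :=
      fun h => hp (abs_le.2 h.1)
    rw [Set.indicator_of_notMem hmem, mul_zero, lintegral_eq_zero_of_ae_eq_zero]
    refine ae_of_all _ fun z => Set.indicator_of_notMem (fun h => hp ?_) _
    exact ((hiff z).1 h).1

end Geometry

/-! ### Mean projection lengths -/

/-- The ratio `Γ((n+1)/2) / Γ(n/2)`, proportional to the mean norm of a standard Gaussian vector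
in dimension `n` (it vanishes for `n = 0`). -/
def gammaRatio (n : ℕ) : ℝ := Real.Gamma (((n : ℝ) + 1) / 2) / Real.Gamma ((n : ℝ) / 2)

/-- This rests on the default values `Γ(0) = 0` and `x / 0 = 0`. It is the right value, since a
projection onto the zero subspace has length zero. -/
lemma gammaRatio_zero : gammaRatio 0 = 0 := by simp [gammaRatio, Real.Gamma_zero]

lemma gammaRatio_pos {n : ℕ} (hn : 0 < n) : 0 < gammaRatio n := by
  have : (0 : ℝ) < n := by exact_mod_cast hn
  exact div_pos (Real.Gamma_pos_of_pos (by positivity)) (Real.Gamma_pos_of_pos (by positivity))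

lemma gammaRatio_nonneg (n : ℕ) : 0 ≤ gammaRatio n := by
  rcases Nat.eq_zero_or_pos n with rfl | hn
  · exact gammaRatio_zero.ge
  · exact (gammaRatio_pos hn).le

section Sphere

open scoped Pointwise

variable {E : Type*} [NormedAddCommGroup E] [InnerProductSpace ℝ E] [FiniteDimensional ℝ E]
  [MeasurableSpace E] [BorelSpace E]

lemma integral_norm_mul_exp_neg_sq :
    ∫ x : E, ‖x‖ * Real.exp (-‖x‖ ^ 2) =
      Real.pi ^ ((Module.finrank ℝ E : ℝ) / 2) * gammaRatio (Module.finrank ℝ E) := by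
  rcases subsingleton_or_nontrivial E with h | h
  · rw [Module.finrank_zero_of_subsingleton, gammaRatio_zero, mul_zero]
    have : ∀ x : E, ‖x‖ * Real.exp (-‖x‖ ^ 2) = 0 := fun x => by
      rw [Subsingleton.elim x 0, norm_zero, zero_mul]
    simp [this]
  · set n := Module.finrank ℝ E with hn
    have hn0 : 0 < n := Module.finrank_pos
    have hn' : (0 : ℝ) < n := by exact_mod_cast hn0
    rw [integral_fun_norm_addHaar volume (fun y : ℝ => y * Real.exp (-y ^ 2)), ← hn]
    have h1 : ∫ y in Set.Ioi (0 : ℝ), y ^ (n - 1) • (y * Real.exp (-y ^ 2)) =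
        1 / 2 * Real.Gamma ((n + 1) / 2) := by
      rw [← integral_rpow_mul_exp_neg_rpow (p := 2) (q := n) (by norm_num) (by linarith)]
      refine setIntegral_congr_fun measurableSet_Ioi fun y hy => ?_
      simp only [smul_eq_mul]
      rw [← mul_assoc, ← pow_succ, Nat.sub_add_cancel hn0, Real.rpow_natCast]
      norm_num [Real.rpow_ofNat]
    have h2 : volume.real (Metric.ball (0 : E) 1) =
        Real.pi ^ ((n : ℝ) / 2) / Real.Gamma ((n : ℝ) / 2 + 1) := by
      rw [measureReal_def, InnerProductSpace.volume_ball]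
      have : (0 : ℝ) < Real.Gamma ((n : ℝ) / 2 + 1) := Real.Gamma_pos_of_pos (by positivity)
      rw [ENNReal.ofReal_one, one_pow, one_mul, ENNReal.toReal_ofReal (by positivity),
        Real.sqrt_eq_rpow, ← Real.rpow_natCast, ← Real.rpow_mul Real.pi_pos.le, ← hn]
      ring_nf
    rw [h1, h2, gammaRatio, Real.Gamma_add_one (by positivity)]
    have h3 := Real.Gamma_pos_of_pos (show (0 : ℝ) < n / 2 by positivity)
    simp only [smul_eq_mul, nsmul_eq_mul]
    field_simp

lemma measurePreserving_orthogonal_prod (W : Submodule ℝ E) :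
    MeasurePreserving ((W.orthogonalDecomposition.toHomeomorph.toMeasurableEquiv).trans
      (MeasurableEquiv.toLp 2 (W × Wᗮ)).symm) :=
  W.orthogonalDecomposition.measurePreserving.trans (WithLp.volume_preserving_ofLp _ _)

/-- The Gaussian weight factorizes over `W` and its orthogonal complement, so the complement
contributes only a power of `π`. -/
lemma integral_norm_starProjection_mul_exp (W : Submodule ℝ E) :
    ∫ x : E, ‖W.starProjection x‖ * Real.exp (-‖x‖ ^ 2) =
      Real.pi ^ ((Module.finrank ℝ E : ℝ) / 2) * gammaRatio (Module.finrank ℝ W) := by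
  have h1 := (measurePreserving_orthogonal_prod W).integral_comp'
    (fun z : W × Wᗮ => (‖z.1‖ * Real.exp (-‖z.1‖ ^ 2)) * Real.exp (-1 * ‖z.2‖ ^ 2))
  rw [Measure.volume_eq_prod, integral_prod_mul (fun z : W => ‖z‖ * Real.exp (-‖z‖ ^ 2))
    (fun z : Wᗮ => Real.exp (-1 * ‖z‖ ^ 2)), integral_norm_mul_exp_neg_sq,
    GaussianFourier.integral_rexp_neg_mul_sq_norm one_pos, div_one] at h1
  have h2 : (Module.finrank ℝ E : ℝ) / 2 =
      (Module.finrank ℝ W : ℝ) / 2 + (Module.finrank ℝ Wᗮ : ℝ) / 2 := by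
    rw [← W.finrank_add_finrank_orthogonal]
    push_cast
    ring
  rw [h2, Real.rpow_add Real.pi_pos, mul_right_comm, ← h1]
  refine integral_congr_ae (ae_of_all _ fun x => ?_)
  have h3 : (W.orthogonalDecomposition.toHomeomorph.toMeasurableEquiv.trans
      (MeasurableEquiv.toLp 2 (W × Wᗮ)).symm) x =
      (W.orthogonalProjectionOnto x, Wᗮ.orthogonalProjectionOnto x) := by
    change WithLp.ofLp (W.orthogonalDecomposition x) = _
    rw [Submodule.orthogonalDecomposition_apply]
  simp only [h3]
  have h4 := W.norm_sq_eq_add_norm_sq_projection x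
  have h5 : ‖W.starProjection x‖ = ‖W.orthogonalProjectionOnto x‖ := rfl
  rw [h5, h4, mul_assoc, ← Real.exp_add]
  congr 2
  ring

/-- Polar coordinates split off a radial factor that does not depend on `L`. It cancels when a
projection is compared with the identity. -/
lemma integral_norm_map_mul_exp (L : E →L[ℝ] E) :
    ∫ x : E, ‖L x‖ * Real.exp (-‖x‖ ^ 2) =
      (∫ v, ‖L (v : E)‖ ∂(volume : Measure E).toSphere) *
        ∫ s : Set.Ioi (0 : ℝ), s.1 * Real.exp (-s.1 ^ 2)
          ∂(Measure.volumeIoiPow (Module.finrank ℝ E - 1)) := by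
  rcases subsingleton_or_nontrivial E with h | h
  · have h1 : ∀ x : E, ‖L x‖ = 0 := fun x => by rw [Subsingleton.elim (L x) 0, norm_zero]
    simp [h1]
  rw [← integral_prod_mul, ← (volume : Measure E).measurePreserving_homeomorphUnitSphereProd.integral_comp
    (Homeomorph.measurableEmbedding _)]
  have h1 : ∫ x : E, ‖L x‖ * Real.exp (-‖x‖ ^ 2) =
      ∫ x : ({(0)}ᶜ : Set E), ‖L x.1‖ * Real.exp (-‖x.1‖ ^ 2) ∂((volume : Measure E).comap Subtype.val) := by
    rw [integral_subtype_comap (measurableSet_singleton _).compl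
      fun x => ‖L x‖ * Real.exp (-‖x‖ ^ 2), restrict_compl_singleton]
  rw [h1]
  refine integral_congr_ae (ae_of_all _ fun x => ?_)
  have hx : 0 < ‖x.1‖ := norm_pos_iff.2 x.2
  simp only [homeomorphUnitSphereProd_apply_fst_coe, homeomorphUnitSphereProd_apply_snd_coe,
    map_smul, norm_smul, norm_inv, norm_norm]
  field_simp

/-- The mean length of the projection of a uniformly distributed unit vector onto a subspace. -/
lemma integral_norm_starProjection_toSphere [Nontrivial E] (W : Submodule ℝ E) :
    ∫ v, ‖W.starProjection (v : E)‖ ∂(volume : Measure E).toSphere =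
      (volume : Measure E).toSphere.real Set.univ *
        (gammaRatio (Module.finrank ℝ W) / gammaRatio (Module.finrank ℝ E)) := by
  have h1 := integral_norm_starProjection_mul_exp W
  have h2 := integral_norm_starProjection_mul_exp (⊤ : Submodule ℝ E)
  rw [integral_norm_map_mul_exp] at h1 h2
  have h3 : ∀ v : Metric.sphere (0 : E) 1, ‖(⊤ : Submodule ℝ E).starProjection (v : E)‖ = 1 := by
    intro v
    rw [Submodule.starProjection_top]
    simp
  simp only [h3, integral_const, smul_eq_mul, mul_one, finrank_top] at h2
  have h4 : 0 < gammaRatio (Module.finrank ℝ E) := gammaRatio_pos Module.finrank_pos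
  have h5 := Real.rpow_pos_of_pos Real.pi_pos ((Module.finrank ℝ E : ℝ) / 2)
  -- The common radial factor. It is nonzero because the identity map yields a positive Gaussian
  -- integral.
  generalize (∫ s : Set.Ioi (0 : ℝ), s.1 * Real.exp (-s.1 ^ 2)
          ∂(Measure.volumeIoiPow (Module.finrank ℝ E - 1))) = c at h1 h2
  have h6 : c ≠ 0 := by
    rintro rfl
    rw [mul_zero] at h2
    exact (mul_pos h5 h4).ne h2
  rw [← mul_div_assoc, eq_div_iff h4.ne']
  refine mul_right_cancel₀ h6 ?_
  linear_combination gammaRatio (Module.finrank ℝ E) * h1 -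
    gammaRatio (Module.finrank ℝ W) * h2

/-- The surface measure of a set is, up to a constant, the volume of the cone over it, and Lebesgue
measure is symmetric. -/
lemma measurePreserving_neg_toSphere :
    MeasurePreserving (fun v : Metric.sphere (0 : E) 1 => -v) (volume : Measure E).toSphere
      (volume : Measure E).toSphere := by
  have hm : Measurable fun v : Metric.sphere (0 : E) 1 => -v := continuous_neg.measurable
  refine ⟨hm, Measure.ext fun s hs => ?_⟩
  rw [Measure.map_apply hm hs, Measure.toSphere_apply' _ (hm hs), Measure.toSphere_apply' _ hs]
  congr 1
  rw [← Measure.measure_neg volume (Set.Ioo (0 : ℝ) 1 • _)]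
  congr 1
  ext x
  simp only [Set.mem_neg, Set.mem_smul, Set.mem_image, Set.mem_preimage]
  constructor
  · rintro ⟨t, ht, _, ⟨v, hv, rfl⟩, h⟩
    exact ⟨t, ht, _, ⟨-v, hv, rfl⟩, by simp [h]⟩
  · rintro ⟨t, ht, _, ⟨v, hv, rfl⟩, h⟩
    exact ⟨t, ht, _, ⟨-v, by simpa using hv, rfl⟩, by simp [h]⟩

end Sphere

section Hemisphere

variable {d : ℕ}

lemma upperHemisphere_eq (hd : 0 < d) :
    upperHemisphere d = {v : UnitSphere d | 0 ≤ (v : EuclideanSpace ℝ (Fin d)) ⟨d - 1, by omega⟩} := by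
  ext v
  refine ⟨fun h => h _ (by simp; omega), fun h i hi => ?_⟩
  have : i = ⟨d - 1, by omega⟩ := Fin.ext (by simp; omega)
  rw [this]
  exact h

lemma measurable_sphere_apply (i : Fin d) :
    Measurable fun v : UnitSphere d => (v : EuclideanSpace ℝ (Fin d)) i := by
  have : Continuous fun v : UnitSphere d => (v : EuclideanSpace ℝ (Fin d)) i := by fun_prop
  exact this.measurable

lemma measurableSet_upperHemisphere (hd : 0 < d) : MeasurableSet (upperHemisphere d) := by
  rw [upperHemisphere_eq hd]
  exact measurableSet_le measurable_const (measurable_sphere_apply _)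

/-- The cone over the equator lies in a proper linear subspace. -/
lemma toSphere_equator_eq_zero (i : Fin d) :
    (volume : Measure (EuclideanSpace ℝ (Fin d))).toSphere
      {v | (v : EuclideanSpace ℝ (Fin d)) i = 0} = 0 := by
  rw [Measure.toSphere_apply' _ (measurableSet_eq_fun (measurable_sphere_apply i)
    measurable_const), mul_eq_zero]
  right
  let L : EuclideanSpace ℝ (Fin d) →ₗ[ℝ] ℝ := (EuclideanSpace.proj i).toLinearMap
  have hL : ∀ x, L x = x i := fun x => rfl
  refine measure_mono_null ?_ (Measure.addHaar_submodule volume (LinearMap.ker L) ?_)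
  · rintro _ ⟨t, ht, _, ⟨v, hv, rfl⟩, rfl⟩
    rw [SetLike.mem_coe, LinearMap.mem_ker]
    change L (t • (v : EuclideanSpace ℝ (Fin d))) = 0
    rw [map_smul, hL, hv, smul_zero]
  · intro h
    have : EuclideanSpace.single i (1 : ℝ) ∈ LinearMap.ker L := h ▸ Submodule.mem_top
    rw [LinearMap.mem_ker, hL] at this
    simp at this

/-- Up to the null equator, the antipodal map exchanges the hemisphere with its complement.
Projection lengths are even, so the hemisphere may be replaced by the sphere. -/
lemma setLIntegral_upperHemisphere (hd : 0 < d) {ψ : UnitSphere d → ℝ≥0∞}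
    (heven : ∀ v, ψ (-v) = ψ v) :
    2 * ∫⁻ v in upperHemisphere d, ψ v ∂(volume : Measure (EuclideanSpace ℝ (Fin d))).toSphere =
      ∫⁻ v, ψ v ∂(volume : Measure (EuclideanSpace ℝ (Fin d))).toSphere := by
  have hm := measurableSet_upperHemisphere hd
  rw [← lintegral_add_compl ψ hm (μ := (volume :
    Measure (EuclideanSpace ℝ (Fin d))).toSphere), two_mul]
  congr 1
  have h1 : ((upperHemisphere d)ᶜ : Set (UnitSphere d)) =ᵐ[(volume :
      Measure (EuclideanSpace ℝ (Fin d))).toSphere] (fun v => -v) ⁻¹' upperHemisphere d := by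
    have h0 := toSphere_equator_eq_zero (⟨d - 1, by omega⟩ : Fin d)
    rw [← compl_compl {v : UnitSphere d | (v : EuclideanSpace ℝ (Fin d)) ⟨d - 1, by omega⟩ = 0},
      ← mem_ae_iff] at h0
    filter_upwards [h0] with v hv
    refine propext ?_
    change ¬ (v ∈ upperHemisphere d) ↔ -v ∈ upperHemisphere d
    rw [upperHemisphere_eq hd]
    change ¬ (0 ≤ (v : EuclideanSpace ℝ (Fin d)) ⟨d - 1, by omega⟩) ↔
      0 ≤ -(v : EuclideanSpace ℝ (Fin d)) ⟨d - 1, by omega⟩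
    rw [not_le, Left.nonneg_neg_iff]
    exact ⟨le_of_lt, fun h => lt_of_le_of_ne h hv⟩
  rw [setLIntegral_congr h1, ← measurePreserving_neg_toSphere.setLIntegral_comp_preimage_emb
    (MeasurableEquiv.neg (UnitSphere d)).measurableEmbedding]
  simp_rw [heven]

lemma lintegral_uniformHemisphere (hd : 0 < d) {ψ : UnitSphere d → ℝ≥0∞}
    (heven : ∀ v, ψ (-v) = ψ v) :
    ∫⁻ v, ψ v ∂(uniformHemisphere d) =
      ((volume : Measure (EuclideanSpace ℝ (Fin d))).toSphere Set.univ)⁻¹ *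
        ∫⁻ v, ψ v ∂(volume : Measure (EuclideanSpace ℝ (Fin d))).toSphere := by
  have h1 := setLIntegral_upperHemisphere hd (ψ := fun _ => 1) fun _ => rfl
  simp only [lintegral_one, Measure.restrict_apply_univ] at h1
  rw [uniformHemisphere, ProbabilityTheory.cond, lintegral_smul_measure, ← h1,
    ← setLIntegral_upperHemisphere hd heven, ENNReal.mul_inv (by simp) (by simp), smul_eq_mul,
    mul_mul_mul_comm, ENNReal.inv_mul_cancel (by simp) (by simp), one_mul]

lemma toSphere_univ_ne_zero (hd : 0 < d) :
    (volume : Measure (EuclideanSpace ℝ (Fin d))).toSphere Set.univ ≠ 0 := by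
  have : NeZero d := ⟨hd.ne'⟩
  rw [Ne, Measure.measure_univ_eq_zero]
  exact Measure.toSphere_ne_zero _

lemma isProbabilityMeasure_uniformHemisphere (hd : 0 < d) :
    IsProbabilityMeasure (uniformHemisphere d) := by
  have : NeZero d := ⟨hd.ne'⟩
  have h := lintegral_uniformHemisphere hd (ψ := fun _ => 1) fun _ => rfl
  refine ⟨?_⟩
  simp only [lintegral_one] at h
  rw [h]
  exact ENNReal.inv_mul_cancel (toSphere_univ_ne_zero hd) (measure_ne_top _ _)

/-- The mean length of the projection of a uniformly distributed direction onto a subspace. -/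
theorem lintegral_norm_starProjection_uniformHemisphere (hd : 0 < d)
    (W : Submodule ℝ (EuclideanSpace ℝ (Fin d))) :
    ∫⁻ v, ENNReal.ofReal ‖W.starProjection (v : EuclideanSpace ℝ (Fin d))‖
        ∂(uniformHemisphere d) =
      ENNReal.ofReal (gammaRatio (Module.finrank ℝ W) / gammaRatio d) := by
  have : NeZero d := ⟨hd.ne'⟩
  have hc : Continuous fun v : UnitSphere d =>
      ‖W.starProjection (v : EuclideanSpace ℝ (Fin d))‖ := by fun_prop
  have hi : Integrable (fun v : UnitSphere d =>
      ‖W.starProjection (v : EuclideanSpace ℝ (Fin d))‖)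
      (volume : Measure (EuclideanSpace ℝ (Fin d))).toSphere :=
    hc.integrable_of_hasCompactSupport (HasCompactSupport.of_compactSpace _)
  rw [lintegral_uniformHemisphere hd, ← ofReal_integral_eq_lintegral_ofReal hi
    (ae_of_all _ fun v => norm_nonneg _), integral_norm_starProjection_toSphere,
    finrank_euclideanSpace_fin, ENNReal.ofReal_mul measureReal_nonneg, ← mul_assoc,
    ofReal_measureReal, ENNReal.inv_mul_cancel (toSphere_univ_ne_zero hd)
      (measure_ne_top _ _), one_mul]
  intro v
  simp

end Hemisphere

/-! ### Evaluation of the constants -/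

/-- The substitution `s = -cos x`, which gives access to the Wallis recursion. -/
lemma capIntegral_eq_integral_sin_pow (m : ℕ) :
    capIntegral m = ∫ x in (0 : ℝ)..Real.pi, Real.sin x ^ (m + 1) := by
  have h := intervalIntegral.integral_comp_mul_deriv (a := 0) (b := Real.pi)
    (f := fun x => -Real.cos x) (f' := Real.sin) (g := fun s => √(1 - s ^ 2) ^ m)
    (fun x _ => neg_neg (Real.sin x) ▸ (Real.hasDerivAt_cos x).neg) Real.continuous_sin.continuousOn
    (by fun_prop)
  simp only [Real.cos_zero, Real.cos_pi, neg_neg] at h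
  rw [capIntegral, ← h]
  refine intervalIntegral.integral_congr fun x hx => ?_
  rw [Set.uIcc_of_le Real.pi_pos.le] at hx
  have hs : √(1 - (-Real.cos x) ^ 2) = Real.sin x := by
    rw [neg_sq, ← Real.sin_sq, Real.sqrt_sq (Real.sin_nonneg_of_mem_Icc hx)]
  simp only [Function.comp, hs]
  rw [pow_succ]

lemma capIntegral_zero : capIntegral 0 = 2 := by
  norm_num [capIntegral]

lemma capIntegral_one : capIntegral 1 = Real.pi / 2 := by
  rw [capIntegral_eq_integral_sin_pow, integral_sin_sq]
  simp

lemma capIntegral_add_two (m : ℕ) :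
    capIntegral (m + 2) = (m + 2) / (m + 3) * capIntegral m := by
  rw [capIntegral_eq_integral_sin_pow, capIntegral_eq_integral_sin_pow,
    show m + 2 + 1 = (m + 1) + 2 from rfl, integral_sin_pow]
  simp only [Real.sin_zero, Real.sin_pi, ne_eq, Nat.add_eq_zero_iff, one_ne_zero, and_false,
    not_false_eq_true, zero_pow, zero_mul, sub_zero, zero_div, zero_add, Nat.cast_add,
    Nat.cast_one]
  ring_nf

lemma capIntegral_two_mul (n : ℕ) :
    capIntegral (2 * n) = 2 ^ (2 * n + 1) * (n ! : ℝ) ^ 2 / ((2 * n + 1)! : ℝ) := by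
  induction n with
  | zero => simp [capIntegral_zero]
  | succ n ih =>
    rw [show 2 * (n + 1) = 2 * n + 2 by ring, capIntegral_add_two, ih,
      Nat.factorial_succ (2 * n + 2), Nat.factorial_succ (2 * n + 1), Nat.factorial_succ n]
    push_cast
    have := Nat.factorial_pos (2 * n + 1)
    field_simp
    ring

lemma kappa_pos (n : ℕ) : 0 < kappa n :=
  div_pos (Real.rpow_pos_of_pos Real.pi_pos _) (Real.Gamma_pos_of_pos (by positivity))

lemma kappa_zero : kappa 0 = 1 := by simp [kappa]

lemma kappa_one : kappa 1 = 2 := by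
  rw [kappa, Real.Gamma_add_one (by norm_num)]
  push_cast
  rw [Real.Gamma_one_half_eq, ← Real.sqrt_eq_rpow]
  have := Real.sqrt_pos.2 Real.pi_pos
  field_simp

lemma kappa_add_two (n : ℕ) : kappa (n + 2) = 2 * Real.pi / (n + 2) * kappa n := by
  have h : ((n + 2 : ℕ) : ℝ) / 2 = (n : ℝ) / 2 + 1 := by push_cast; ring
  have h' := Real.Gamma_pos_of_pos (show (0 : ℝ) < (n : ℝ) / 2 + 1 by positivity)
  rw [kappa, kappa, h, Real.Gamma_add_one (s := (n : ℝ) / 2 + 1) (by positivity),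
    Real.rpow_add Real.pi_pos, Real.rpow_one]
  field_simp

/-- Geometrically this is slicing the ball by parallel hyperplanes. Here it is deduced from the
two-step recursions of both sides. -/
lemma kappa_succ_eq (m : ℕ) : kappa (m + 1) = capIntegral m * kappa m := by
  induction m using Nat.twoStepInduction with
  | zero => rw [kappa_one, kappa_zero, capIntegral_zero]; ring
  | one =>
    rw [kappa_add_two, kappa_zero, capIntegral_one, kappa_one]
    push_cast; ring
  | more m ih _ =>
    rw [show m + 2 + 1 = (m + 1) + 2 from rfl, kappa_add_two, ih, capIntegral_add_two,
      kappa_add_two]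
    push_cast
    field_simp
    ring

lemma capIntegral_pos (m : ℕ) : 0 < capIntegral m := by
  have h := kappa_pos (m + 1)
  rw [kappa_succ_eq] at h
  exact pos_of_mul_pos_left h (kappa_pos m).le

lemma volume_real_closedBall {m : ℕ} (hm : 0 < m) {r : ℝ} (hr : 0 ≤ r) :
    volume.real (Metric.closedBall (0 : EuclideanSpace ℝ (Fin m)) r) = kappa m * r ^ m := by
  have : Nonempty (Fin m) := ⟨⟨0, hm⟩⟩
  have h := kappa_pos m
  rw [measureReal_def, EuclideanSpace.volume_closedBall, ENNReal.toReal_mul, ENNReal.toReal_pow,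
    ENNReal.toReal_ofReal hr, Fintype.card_fin, mul_comm, kappa, Real.sqrt_eq_rpow,
    ← Real.rpow_natCast (Real.pi ^ _), ← Real.rpow_mul Real.pi_pos.le, ENNReal.toReal_ofReal]
  · ring_nf
  · rw [one_div_mul_eq_div]
    exact h.le

/-- The quantity `b_{n+1}` in terms of cap integrals. -/
lemma bConst_succ (n : ℕ) :
    bConst (n + 1) = √(capIntegral (2 * n)) / (2 * capIntegral n) := by
  have h1 := kappa_pos n
  have h2 := capIntegral_pos n
  have h3 : √(capIntegral (2 * n)) = 2 ^ (n + 1) * (n ! : ℝ) / √(2 * ((2 * n + 1)! : ℝ)) := by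
    rw [capIntegral_two_mul, eq_div_iff (by positivity), ← Real.sqrt_mul (by positivity),
      ← Real.sqrt_sq (show (0 : ℝ) ≤ 2 ^ (n + 1) * (n ! : ℝ) by positivity)]
    congr 1
    have := Nat.factorial_pos (2 * n + 1)
    field_simp
    ring
  rw [bConst, h3, kappa_succ_eq, show 2 * (n + 1) - 1 = 2 * n + 1 by omega, Nat.add_sub_cancel]
  field_simp
  ring

lemma bConst_pos {m : ℕ} (hm : 0 < m) : 0 < bConst m := by
  obtain ⟨n, rfl⟩ := Nat.exists_eq_succ_of_ne_zero hm.ne'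
  rw [Nat.succ_eq_add_one, bConst_succ]
  exact div_pos (Real.sqrt_pos.2 (capIntegral_pos _)) (mul_pos two_pos (capIntegral_pos _))

lemma aConst_pos {d k : ℕ} (hk : k < d) : 0 < aConst d k := by
  have h1 : (0 : ℝ) < d := by exact_mod_cast (Nat.zero_le k).trans_lt hk
  have h2 : (0 : ℝ) < d.choose k := by exact_mod_cast Nat.choose_pos hk.le
  have := kappa_pos d
  have := kappa_pos k
  have := kappa_pos (d - 1)
  rw [aConst]
  positivity

/-- Legendre's duplication formula at `(n + 1)/2`. -/
lemma Gamma_half_mul_Gamma (n : ℕ) :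
    Real.Gamma (((n : ℝ) + 1) / 2) * Real.Gamma ((n : ℝ) / 2 + 1) =
      (n ! : ℝ) / 2 ^ n * √Real.pi := by
  have h := Real.Gamma_mul_Gamma_add_half (((n : ℝ) + 1) / 2)
  have h1 : ((n : ℝ) + 1) / 2 + 1 / 2 = (n : ℝ) / 2 + 1 := by ring
  have h2 : 2 * (((n : ℝ) + 1) / 2) = n + 1 := by ring
  rw [h1, h2, Real.Gamma_nat_eq_factorial] at h
  rw [h, show (1 : ℝ) - (n + 1) = -n by ring, Real.rpow_neg two_pos.le, Real.rpow_natCast]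
  ring

/-- The cap integrals multiply to `kappa m`, and the Gamma quotients of consecutive dimensions
telescope. -/
lemma hitConst_eq {c : ℝ} (m n : ℕ) (h : m ≤ n) :
    hitConst (fun j => gammaRatio j / c) n m =
      kappa m / c ^ m *
        (Real.Gamma (((n : ℝ) + 1) / 2) / Real.Gamma ((((n - m : ℕ) : ℝ) + 1) / 2)) := by
  induction m generalizing n with
  | zero =>
    have := Real.Gamma_pos_of_pos (show (0 : ℝ) < ((n : ℝ) + 1) / 2 by positivity)
    simp [hitConst, kappa_zero, this.ne']
  | succ m ih =>
    obtain ⟨n, rfl⟩ := Nat.exists_eq_succ_of_ne_zero (show n ≠ 0 by omega)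
    rw [hitConst, Nat.succ_eq_add_one, Nat.add_sub_cancel, ih n (by omega), gammaRatio,
      kappa_succ_eq, Nat.add_sub_add_right]
    have := Real.Gamma_pos_of_pos (show (0 : ℝ) < ((n : ℝ) + 1) / 2 by positivity)
    push_cast
    field_simp
    ring

/-- The constant `a_{d,k}` is the normalized mean measure of the configurations of hyperplanes
whose intersection meets the unit ball. -/
lemma hitConst_div_factorial {d k : ℕ} (hk : k < d) :
    hitConst (fun j => gammaRatio j / gammaRatio d) d (d - k) / ((d - k)! : ℝ) =
      aConst d k * kappa (d - k) := by
  have hd : (0 : ℝ) < d := by exact_mod_cast (Nat.zero_le k).trans_lt hk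
  have hg := gammaRatio_pos ((Nat.zero_le k).trans_lt hk)
  have hratio : kappa (d - 1) / ((d : ℝ) * kappa d) = (2 * √Real.pi * gammaRatio d)⁻¹ := by
    have h1 := Real.Gamma_pos_of_pos (show (0 : ℝ) < (d : ℝ) / 2 by positivity)
    have h2 := Real.Gamma_pos_of_pos (show (0 : ℝ) < ((d : ℝ) + 1) / 2 by positivity)
    have h3 := Real.rpow_pos_of_pos Real.pi_pos ((d : ℝ) / 2)
    have h4 := Real.sqrt_pos.2 Real.pi_pos
    rw [kappa, kappa, gammaRatio, Real.Gamma_add_one (s := (d : ℝ) / 2) (by positivity),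
      show ((d - 1 : ℕ) : ℝ) / 2 + 1 = ((d : ℝ) + 1) / 2 by
        rw [Nat.cast_sub (by omega)]; push_cast; ring,
      show ((d - 1 : ℕ) : ℝ) / 2 = (d : ℝ) / 2 - 1 / 2 by
        rw [Nat.cast_sub (by omega)]; push_cast; ring,
      Real.rpow_sub Real.pi_pos, ← Real.sqrt_eq_rpow]
    field_simp
  rw [hitConst_eq _ _ (Nat.sub_le d k), Nat.sub_sub_self hk.le, aConst, hratio]
  -- Duplication trades `Γ((d+1)/2)` and `Γ((k+1)/2)` for factorials and the Gamma values in `kappa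
  -- d` and `kappa k`; the factorials form the binomial coefficient.
  have hGd := Gamma_half_mul_Gamma d
  have hGk := Gamma_half_mul_Gamma k
  have hchoose := Nat.choose_mul_factorial_mul_factorial hk.le
  have hchoose' : (d.choose k : ℝ) = (d ! : ℝ) / ((k ! : ℝ) * ((d - k)! : ℝ)) := by
    rw [eq_div_iff (by positivity), ← hchoose]
    push_cast
    ring
  obtain ⟨m, rfl⟩ := Nat.exists_eq_add_of_lt hk
  rw [show k + m + 1 = k + (m + 1) by ring] at *
  generalize m + 1 = j at *
  rw [Nat.add_sub_cancel_left] at *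
  have hp := Real.sqrt_pos.2 Real.pi_pos
  have hpi : Real.pi ^ (((k + j : ℕ) : ℝ) / 2) = Real.pi ^ ((k : ℝ) / 2) * √Real.pi ^ j := by
    rw [Real.sqrt_eq_rpow, ← Real.rpow_natCast (Real.pi ^ (1 / 2 : ℝ)),
      ← Real.rpow_mul Real.pi_pos.le, ← Real.rpow_add Real.pi_pos]
    push_cast
    ring_nf
  have g1 := Real.Gamma_pos_of_pos (show (0 : ℝ) < ((k : ℝ) + 1) / 2 by positivity)
  have g2 := Real.Gamma_pos_of_pos (show (0 : ℝ) < (k : ℝ) / 2 + 1 by positivity)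
  have g3 := Real.Gamma_pos_of_pos (show (0 : ℝ) < ((k + j : ℕ) : ℝ) / 2 + 1 by positivity)
  have g4 := Real.rpow_pos_of_pos Real.pi_pos ((k : ℝ) / 2)
  rw [← eq_div_iff g3.ne'] at hGd
  rw [← eq_div_iff g2.ne'] at hGk
  generalize gammaRatio (k + j) = G at *
  generalize kappa j = K at *
  rw [hGd, hGk, hchoose', kappa, kappa, hpi, inv_pow, mul_pow, mul_pow, pow_add]
  field_simp

/-! ### Counting flats by tuples of hyperplanes -/

lemma mem_hitSet_top_iff {E : Type*} [NormedAddCommGroup E] [InnerProductSpace ℝ E] {r : ℝ} {m : ℕ}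
    {x : Fin m → ℝ × Metric.sphere (0 : E) 1} :
    x ∈ hitSet (⊤ : Submodule ℝ E) 0 r m ↔
      ∃ y : E, ‖y‖ ≤ r ∧ ∀ i, inner ℝ y ((x i).2 : E) = (x i).1 := by
  simp [hitSet]

section FlatSet

variable {E : Type*} [NormedAddCommGroup E] [InnerProductSpace ℝ E] [FiniteDimensional ℝ E]

/-- The configurations of `m` hyperplanes in general position whose intersection meets the ball
of radius `r`. -/
def flatSet (E : Type*) [NormedAddCommGroup E] [InnerProductSpace ℝ E] (r : ℝ) (m : ℕ) :
    Set (Fin m → ℝ × Metric.sphere (0 : E) 1) :=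
  {x | LinearIndependent ℝ fun i => ((x i).2 : E)} ∩ hitSet ⊤ 0 r m

variable [MeasurableSpace E] [BorelSpace E]

lemma measurableSet_flatSet (r : ℝ) (m : ℕ) : MeasurableSet (flatSet E r m) := by
  refine MeasurableSet.inter ?_ (measurableSet_hitSet _ _ _ _)
  have hc : Continuous fun (x : Fin m → ℝ × Metric.sphere (0 : E) 1) (i : Fin m) =>
      ((x i).2 : E) := by fun_prop
  exact (isOpen_setOfPred_linearIndependent.preimage hc).measurableSet

/-- Almost all hyperplanes with a common point are in general position. -/
lemma measure_hitSet_diff_flatSet {Θ : Measure (Metric.sphere (0 : E) 1)}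
    [IsProbabilityMeasure Θ] {lam : ℝ} (hlam : 0 < lam) (r : ℝ) (m : ℕ) :
    Measure.pi (fun _ : Fin m => markedLebesgue lam Θ)
      (hitSet (⊤ : Submodule ℝ E) 0 r m \ flatSet E r m) = 0 := by
  have hm : MeasurableSet (hitSet (⊤ : Submodule ℝ E) 0 r m \ flatSet E r m) :=
    (measurableSet_hitSet _ _ _ _).diff (measurableSet_flatSet r m)
  have : (ENNReal.ofReal lam • (volume : Measure ℝ)).IsAddHaarMeasure :=
    Measure.IsAddHaarMeasure.smul _ (by simpa using hlam) ENNReal.ofReal_ne_top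
  have hmp := (measurePreserving_arrowProdEquivProdArrow ℝ (Metric.sphere (0 : E) 1) (Fin m)
    (fun _ => ENNReal.ofReal lam • (volume : Measure ℝ)) (fun _ => Θ)).symm
  rw [← hmp.measure_preimage hm.nullMeasurableSet,
    Measure.prod_apply_symm (hmp.measurable hm), lintegral_eq_zero_of_ae_eq_zero]
  refine ae_of_all _ fun v => ?_
  by_cases hv : LinearIndependent ℝ fun i => ((v i) : E)
  · convert! measure_empty (μ := Measure.pi fun _ : Fin m =>
      ENNReal.ofReal lam • (volume : Measure ℝ))
    rw [Set.eq_empty_iff_forall_notMem]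
    rintro p ⟨h1, h2⟩
    exact h2 ⟨hv, h1⟩
  -- For fixed dependent normals, a common point forces the same linear relation on the offsets, so
  -- these lie in a proper subspace.
  · obtain ⟨g, hg, i, hi⟩ := Fintype.not_linearIndependent_iff.1 hv
    let L : (Fin m → ℝ) →ₗ[ℝ] ℝ := ∑ j, g j • LinearMap.proj j
    have hL : ∀ p, L p = ∑ j, g j * p j := fun p => by simp [L]
    refine measure_mono_null ?_ (Measure.addHaar_submodule _ (LinearMap.ker L) ?_)
    · rintro p ⟨h1, -⟩
      obtain ⟨y, -, hy⟩ := mem_hitSet_top_iff.1 h1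
      rw [SetLike.mem_coe, LinearMap.mem_ker, hL]
      have : ∀ j, inner ℝ y (v j : E) = p j := hy
      simp_rw [← this, ← inner_smul_right, ← inner_sum, hg, inner_zero_right]
    · intro h
      have : Pi.single i (1 : ℝ) ∈ LinearMap.ker L := h ▸ Submodule.mem_top
      rw [LinearMap.mem_ker, hL] at this
      simp [Pi.single_apply, hi] at this

end FlatSet

section Count

variable {d : ℕ}

lemma finrank_orthogonal_span_eq_iff {k m : ℕ} (hd : d = k + m)
    (v : Fin m → EuclideanSpace ℝ (Fin d)) :
    Module.finrank ℝ (Submodule.span ℝ (Set.range v))ᗮ = k ↔ LinearIndependent ℝ v := by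
  have h := (Submodule.span ℝ (Set.range v)).finrank_add_finrank_orthogonal
  rw [finrank_euclideanSpace_fin] at h
  rw [linearIndependent_iff_card_eq_finrank_span, Fintype.card_fin, Set.finrank]
  omega

/-- The intersection of `m` hyperplanes is a flat of codimension `m` meeting a ball if and only if
the hyperplanes are in general position. -/
lemma isFlat_and_nonempty_iff {k m : ℕ} (hd : d = k + m) (x : Fin m → ℝ × UnitSphere d) (r : ℝ) :
    (IsFlat k (⋂ i, hyperplane (x i)) ∧
      ((⋂ i, hyperplane (x i)) ∩ Metric.closedBall 0 r).Nonempty) ↔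
      x ∈ flatSet (EuclideanSpace ℝ (Fin d)) r m := by
  have hball : ((⋂ i, hyperplane (x i)) ∩ Metric.closedBall 0 r).Nonempty ↔
      x ∈ hitSet (⊤ : Submodule ℝ (EuclideanSpace ℝ (Fin d))) 0 r m := by
    rw [mem_hitSet_top_iff]
    constructor
    · rintro ⟨y, hy, hyr⟩
      exact ⟨y, by simpa using hyr, fun i => Set.mem_iInter.1 hy i⟩
    · rintro ⟨y, hyr, hy⟩
      exact ⟨y, Set.mem_iInter.2 hy, by simpa using hyr⟩
  rw [hball, flatSet, Set.mem_inter_iff, and_congr_left_iff]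
  intro hx
  obtain ⟨y, -, hy⟩ := mem_hitSet_top_iff.1 hx
  set v : Fin m → EuclideanSpace ℝ (Fin d) := fun i => ((x i).2 : EuclideanSpace ℝ (Fin d))
  -- Once a common point `y` exists, the intersection is `y + span(v)^⊥`, so its dimension decides
  -- about independence.
  have hset : (⋂ i, hyperplane (x i)) =
      (AffineSubspace.mk' y (Submodule.span ℝ (Set.range v))ᗮ : Set _) := by
    ext u
    rw [SetLike.mem_coe, AffineSubspace.mem_mk', vsub_eq_sub, Submodule.mem_orthogonal']
    constructor
    · intro hu w hw
      refine Submodule.span_induction ?_ (by simp) (fun a b _ _ ha hb => by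
        rw [inner_add_right, ha, hb, add_zero]) (fun c a _ ha => by
        rw [inner_smul_right, ha, mul_zero]) hw
      rintro _ ⟨i, rfl⟩
      have : inner ℝ u (v i) = (x i).1 := Set.mem_iInter.1 hu i
      rw [inner_sub_left, this, ← hy i, sub_self]
    · intro hu
      refine Set.mem_iInter.2 fun i => ?_
      have := hu (v i) (Submodule.subset_span ⟨i, rfl⟩)
      rw [inner_sub_left, hy i, sub_eq_zero] at this
      exact this
  change IsFlat k _ ↔ LinearIndependent ℝ v
  rw [hset, ← finrank_orthogonal_span_eq_iff hd]
  constructor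
  · rintro ⟨A, hA, -, hk⟩
    rw [SetLike.coe_injective hA, AffineSubspace.direction_mk'] at hk
    exact hk
  · intro hk
    exact ⟨_, rfl, ⟨y, AffineSubspace.self_mem_mk' _ _⟩, by rwa [AffineSubspace.direction_mk']⟩

lemma encard_injective_image_eq {m : ℕ} {s : Finset ℕ} (hs : s.card = m) :
    {I : Fin m → ℕ | Function.Injective I ∧ Finset.univ.image I = s}.encard = (m ! : ℕ) := by
  let f : (Fin m ↪ s) → Fin m → ℕ := fun g i => g i
  have hf : Function.Injective f := fun g g' h => by
    ext i
    exact congrFun h i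
  have hrange : {I : Fin m → ℕ | Function.Injective I ∧ Finset.univ.image I = s} =
      f '' Set.univ := by
    ext I
    constructor
    · rintro ⟨hI, h⟩
      have hmem : ∀ i, I i ∈ s := fun i => h ▸ Finset.mem_image_of_mem I (Finset.mem_univ i)
      exact ⟨⟨fun i => ⟨I i, hmem i⟩, fun i j hij => hI (congrArg Subtype.val hij)⟩, trivial, rfl⟩
    · rintro ⟨g, -, rfl⟩
      have hinj : Function.Injective (f g) := fun i j hij => g.injective (Subtype.ext hij)
      refine ⟨hinj, Finset.eq_of_subset_of_card_le ?_ ?_⟩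
      · intro n hn
        obtain ⟨i, -, rfl⟩ := Finset.mem_image.1 hn
        exact (g i).2
      · rw [Finset.card_image_of_injective _ hinj, hs, Finset.card_univ, Fintype.card_fin]
  rw [hrange, hf.encard_image, Set.encard_univ, ENat.card_eq_coe_fintype_card,
    Fintype.card_embedding_eq, Fintype.card_coe, hs, Fintype.card_fin, Nat.descFactorial_self]

/-- Grouping injective tuples by their image, each set of size `m` is the image of `m!` of them. -/
lemma tsum_injective_image (m : ℕ) (Q : Finset ℕ → Prop) :
    ∑' I : Fin m → ℕ, {I : Fin m → ℕ | Function.Injective I ∧ Q (Finset.univ.image I)}.indicator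
      (1 : (Fin m → ℕ) → ℝ≥0∞) I = m ! * (({s : Finset ℕ | s.card = m ∧ Q s}.encard : ℕ∞) : ℝ≥0∞) := by
  classical
  rw [← ENNReal.tsum_set_one, tsum_subtype {s : Finset ℕ | s.card = m ∧ Q s} fun _ => (1 : ℝ≥0∞),
    ← ENNReal.tsum_mul_left]
  have h1 : ∀ I : Fin m → ℕ,
      {I : Fin m → ℕ | Function.Injective I ∧ Q (Finset.univ.image I)}.indicator
        (1 : (Fin m → ℕ) → ℝ≥0∞) I = ∑' s : Finset ℕ,
          if Function.Injective I ∧ Finset.univ.image I = s ∧ Q s then (1 : ℝ≥0∞) else 0 := by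
    intro I
    rw [tsum_eq_single (Finset.univ.image I)]
    · simp [Set.indicator]
    · intro s hs
      rw [if_neg]
      exact fun h => hs h.2.1.symm
  simp_rw [h1]
  rw [ENNReal.tsum_comm]
  refine tsum_congr fun s => ?_
  by_cases hs : s.card = m ∧ Q s
  · rw [Set.indicator_of_mem (by exact hs), mul_one]
    have h2 : ∀ I : Fin m → ℕ, (if Function.Injective I ∧ Finset.univ.image I = s ∧ Q s then
        (1 : ℝ≥0∞) else 0) = {I : Fin m → ℕ | Function.Injective I ∧
          Finset.univ.image I = s}.indicator (fun _ => 1) I := by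
      intro I
      simp [Set.indicator, hs.2]
    simp_rw [h2]
    rw [← tsum_subtype, ENNReal.tsum_set_one, encard_injective_image_eq hs.1]
    simp
  · rw [Set.indicator_of_notMem (by exact hs), mul_zero, ENNReal.tsum_eq_zero]
    intro I
    rw [if_neg]
    rintro ⟨hI, rfl, hQ⟩
    exact hs ⟨by rw [Finset.card_image_of_injective _ hI, Finset.card_univ, Fintype.card_fin], hQ⟩

lemma factorial_mul_flatCount {Ω : Type*} (X : ℕ → Ω → ℝ × UnitSphere d) {k : ℕ} (hk : k ≤ d)
    (r : ℝ) (ω : Ω) :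
    ((d - k)! : ℝ≥0∞) * (flatCount X k r ω : ℝ≥0∞) = tupleSum X (Fin (d - k))
      ((flatSet (EuclideanSpace ℝ (Fin d)) r (d - k)).indicator 1) ω := by
  rw [flatCount, ← tsum_injective_image, tupleSum]
  refine tsum_congr fun I => ?_
  have h : (⋂ i ∈ Finset.univ.image I, hyperplane (X i ω)) = ⋂ a, hyperplane (X (I a) ω) := by
    ext; simp
  by_cases hI : Function.Injective I
  · rw [Set.indicator_of_mem (s := {I : Fin (d - k) → ℕ | Function.Injective I}) hI]
    refine Set.indicator_one_congr ?_
    rw [← isFlat_and_nonempty_iff (show d = k + (d - k) by omega), ← h]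
    exact and_iff_right hI
  · rw [Set.indicator_of_notMem (s := {I : Fin (d - k) → ℕ | Function.Injective I}) hI]
    exact Set.indicator_of_notMem (fun h => hI h.1) _

lemma toNat_flatCount_eq {Ω : Type*} (X : ℕ → Ω → ℝ × UnitSphere d) {k : ℕ} (hk : k ≤ d)
    (r : ℝ) (ω : Ω) :
    ((flatCount X k r ω).toNat : ℝ) = (tupleSum X (Fin (d - k))
      ((flatSet (EuclideanSpace ℝ (Fin d)) r (d - k)).indicator 1) ω).toReal / ((d - k)! : ℝ) := by
  rw [← factorial_mul_flatCount X hk, ENNReal.toReal_mul, ENNReal.toReal_natCast,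
    mul_div_cancel_left₀ _ (by positivity)]
  -- In the infinite case both sides are zero, by the default values of `toNat` and `toReal` at
  -- infinity.
  cases flatCount X k r ω <;> simp

end Count

/-! ### The delta method and normal quantiles -/

section Delta

variable {Ω Ω' : Type*} [MeasurableSpace Ω] [MeasurableSpace Ω'] {P : Measure Ω}
  [IsProbabilityMeasure P] {P' : Measure Ω'} [IsProbabilityMeasure P']

/-- The delta method. -/
theorem tendstoInDistribution_delta {l : Filter ℝ} [l.IsCountablyGenerated] {s : ℝ → ℝ}
    (hs : Tendsto (fun r => (s r)⁻¹) l (𝓝 0)) {ρ : ℝ → Ω → ℝ} {Z : Ω' → ℝ} {x : ℝ}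
    (h : TendstoInDistribution (fun r ω => s r * (ρ r ω - x)) l Z (fun _ => P) P')
    {g : ℝ → ℝ} (hg : Continuous g) {g' : ℝ} (hg' : HasDerivAt g g' x) :
    TendstoInDistribution (fun r ω => s r * (g (ρ r ω) - g x)) l (fun ω => g' * Z ω)
      (fun _ => P) P' := by
  -- With `Y = s (ρ - x)`, the transformed quantity is `Y · dslope g x (x + Y s⁻¹)`. Since the slope
  -- is continuous and `s⁻¹ → 0`, Slutsky's theorem applies.
  have hc : Continuous (dslope g x) := by
    rw [← continuousOn_univ, continuousOn_dslope univ_mem]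
    exact ⟨hg.continuousOn, hg'.differentiableAt⟩
  have hh : Continuous fun p : ℝ × ℝ => p.1 * dslope g x (x + p.2 * p.1) := by fun_prop
  have hconst : TendstoInMeasure P (fun r (_ : Ω) => (s r)⁻¹) l fun _ => 0 := by
    rw [tendstoInMeasure_iff_norm]
    intro ε hε
    refine tendsto_const_nhds.congr' ?_
    filter_upwards [hs.norm.eventually_lt_const (u := ε) (by simpa using hε)] with r hr
    symm
    convert! measure_empty (μ := P)
    rw [Set.eq_empty_iff_forall_notMem]
    intro ω hω
    simp only [sub_zero, Set.mem_ofPred_eq] at hω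
    linarith
  have h1 := h.continuous_comp_prodMk_of_tendstoInMeasure_const hh hconst
    (fun _ => aemeasurable_const)
  refine h1.congr (fun r => ae_of_all _ fun ω => ?_) (ae_of_all _ fun ω => ?_)
  · simp only
    rcases eq_or_ne (s r) 0 with h0 | h0
    · simp [h0]
    · rw [inv_mul_cancel_left₀ h0, add_sub_cancel, mul_assoc, ← smul_eq_mul (ρ r ω - x),
        sub_smul_dslope]
  · simp only [zero_mul, add_zero, dslope_same, hg'.deriv]
    ring

/-- Chebyshev's inequality. -/
lemma tendstoInMeasure_zero_of_integral_sq_le {R : ℝ → Ω → ℝ} {C r₀ : ℝ}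
    (hR : ∀ r ≥ r₀, Integrable (fun ω => R r ω ^ 2) P ∧ ∫ ω, R r ω ^ 2 ∂P ≤ C / r) :
    TendstoInMeasure P R atTop 0 := by
  rw [tendstoInMeasure_iff_measureReal_norm]
  intro ε hε
  have hlim : Tendsto (fun r : ℝ => C / r / ε ^ 2) atTop (𝓝 0) := by
    have := (tendsto_const_nhds (x := C)).div_atTop tendsto_id (l := (atTop : Filter ℝ))
    simpa using this.div_const (ε ^ 2)
  refine tendsto_of_tendsto_of_tendsto_of_le_of_le' tendsto_const_nhds hlim
    (Eventually.of_forall fun r => measureReal_nonneg) ?_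
  filter_upwards [eventually_ge_atTop r₀] with r hr
  obtain ⟨h1, h2⟩ := hR r hr
  have h3 := mul_meas_ge_le_integral_of_nonneg (ae_of_all _ fun ω => sq_nonneg (R r ω)) h1 (ε ^ 2)
  rw [le_div_iff₀ (by positivity), mul_comm]
  refine (mul_le_mul_of_nonneg_left (measureReal_mono ?_) (by positivity)).trans (h3.trans h2)
  intro ω hω
  simp only [Pi.zero_apply, sub_zero, Set.mem_ofPred_eq, Real.norm_eq_abs] at hω ⊢
  rw [← sq_abs (R r ω)]
  gcongr

end Delta

section Quantile

lemma continuous_cdf (μ : Measure ℝ) [IsProbabilityMeasure μ] [NullSingletonClass μ] :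
    Continuous (cdf μ) := by
  refine continuous_iff_continuousAt.2 fun x => ?_
  rw [(monotone_cdf μ).continuousAt_iff_leftLim_eq_rightLim, StieltjesFunction.rightLim_eq]
  have h := StieltjesFunction.measure_singleton (cdf μ) x
  rw [measure_cdf, measure_singleton, eq_comm, ENNReal.ofReal_eq_zero, sub_nonpos] at h
  exact le_antisymm ((monotone_cdf μ).leftLim_le le_rfl) h

/-- Without atoms the distribution function is continuous, so it attains `q`, and the infimum
belongs to the closed superlevel set. -/
lemma cdf_sInf_eq {μ : Measure ℝ} [IsProbabilityMeasure μ] [NullSingletonClass μ] {q : ℝ} (hq0 : 0 < q)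
    (hq1 : q < 1) : cdf μ (sInf {x : ℝ | q ≤ cdf μ x}) = q := by
  have hc := continuous_cdf μ
  obtain ⟨u, hu⟩ := ((tendsto_cdf_atBot μ).eventually_lt_const hq0).exists
  obtain ⟨v, hv⟩ := ((tendsto_cdf_atTop μ).eventually_const_lt hq1).exists
  have hbdd : BddBelow {x : ℝ | q ≤ cdf μ x} :=
    ⟨u, fun x hx => le_of_not_gt fun h => (hx.trans (monotone_cdf μ h.le)).not_gt hu⟩
  have huv : u ≤ v := le_of_not_gt fun h => ((monotone_cdf μ h.le).trans_lt hu).not_gt hv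
  obtain ⟨w, -, hw⟩ := intermediate_value_Icc huv hc.continuousOn ⟨hu.le, hv.le⟩
  refine le_antisymm ?_ ?_
  · exact (monotone_cdf μ (csInf_le hbdd hw.ge)).trans hw.le
  · exact (isClosed_le continuous_const hc).csInf_mem ⟨v, hv.le⟩ hbdd

lemma gaussianReal_real_Ici_neg (z : ℝ) :
    (gaussianReal 0 1).real (Set.Ici (-z)) = cdf (gaussianReal 0 1) z := by
  have h := gaussianReal_map_neg (μ := 0) (v := 1)
  rw [neg_zero] at h
  rw [cdf_eq_real, measureReal_def, measureReal_def]
  conv_rhs => rw [← h, Measure.map_apply measurable_neg measurableSet_Iic]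
  congr 2
  ext x
  simp

lemma gaussianReal_real_Iio_neg (z : ℝ) :
    (gaussianReal 0 1).real (Set.Iio (-z)) = 1 - cdf (gaussianReal 0 1) z := by
  rw [← gaussianReal_real_Ici_neg, ← Set.compl_Ici, probReal_compl_eq_one_sub measurableSet_Ici]

variable {α : ℝ}

/-- By symmetry the distribution function equals `1/2` at `0`, which is less than `1 - α/2`. -/
lemma stdNormalQuantile_pos (h0 : 0 < α) (h1 : α < 1) : 0 < stdNormalQuantile (1 - α / 2) := by
  have : NullSingletonClass (gaussianReal 0 1) := nullSingletonClass_gaussianReal one_ne_zero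
  have hz := cdf_sInf_eq (μ := gaussianReal 0 1) (q := 1 - α / 2) (by linarith) (by linarith)
  rw [← stdNormalQuantile] at hz
  by_contra! h
  have h2 := gaussianReal_real_Ici_neg 0
  have h3 := gaussianReal_real_Iio_neg 0
  have h4 := monotone_cdf (gaussianReal 0 1) h
  rw [neg_zero] at h3
  have h5 : cdf (gaussianReal 0 1) 0 = (gaussianReal 0 1).real (Set.Iio 0) := by
    rw [cdf_eq_real]
    exact measureReal_congr Iio_ae_eq_Iic.symm
  linarith

lemma gaussianReal_real_Icc_quantile (h0 : 0 < α) (h1 : α < 1) :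
    (gaussianReal 0 1).real
      (Set.Icc (-stdNormalQuantile (1 - α / 2)) (stdNormalQuantile (1 - α / 2))) = 1 - α := by
  have : NullSingletonClass (gaussianReal 0 1) := nullSingletonClass_gaussianReal one_ne_zero
  have hz := cdf_sInf_eq (μ := gaussianReal 0 1) (q := 1 - α / 2) (by linarith) (by linarith)
  rw [← stdNormalQuantile] at hz
  have hpos := stdNormalQuantile_pos h0 h1
  set z := stdNormalQuantile (1 - α / 2)
  have h2 : Set.Icc (-z) z = Set.Iic z \ Set.Iio (-z) := by
    ext x
    simp [and_comm]
  have h3 : Set.Iio (-z) ⊆ Set.Iic z := fun x hx => by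
    simp only [Set.mem_Iio, Set.mem_Iic] at hx ⊢
    linarith
  rw [h2, measureReal_sdiff h3 measurableSet_Iio, gaussianReal_real_Iio_neg,
    ← cdf_eq_real, hz]
  ring

/-- The portmanteau theorem for `[-z, z]`, whose two boundary points are null for the normal law. -/
lemma tendsto_measureReal_abs_le {Ω : Type*} [MeasurableSpace Ω] {P : Measure Ω}
    [IsProbabilityMeasure P] {Z : ℝ → Ω → ℝ}
    (h : TendstoInDistribution Z atTop (fun x : ℝ => x) (fun _ => P) (gaussianReal 0 1))
    (h0 : 0 < α) (h1 : α < 1) :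
    Tendsto (fun r => P.real {ω | |Z r ω| ≤ stdNormalQuantile (1 - α / 2)}) atTop
      (𝓝 (1 - α)) := by
  have : NullSingletonClass (gaussianReal 0 1) := nullSingletonClass_gaussianReal one_ne_zero
  have hpos := stdNormalQuantile_pos h0 h1
  rw [← gaussianReal_real_Icc_quantile h0 h1]
  set z := stdNormalQuantile (1 - α / 2)
  have h2 := ProbabilityMeasure.tendsto_measure_of_null_frontier_of_tendsto' h.tendsto
    (E := Set.Icc (-z) z) (by
      simp only [ProbabilityMeasure.coe_mk, Measure.map_id']
      rw [frontier_Icc (by linarith)]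
      exact (Set.toFinite {-z, z}).measure_zero _)
  simp only [ProbabilityMeasure.coe_mk, Measure.map_id'] at h2
  have h3 := (ENNReal.tendsto_toReal (measure_ne_top (gaussianReal 0 1) (Set.Icc (-z) z))).comp h2
  refine (h3.congr fun r => ?_)
  simp only [Function.comp]
  rw [Measure.map_apply_of_aemeasurable (h.forall_aemeasurable r) measurableSet_Icc, measureReal_def]
  congr 2
  ext ω
  simp [abs_le]

end Quantile

/-! ### Asymptotic normality of the number of flats -/

/-- A hyperplane meeting the ball has offset at most `r` in absolute value. This bounds the kernel
by a window of intensity `2 λ r`. -/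
lemma hitSet_top_indicator_le {E : Type*} [NormedAddCommGroup E] [InnerProductSpace ℝ E] {r : ℝ} {m : ℕ}
    (x : Fin m → ℝ × Metric.sphere (0 : E) 1) :
    (hitSet (⊤ : Submodule ℝ E) 0 r m).indicator
      (1 : (Fin m → ℝ × Metric.sphere (0 : E) 1) → ℝ≥0∞) x ≤
      ∏ c, (Set.Icc (-r) r ×ˢ Set.univ).indicator
        (1 : ℝ × Metric.sphere (0 : E) 1 → ℝ≥0∞) (x c) := by
  by_cases hx : x ∈ hitSet (⊤ : Submodule ℝ E) 0 r m
  · have h : ∀ c, x c ∈ Set.Icc (-r) r ×ˢ (Set.univ : Set (Metric.sphere (0 : E) 1)) := by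
      intro c
      obtain ⟨y, hy, h⟩ := mem_hitSet_top_iff.1 hx
      refine ⟨abs_le.1 ?_, trivial⟩
      rw [← h c]
      refine (abs_real_inner_le_norm _ _).trans ?_
      rwa [norm_eq_of_mem_sphere, mul_one]
    rw [Set.indicator_of_mem hx, Finset.prod_congr rfl fun c _ => Set.indicator_of_mem (h c) _]
    simp
  · rw [Set.indicator_of_notMem hx]
    exact bot_le

section HitCount

variable {E : Type*} [NormedAddCommGroup E] [InnerProductSpace ℝ E] [FiniteDimensional ℝ E]
  [MeasurableSpace E] [BorelSpace E] {Θ : Measure (Metric.sphere (0 : E) 1)}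
  {lam : ℝ} {Ω : Type*} [MeasurableSpace Ω] {P : Measure Ω}
  {X : ℕ → Ω → ℝ × Metric.sphere (0 : E) 1}

/-- The number of ordered tuples of distinct hyperplanes whose intersection meets a ball. -/
def hitCount (X : ℕ → Ω → ℝ × Metric.sphere (0 : E) 1) (m : ℕ) (r : ℝ) : Ω → ℝ≥0∞ :=
  tupleSum X (Fin m) ((hitSet (⊤ : Submodule ℝ E) 0 r m).indicator 1)

lemma measurable_hitCount (h : IsPoissonProcess X (markedLebesgue lam Θ) P) (m : ℕ) (r : ℝ) :
    Measurable (hitCount X m r) :=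
  measurable_tupleSum h.measurable (measurable_one.indicator (measurableSet_hitSet _ _ _ _))

variable [IsProbabilityMeasure Θ]

/-- By the Mecke formula the number of exceptional tuples has mean zero, so almost surely there are
none. The condition of general position can then be dropped from the kernel. -/
lemma tupleSum_flatSet_ae_eq (h : IsPoissonProcess X (markedLebesgue lam Θ) P) (hlam : 0 < lam)
    (m : ℕ) (r : ℝ) :
    tupleSum X (Fin m) ((flatSet E r m).indicator 1) =ᵐ[P] hitCount X m r := by
  let D := hitSet (⊤ : Submodule ℝ E) 0 r m \ flatSet E r m
  have hD : MeasurableSet D :=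
    (measurableSet_hitSet _ _ _ _).diff (measurableSet_flatSet r m)
  have hDm : Measurable (D.indicator (1 : (Fin m → ℝ × Metric.sphere (0 : E) 1) → ℝ≥0∞)) :=
    measurable_one.indicator hD
  have h0 : ∫⁻ ω, tupleSum X (Fin m) (D.indicator 1) ω ∂P = 0 := by
    rw [h.lintegral_tupleSum hDm, lintegral_indicator_one hD]
    exact measure_hitSet_diff_flatSet hlam r m
  rw [lintegral_eq_zero_iff (measurable_tupleSum h.measurable hDm)] at h0
  filter_upwards [h0] with ω hω
  have hsub : flatSet E r m ⊆ hitSet (⊤ : Submodule ℝ E) 0 r m := Set.inter_subset_right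
  rw [Pi.zero_apply, tupleSum, ENNReal.tsum_eq_zero] at hω
  rw [tupleSum, hitCount, tupleSum]
  refine tsum_congr fun I => ?_
  by_cases hI : Function.Injective I
  · have h1 := hω I
    rw [Set.indicator_of_mem (s := {I : Fin m → ℕ | Function.Injective I}) hI] at h1 ⊢
    rw [Set.indicator_of_mem (s := {I : Fin m → ℕ | Function.Injective I}) hI]
    rw [Set.indicator_apply_eq_zero] at h1
    refine Set.indicator_one_congr ⟨fun hx => hsub hx, fun hx => ?_⟩
    by_contra hx'
    exact one_ne_zero (h1 ⟨hx, hx'⟩)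
  · rw [Set.indicator_of_notMem (s := {I : Fin m → ℕ | Function.Injective I}) hI,
      Set.indicator_of_notMem (s := {I : Fin m → ℕ | Function.Injective I}) hI]

lemma lintegral_hitCount (h : IsPoissonProcess X (markedLebesgue lam Θ) P) {γ : ℕ → ℝ}
    (hγ : ∀ n, 0 ≤ γ n) (hlam : 0 ≤ lam)
    (hΘ : ∀ W : Submodule ℝ E, ∫⁻ v, ENNReal.ofReal ‖W.starProjection (v : E)‖ ∂Θ =
      ENNReal.ofReal (γ (Module.finrank ℝ W))) (m : ℕ) {r : ℝ} (hr : 0 ≤ r) :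
    ∫⁻ ω, hitCount X m r ω ∂P =
      ENNReal.ofReal (lam ^ m * hitConst γ (Module.finrank ℝ E) m * r ^ m) := by
  have hm := measurableSet_hitSet (⊤ : Submodule ℝ E) 0 r m
  rw [← finrank_top ℝ E, ← measure_hitSet hγ hlam hΘ m ⊤ 0 hr, ← lintegral_indicator_one hm]
  exact h.lintegral_tupleSum (measurable_one.indicator hm)

/-- The asymptotic normality of the number of tuples of hyperplanes meeting a ball. -/
theorem tendstoInDistribution_hitCount [IsProbabilityMeasure P]
    (h : IsPoissonProcess X (markedLebesgue lam Θ) P) {γ : ℕ → ℝ}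
    (hγ : ∀ n, 0 ≤ γ n) (hlam : 0 < lam)
    (hΘ : ∀ W : Submodule ℝ E, ∫⁻ v, ENNReal.ofReal ‖W.starProjection (v : E)‖ ∂Θ =
      ENNReal.ofReal (γ (Module.finrank ℝ W))) (hγE : γ (Module.finrank ℝ E) = 1) {m : ℕ}
    (hm : 0 < m) (hpos : 0 < hitConst γ (Module.finrank ℝ E) m) :
    TendstoInDistribution (fun r ω => √(lam * r) * ((hitCount X m r ω).toReal /
      (lam ^ m * hitConst γ (Module.finrank ℝ E) m * r ^ m) - 1)) atTop
      (fun x : ℝ => 2 * m * bConst m * x) (fun _ => P) (gaussianReal 0 1) := by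
  obtain ⟨n, rfl⟩ : ∃ n, m = n + 1 := ⟨m - 1, by omega⟩
  rw [Nat.cast_add_one]
  set A := hitConst γ (Module.finrank ℝ E - 1) n with hA
  have hH : hitConst γ (Module.finrank ℝ E) (n + 1) = capIntegral n * A := by
    rw [hitConst, hγE, one_mul]
  rw [hH] at hpos ⊢
  have hc1 := capIntegral_pos n
  have hc2 := capIntegral_pos (2 * n)
  have hApos : 0 < A := pos_of_mul_pos_right hpos hc1.le
  let ψ : ℝ → ℝ := fun s => √(1 - s ^ 2) ^ n
  have hψ : Measurable ψ := by fun_prop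
  have hψ1 : ∀ s, |ψ s| ≤ 1 := fun s => by
    rw [abs_of_nonneg (by positivity)]
    refine pow_le_one₀ (Real.sqrt_nonneg _) ?_
    exact Real.sqrt_le_iff.2 ⟨zero_le_one, by nlinarith [sq_nonneg s]⟩
  have hψ2 : ∫ s in (-1 : ℝ)..1, ψ s ^ 2 = capIntegral (2 * n) := by
    refine intervalIntegral.integral_congr fun s _ => ?_
    simp only [ψ]
    rw [← pow_mul, mul_comm]
  have hψ3 : ∫ s in (-1 : ℝ)..1, ψ s = capIntegral n := rfl
  have hclt := h.tendstoInDistribution_tsum hlam hψ hψ1 (by rw [hψ2]; exact hc2)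
  rw [hψ2, hψ3] at hclt
  have hclt' := hclt.continuous_comp (g := fun x : ℝ => 2 * (n + 1) * bConst (n + 1) * x)
    (by fun_prop)
  -- The projection already has the desired limit, so only the normalized remainder must vanish in
  -- probability.
  refine tendstoInDistribution_of_tendstoInMeasure_sub _ _ hclt' ?_ fun r =>
    ((((measurable_hitCount h (n + 1) r).ennreal_toReal).div_const _).sub_const 1
      |>.const_mul _).aemeasurable
  set C : ℝ := (n + 1) ^ 4 * ((2 * n)! * Real.exp 2 * (2 * lam) ^ (2 * n)) * lam /
    (lam ^ (n + 1) * (capIntegral n * A)) ^ 2 with hC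
  -- For `r ≥ 1/(2λ)` the window has intensity at least `1`, as the moment bound requires. The
  -- remainder is of order `r · r^{2n} / r^{2n+2} = 1/r`.
  refine tendstoInMeasure_zero_of_integral_sq_le (C := C) (r₀ := 1 / (2 * lam)) fun r hr => ?_
  have hr0 : 0 < r := lt_of_lt_of_le (by positivity) hr
  set M := lam ^ (n + 1) * (capIntegral n * A) * r ^ (n + 1) with hM
  have hMpos : 0 < M := by positivity
  have ht : 1 ≤ 2 * lam * r := by
    rw [ge_iff_le, div_le_iff₀ (by positivity)] at hr
    linarith
  have hWt : markedLebesgue lam Θ (Set.Icc (-r) r ×ˢ Set.univ) = ENNReal.ofReal (2 * lam * r) := by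
    rw [markedLebesgue, Measure.prod_prod, Measure.smul_apply, Real.volume_Icc, measure_univ,
      mul_one, smul_eq_mul, ← ENNReal.ofReal_mul hlam.le]
    ring_nf
  have hWm : MeasurableSet (Set.Icc (-r) r ×ˢ (Set.univ : Set (Metric.sphere (0 : E) 1))) :=
    measurableSet_Icc.prod MeasurableSet.univ
  have hfm : Measurable ((hitSet (⊤ : Submodule ℝ E) 0 r (n + 1)).indicator
      (1 : (Fin (n + 1) → ℝ × Metric.sphere (0 : E) 1) → ℝ≥0∞)) :=
    measurable_one.indicator (measurableSet_hitSet _ _ _ _)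
  have hgm : Measurable fun x : ℝ × Metric.sphere (0 : E) 1 =>
      ENNReal.ofReal (√(1 - (x.1 / r) ^ 2) ^ n) := by fun_prop
  let f₁ : ℝ × Metric.sphere (0 : E) 1 → ℝ≥0∞ := fun y =>
    ENNReal.ofReal (lam ^ n * A * r ^ n) *
      (Set.Icc (-r) r ×ˢ Set.univ).indicator
        (fun x : ℝ × Metric.sphere (0 : E) 1 => ENNReal.ofReal (√(1 - (x.1 / r) ^ 2) ^ n)) y
  have hf₁m : Measurable f₁ := (hgm.indicator hWm).const_mul _
  have hf₁ := fun a y => lintegral_insertNth_hitSet (n := n) hγ hlam.le hΘ a y hr0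
  have hf₁int : ∫⁻ y, f₁ y ∂(markedLebesgue lam Θ) = ENNReal.ofReal M := by
    have h1 := lintegral_pi_insertNth (Λ := markedLebesgue lam Θ) (0 : Fin (n + 1))
      (F := fun y z => (hitSet (⊤ : Submodule ℝ E) 0 r (n + 1)).indicator
        (1 : (Fin (n + 1) → ℝ × Metric.sphere (0 : E) 1) → ℝ≥0∞) (Fin.insertNth 0 y z))
        (hfm.comp (measurable_insertNth 0))
    simp only [Fin.insertNth_self_removeNth] at h1
    simp_rw [hf₁] at h1
    rw [← h1, lintegral_indicator_one (measurableSet_hitSet _ _ _ _),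
      measure_hitSet hγ hlam.le hΘ (n + 1) ⊤ 0 hr0.le, finrank_top, hH]
  have hS : ∀ ω, (∑' i, f₁ (X i ω)).toReal = lam ^ n * A * r ^ n *
      ∑' i, (Set.Icc (-r) r ×ˢ Set.univ).indicator
        (fun x : ℝ × Metric.sphere (0 : E) 1 => ψ (x.1 / r)) (X i ω) := by
    intro ω
    simp only [f₁]
    rw [ENNReal.tsum_mul_left, ENNReal.toReal_mul, ENNReal.toReal_ofReal (by positivity),
      ENNReal.tsum_toReal_eq]
    · congr 1
      refine tsum_congr fun i => ?_
      by_cases hi : X i ω ∈ Set.Icc (-r) r ×ˢ (Set.univ : Set (Metric.sphere (0 : E) 1))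
      · rw [Set.indicator_of_mem hi, Set.indicator_of_mem hi,
          ENNReal.toReal_ofReal (by positivity)]
      · rw [Set.indicator_of_notMem hi, Set.indicator_of_notMem hi, ENNReal.toReal_zero]
    · intro i
      refine ne_top_of_le_ne_top ENNReal.ofReal_ne_top (Set.indicator_le_self _ _ _)
  obtain ⟨hint, hle⟩ := h.integral_sub_projection_sq_le hWm ht hWt hfm
    hitSet_top_indicator_le hf₁m hf₁
  -- The standard deviation of the projection relative to the mean produces `(n+1) √c_{2n} / c_n`,
  -- with `c` the cap integrals, which is `2 (n+1) b_{n+1}`.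
  have hid : ∀ ω, √(lam * r) * ((hitCount X (n + 1) r ω).toReal / M - 1) -
      2 * (n + 1) * bConst (n + 1) * ((∑' i, (Set.Icc (-r) r ×ˢ Set.univ).indicator
        (fun x : ℝ × Metric.sphere (0 : E) 1 => ψ (x.1 / r)) (X i ω) - lam * r * capIntegral n) /
          √(lam * r * capIntegral (2 * n))) =
      √(lam * r) / M * ((hitCount X (n + 1) r ω).toReal - (n + 1) * (∑' i, f₁ (X i ω)).toReal +
        n * (∫⁻ y, f₁ y ∂(markedLebesgue lam Θ)).toReal) := by
    intro ω
    rw [hS, hf₁int, ENNReal.toReal_ofReal hMpos.le, bConst_succ, hM,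
      Real.sqrt_mul (by positivity : 0 ≤ lam * r)]
    have hs1 : 0 < √(lam * r) := Real.sqrt_pos.2 (by positivity)
    have hs2 : 0 < √(capIntegral (2 * n)) := Real.sqrt_pos.2 hc2
    have hs3 : √(lam * r) ^ 2 = lam * r := Real.sq_sqrt (by positivity)
    field_simp
    rw [hs3]
    ring
  simp only [Pi.sub_apply, Function.comp, ← hM, hid, mul_pow]
  refine ⟨hint.const_mul _, ?_⟩
  rw [integral_const_mul]
  refine (mul_le_mul_of_nonneg_left hle (by positivity)).trans (le_of_eq ?_)
  rw [div_pow, Real.sq_sqrt (by positivity), hC, hM]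
  field_simp
  ring

end HitCount

/-! ### Estimation of the intensities -/

/-- The lower endpoint is an even power, so it tests `|u - w| ≤ t` rather than `u - w ≤ t`. The
extra condition `w - u ≤ t` is automatic when `w ≤ t`. -/
lemma pow_mem_Icc_iff_abs_sub_le {m : ℕ} (hm : 0 < m) {t u w : ℝ} (hu : 0 ≤ u) (ht : 0 ≤ t)
    (hw : 0 ≤ w) (hwt : w ≤ t) :
    t ^ (2 * m) ∈ Set.Icc ((u - w) ^ (2 * m)) ((u + w) ^ (2 * m)) ↔ |u - t| ≤ w := by
  have h0 : 2 * m ≠ 0 := by omega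
  rw [Set.mem_Icc, ← Even.pow_abs (even_two_mul m) (u - w),
    pow_le_pow_iff_left₀ (abs_nonneg _) ht h0, pow_le_pow_iff_left₀ ht (by positivity) h0,
    abs_le, abs_le]
  constructor
  · rintro ⟨⟨h1, h2⟩, h3⟩
    constructor <;> linarith
  · rintro ⟨h1, h2⟩
    refine ⟨⟨?_, ?_⟩, ?_⟩ <;> linarith

lemma pow_rpow_half_inv {m : ℕ} (hm : 0 < m) {x : ℝ} (hx : 0 ≤ x) :
    (x ^ m) ^ (1 / (2 * (m : ℝ))) = √x := by
  have : (m : ℝ) ≠ 0 := by exact_mod_cast hm.ne'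
  rw [← Real.rpow_natCast, ← Real.rpow_mul hx, Real.sqrt_eq_rpow]
  congr 1
  field_simp

lemma rpow_half_inv_pow {m : ℕ} (hm : 0 < m) {x : ℝ} (hx : 0 ≤ x) :
    (x ^ (1 / (2 * (m : ℝ)))) ^ (2 * m) = x := by
  have : (m : ℝ) ≠ 0 := by exact_mod_cast hm.ne'
  rw [← Real.rpow_natCast, ← Real.rpow_mul hx]
  push_cast
  rw [one_div_mul_cancel (by positivity), Real.rpow_one]

lemma lambdaHat_nonneg {Ω : Type*} {d k : ℕ} {X : ℕ → Ω → ℝ × UnitSphere d} (r : ℝ) (ω : Ω) :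
    0 ≤ lambdaHat X k r ω :=
  div_nonneg (Nat.cast_nonneg _) measureReal_nonneg

section Flats

variable {Ω : Type*} [MeasurableSpace Ω] {P : Measure Ω} {d k : ℕ} {lam : ℝ}
  {X : ℕ → Ω → ℝ × UnitSphere d}

lemma hitConst_eq_aConst (hk : k < d) :
    hitConst (fun j => gammaRatio j / gammaRatio d) d (d - k) =
      ((d - k)! : ℝ) * (aConst d k * kappa (d - k)) := by
  rw [← hitConst_div_factorial hk]
  field_simp

/-- The mean number of flats of the intersection process that meet a ball. -/
lemma lintegral_flatCount (hk : k < d) (hlam : 0 < lam)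
    (hX : IsPoissonHyperplaneProcess X lam (uniformHemisphere d) P) {r : ℝ} (hr : 0 ≤ r) :
    ∫⁻ ω, (flatCount X k r ω : ℝ≥0∞) ∂P =
      ENNReal.ofReal (aConst d k * lam ^ (d - k) * kappa (d - k) * r ^ (d - k)) := by
  have hd : 0 < d := (Nat.zero_le k).trans_lt hk
  have := isProbabilityMeasure_uniformHemisphere hd
  have hX' : IsPoissonProcess X (markedLebesgue lam (uniformHemisphere d)) P := hX
  have h1 := lintegral_hitCount hX' (γ := fun j => gammaRatio j / gammaRatio d)
    (fun n => div_nonneg (gammaRatio_nonneg _) (gammaRatio_nonneg _)) hlam.le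
    (lintegral_norm_starProjection_uniformHemisphere hd) (d - k) hr
  rw [← lintegral_congr_ae (tupleSum_flatSet_ae_eq hX' hlam (d - k) r),
    finrank_euclideanSpace_fin, hitConst_eq_aConst hk] at h1
  simp_rw [← factorial_mul_flatCount X hk.le] at h1
  rw [lintegral_const_mul' _ _ (ENNReal.natCast_ne_top _),
    show lam ^ (d - k) * (((d - k)! : ℝ) * (aConst d k * kappa (d - k))) * r ^ (d - k) =
      ((d - k)! : ℝ) * (aConst d k * lam ^ (d - k) * kappa (d - k) * r ^ (d - k)) by ring,
    ENNReal.ofReal_mul (by positivity), ENNReal.ofReal_natCast] at h1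
  exact (ENNReal.mul_right_inj (by exact_mod_cast (d - k).factorial_ne_zero)
    (ENNReal.natCast_ne_top _)).1 h1

lemma flatIntensity_eq (hk : k < d) (hlam : 0 < lam)
    (hX : IsPoissonHyperplaneProcess X lam (uniformHemisphere d) P) :
    flatIntensity X P k = aConst d k * lam ^ (d - k) := by
  have ha := aConst_pos hk
  have hκ := kappa_pos (d - k)
  rw [flatIntensity, lintegral_flatCount hk hlam hX zero_le_one,
    ENNReal.toReal_ofReal (by positivity)]
  field_simp
  simp

variable [IsProbabilityMeasure P]

/-- Asymptotic normality of the estimator of the intensity. -/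
lemma tendstoInDistribution_lambdaHat (hk : k < d) (hlam : 0 < lam)
    (hX : IsPoissonHyperplaneProcess X lam (uniformHemisphere d) P) :
    TendstoInDistribution (fun r ω => √(lam * r) *
      (lambdaHat X k r ω / (aConst d k * lam ^ (d - k)) - 1)) atTop
      (fun x : ℝ => 2 * ((d - k : ℕ) : ℝ) * bConst (d - k) * x) (fun _ => P)
      (gaussianReal 0 1) := by
  have hd : 0 < d := (Nat.zero_le k).trans_lt hk
  have hg := gammaRatio_pos hd
  have ha := aConst_pos hk
  have hκ := kappa_pos (d - k)
  have := isProbabilityMeasure_uniformHemisphere hd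
  have hX' : IsPoissonProcess X (markedLebesgue lam (uniformHemisphere d)) P := hX
  have hH := hitConst_eq_aConst hk
  have hflat := fun r ω => toNat_flatCount_eq X hk.le r ω
  have hae := fun r => tupleSum_flatSet_ae_eq hX' hlam (d - k) r
  have hvol := fun r (hr : (0 : ℝ) ≤ r) => volume_real_closedBall (m := d - k) (by omega) hr
  unfold lambdaHat
  have h1 := tendstoInDistribution_hitCount hX' (γ := fun j => gammaRatio j / gammaRatio d)
    (fun n => div_nonneg (gammaRatio_nonneg _) (gammaRatio_nonneg _)) hlam
    (lintegral_norm_starProjection_uniformHemisphere hd)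
    (by rw [finrank_euclideanSpace_fin, div_self hg.ne']) (Nat.sub_pos_of_lt hk)
    (by rw [finrank_euclideanSpace_fin, hH]; positivity)
  rw [finrank_euclideanSpace_fin, hH] at h1
  refine h1.congr (fun r => ?_) (ae_of_all _ fun x => rfl)
  filter_upwards [hae r] with ω hω
  rcases le_or_gt r 0 with hr | hr
  -- For `r ≤ 0` the factor `√(λ r)` is zero by default, so the volume formula is needed for
  -- positive radii only.
  · rw [Real.sqrt_eq_zero_of_nonpos (mul_nonpos_of_nonneg_of_nonpos hlam.le hr), zero_mul,
      zero_mul]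
  · rw [hvol r hr.le, hflat, hω]
    congr 2
    field_simp

/-- Asymptotic normality of the variance-stabilized estimator. -/
lemma tendstoInDistribution_rpow_lambdaHat (hk : k < d) (hlam : 0 < lam)
    (hX : IsPoissonHyperplaneProcess X lam (uniformHemisphere d) P) :
    TendstoInDistribution (fun r ω => √(lam * r) *
      ((lambdaHat X k r ω / (aConst d k * lam ^ (d - k))) ^ (1 / (2 * ((d - k : ℕ) : ℝ))) - 1) /
        bConst (d - k)) atTop (fun x : ℝ => x) (fun _ => P) (gaussianReal 0 1) := by
  have hm : (0 : ℝ) < ((d - k : ℕ) : ℝ) := by exact_mod_cast Nat.sub_pos_of_lt hk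
  have hb := bConst_pos (Nat.sub_pos_of_lt hk)
  have hs : Tendsto (fun r : ℝ => (√(lam * r))⁻¹) atTop (𝓝 0) :=
    tendsto_inv_atTop_zero.comp (Real.tendsto_sqrt_atTop.comp (tendsto_id.const_mul_atTop hlam))
  -- The derivative `1/(2m)` of the power at `1` cancels the factor `2m` of the limiting standard
  -- deviation.
  have h1 := tendstoInDistribution_delta hs (tendstoInDistribution_lambdaHat hk hlam hX)
    (Real.continuous_rpow_const (q := 1 / (2 * ((d - k : ℕ) : ℝ))) (by positivity))
    (Real.hasDerivAt_rpow_const (Or.inl one_ne_zero))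
  simp only [Real.one_rpow] at h1
  refine (h1.continuous_comp (g := fun x : ℝ => x / bConst (d - k)) (by fun_prop)).congr
    (fun r => ae_of_all _ fun ω => rfl) (ae_of_all _ fun x => ?_)
  simp only [Function.comp]
  field_simp

end Flats

end

/-! ### Variance stabilization and the confidence intervals. -/

theorem corollary4p2 {Ω : Type*} [MeasurableSpace Ω] (P : Measure Ω) [IsProbabilityMeasure P]
    (d k : ℕ) (hk : k < d) (lam : ℝ) (hlam : 0 < lam)
    (X : ℕ → Ω → ℝ × UnitSphere d)
    (hX : IsPoissonHyperplaneProcess X lam (uniformHemisphere d) P) :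
    -- `λ_k` is the intensity of `Φ_k`, at every radius
    (∀ r : ℝ, 0 < r → ∫⁻ ω, (flatCount X k r ω : ℝ≥0∞) ∂P =
      ENNReal.ofReal (flatIntensity X P k * kappa (d - k) * r ^ (d - k))) ∧
    -- asymptotic normality of the transformed estimator
    TendstoInDistribution
      (fun (r : ℝ) (ω : Ω) => Real.sqrt r / bConst (d - k) *
        aConst d k ^ (-(1 / (2 * ((d - k : ℕ) : ℝ)))) *
        (lambdaHat X k r ω ^ (1 / (2 * ((d - k : ℕ) : ℝ))) -
          flatIntensity X P k ^ (1 / (2 * ((d - k : ℕ) : ℝ)))))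
      atTop (fun x : ℝ => x) (fun _ => P) (gaussianReal 0 1) ∧
    -- asymptotically exact confidence intervals for `λ_k`
    (∀ α : ℝ, 0 < α → α < 1 →
      Tendsto (fun r : ℝ => P.real {ω | flatIntensity X P k ∈ intervalI X k r α ω})
        atTop (𝓝 (1 - α))) ∧
    -- the relation between `λ` and `λ_k`
    lam = (flatIntensity X P k / aConst d k) ^ (1 / ((d - k : ℕ) : ℝ)) ∧
    -- asymptotically exact confidence intervals for `λ`
    (∀ α : ℝ, 0 < α → α < 1 →
      Tendsto (fun r : ℝ => P.real {ω | lam ∈ intervalJ X k r α ω}) atTop (𝓝 (1 - α))) := by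
  have hm : 0 < d - k := Nat.sub_pos_of_lt hk
  have ha := aConst_pos hk
  have hb := bConst_pos hm
  have hI := flatIntensity_eq hk hlam hX
  have hclt := tendstoInDistribution_rpow_lambdaHat hk hlam hX
  set m := d - k
  set e : ℝ := 1 / (2 * (m : ℝ)) with he
  set a := aConst d k
  set b := bConst m
  have hae : 0 < a ^ e := Real.rpow_pos_of_pos ha e
  have hsl : 0 < √lam := Real.sqrt_pos.2 hlam
  have hlk : (a * lam ^ m) ^ e = a ^ e * √lam := by
    rw [Real.mul_rpow ha.le (by positivity), he, pow_rpow_half_inv hm hlam.le]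
  have hhat : ∀ r ω, lambdaHat X k r ω ^ e =
      a ^ e * √lam * (lambdaHat X k r ω / (a * lam ^ m)) ^ e := by
    intro r ω
    have h0 := lambdaHat_nonneg (X := X) (k := k) r ω
    rw [← hlk, ← Real.mul_rpow (by positivity) (by positivity)]
    congr 1
    field_simp
  have hhat' : ∀ r ω, (lambdaHat X k r ω / a) ^ e =
      √lam * (lambdaHat X k r ω / (a * lam ^ m)) ^ e := by
    intro r ω
    have h0 := lambdaHat_nonneg (X := X) (k := k) r ω
    rw [Real.div_rpow h0 ha.le, hhat]
    field_simp
  have hρ : ∀ r ω, 0 ≤ (lambdaHat X k r ω / (a * lam ^ m)) ^ e := fun r ω =>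
    Real.rpow_nonneg (div_nonneg (lambdaHat_nonneg r ω) (by positivity)) _
  -- For large `r` the half-width is below the target `√λ`, so the even powers in both intervals can
  -- be inverted.
  have hsmall : ∀ α : ℝ, ∀ᶠ r : ℝ in atTop,
      b / √r * stdNormalQuantile (1 - α / 2) ≤ √lam := by
    intro α
    have : Tendsto (fun r : ℝ => b / √r * stdNormalQuantile (1 - α / 2)) atTop (𝓝 0) := by
      simpa using (Real.tendsto_sqrt_atTop.const_div_atTop b).mul_const
        (stdNormalQuantile (1 - α / 2))
    exact this.eventually_le_const hsl
  -- Coverage, for `√λ` as for its multiple `a ^ e * √lam`, becomes the event that the normalized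
  -- statistic is at most the quantile in absolute value.
  have hiff : ∀ r : ℝ, 0 < r → ∀ ω z,
      |√lam * (lambdaHat X k r ω / (a * lam ^ m)) ^ e - √lam| ≤ b / √r * z ↔
      |√(lam * r) * ((lambdaHat X k r ω / (a * lam ^ m)) ^ e - 1) / b| ≤ z := by
    intro r hr ω z
    have hsr : 0 < √r := Real.sqrt_pos.2 hr
    rw [abs_div, abs_of_pos hb, div_le_iff₀ hb, Real.sqrt_mul hlam.le, abs_mul,
      abs_of_pos (mul_pos hsl hsr), ← mul_sub_one, abs_mul, abs_of_pos hsl,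
      div_mul_eq_mul_div, le_div_iff₀ hsr]
    ring_nf
  refine ⟨fun r hr => ?_, ?_, fun α h0 h1 => ?_, ?_, fun α h0 h1 => ?_⟩
  · rw [hI, lintegral_flatCount hk hlam hX hr.le]
  · refine hclt.congr (fun r => ae_of_all _ fun ω => ?_) (ae_of_all _ fun x => rfl)
    simp only
    rw [hI, hlk, hhat, Real.rpow_neg ha.le, Real.sqrt_mul hlam.le]
    field_simp
  · refine (tendsto_measureReal_abs_le hclt h0 h1).congr' ?_
    filter_upwards [hsmall α, eventually_gt_atTop 0] with r hr hr0
    have hz := stdNormalQuantile_pos h0 h1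
    congr 1
    ext ω
    have hmem := pow_mem_Icc_iff_abs_sub_le hm (t := a ^ e * √lam) (u := lambdaHat X k r ω ^ e)
      (w := a ^ e * b / √r * stdNormalQuantile (1 - α / 2))
      (Real.rpow_nonneg (lambdaHat_nonneg r ω) _) (by positivity) (by positivity)
      (by rw [mul_div_assoc, mul_assoc]; exact mul_le_mul_of_nonneg_left hr hae.le)
    rw [← hlk, he, rpow_half_inv_pow hm (by positivity), ← he, hlk, hhat] at hmem
    simp only [Set.mem_ofPred_eq]
    rw [← hiff r hr0, hI, intervalI, hhat]
    refine Iff.trans ?_ hmem.symm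
    rw [mul_assoc, ← mul_sub, abs_mul, abs_of_pos hae, mul_div_assoc, mul_assoc (a ^ e),
      mul_le_mul_iff_right₀ hae]
  · rw [hI, mul_div_cancel_left₀ _ ha.ne', ← Real.rpow_natCast, ← Real.rpow_mul hlam.le,
      mul_one_div_cancel (by exact_mod_cast hm.ne'), Real.rpow_one]
  · refine (tendsto_measureReal_abs_le hclt h0 h1).congr' ?_
    filter_upwards [hsmall α, eventually_gt_atTop 0] with r hr hr0
    have hz := stdNormalQuantile_pos h0 h1
    congr 1
    ext ω
    have hmem := pow_mem_Icc_iff_abs_sub_le one_pos (t := √lam)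
      (u := (lambdaHat X k r ω / a) ^ e) (w := b / √r * stdNormalQuantile (1 - α / 2))
      (Real.rpow_nonneg (div_nonneg (lambdaHat_nonneg r ω) ha.le) _) hsl.le (by positivity) hr
    rw [mul_one, Real.sq_sqrt hlam.le] at hmem
    simp only [Set.mem_ofPred_eq]
    rw [← hiff r hr0, ← hhat']
    exact hmem.symm
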